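/- A graph here has a reflexive symmetric edge relation. A rooted tree is a finite tree with at least two vertices and a distinguished root $r$, ordered by $x\le y$ iff the arc from $r$ to $y$ contains $x$. An epimorphism $f\colon S\to T$ of rooted trees maps edges to edges, is surjective on vertices and on edges, preserves the root and preserves $\le$. It is confluent if for every connected vertex set $Q$ of $T$ every component of $f^{-1}(Q)$ is mapped onto $Q$, and light if no two distinct vertices of the same fibre are joined by an edge. A splitting edge map is an epimorphism $S\to T$ where $S$ is obtained from $T$ by replacing an edge $\langle a,b\rangle$ by $\langle a,x\rangle,\langle x,b\rangle$ with a new vertex $x$ (with the same root), which maps $x$ to $a$ or to $b$ and is the identity on $T$. An adding edge map is an epimorphism $S\to T$ where $S$ is obtained from $T$ by adding a new vertex $y$ and an edge $\langle v,y\rangle$ (with the same root), which maps $y$ to $v$ and is the identity on $T$. An epimorphism is simple*-confluent if it is a finite composition of splitting edge maps, adding edge maps and light confluent epimorphisms. Let $\mathcal T_{\mathcal C}$ be the family of all rooted trees with the simple*-confluent epimorphisms. For an inverse sequence $\{F_n,\alpha_n\}$ in $\mathcal T_{\mathcal C}$, let $\mathbb T=\varprojlim\{F_n,\alpha_n\}$,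 a compact zero-dimensional metrizable space in which $\langle x,y\rangle$ is an edge iff $\langle x_n,y_n\rangle$ is an edge of $F_n$ for all $n$. Call a map $h\colon\mathbb T\to A$ onto a rooted tree $A$ admissible if $h=h'\circ\alpha_m^\infty$ for some $m$ and some simple*-confluent $h'\colon F_m\to A$, where $\alpha_m^\infty\colon\mathbb T\to F_m$ is the projection. $\mathbb T$ is a projective Fraïssé limit of $\mathcal T_{\mathcal C}$ if (1) every rooted tree is the image of an admissible map; (2) for every admissible $f\colon\mathbb T\to A$ and simple*-confluent $g\colon B\to A$ there is an admissible $h\colon\mathbb T\to B$ with $f=g\circ h$; (3) for every $\varepsilon>0$ some admissible map has all fibres of diameter less than $\varepsilon$. **Theorem.** A projective Fraïssé limit $\mathbb T_{\mathcal C}$ of $\mathcal T_{\mathcal C}$ exists. For every such limit the edge relation is transitive (hence an equivalence relation), and the topological realization $|\mathbb T_{\mathcal C}|$, i.e. the quotient of $\mathbb T_{\mathcal C}$ by its edge relation, is a dendroid (a compact connected metrizable space that is arcwise connected and in which the intersection of any two subcontinua is connected) which is Kelley and smooth. Its endpoints are dense, and every point of it is an endpoint or a ramification point in the classical sense. Here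 a continuum $X$ is Kelley if for every subcontinuum $K$, every $p\in K$ and every sequence $p_n\to p$ there are subcontinua $K_n\ni p_n$ with $K_n\to K$ in the Hausdorff metric. A dendroid is smooth if for some point $p$, $x_n\to x$ implies that the arcs $[p,x_n]$ converge to $[p,x]$. A point $p$ is an endpoint in the classical sense if it is an endpoint of every arc containing it, and a ramification point in the classical sense if there are three arcs $A,B,C$ with $A\cap B=A\cap C=B\cap C=\{p\}$. -/

import Mathlib

open Set Filter Topology TopologicalSpace

/-! ## Finite rooted trees and their epimorphisms

The graphs considered carry a reflexive symmetric edge relation; a finite tree is therefore given by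
the `SimpleGraph` of its non-degenerate edges, and `FinRootedTree.Edge` is the reflexive relation. -/

/-- A finite rooted tree with at least two vertices. -/
structure FinRootedTree where
  V : Type
  finite : Finite V
  nontrivial : Nontrivial V
  graph : SimpleGraph V
  isTree : graph.IsTree
  root : V

namespace FinRootedTree

/-- The (reflexive, symmetric) edge relation. -/
def Edge (T : FinRootedTree) (a b : T.V) : Prop := a = b ∨ T.graph.Adj a b

/-- The tree order: `x ≤ y` iff the arc from the root to `y` contains `x`. -/
def le (T : FinRootedTree) (x y : T.V) : Prop :=
  ∃ p : T.graph.Walk T.root y, p.IsPath ∧ x ∈ p.support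

/-- Vertex sets of finite trees carry the discrete topology. -/
instance (T : FinRootedTree) : TopologicalSpace T.V := ⊥

instance (T : FinRootedTree) : DiscreteTopology T.V := ⟨rfl⟩

/-- Epimorphisms of rooted trees: surjective on vertices and on edges, mapping edges to edges,
preserving the root and the tree order. -/
structure IsEpi (S T : FinRootedTree) (f : S.V → T.V) : Prop where
  map_edge : ∀ a b, S.Edge a b → T.Edge (f a) (f b)
  surj : Function.Surjective f
  surj_edge : ∀ u v, T.Edge u v → ∃ a b, S.Edge a b ∧ f a = u ∧ f b = v
  map_root : f S.root = T.root
  map_le : ∀ a b, S.le a b → T.le (f a) (f b)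

/-- `f` is confluent: for every connected set `Q` of vertices of `T` and every vertex `a` with
`f a ∈ Q` there is a connected set `C` containing `a` with `f(C) = Q`. -/
def IsConfluent (S T : FinRootedTree) (f : S.V → T.V) : Prop :=
  ∀ Q : Set T.V, (T.graph.induce Q).Connected → ∀ a : S.V, f a ∈ Q →
    ∃ C : Set S.V, (S.graph.induce C).Connected ∧ a ∈ C ∧ f '' C = Q

/-- `f` is light: no two distinct vertices in the same fibre are joined by an edge. -/
def IsLight (S T : FinRootedTree) (f : S.V → T.V) : Prop :=
  ∀ a b, S.graph.Adj a b → f a ≠ f b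

/-- `f : S → T` is a splitting edge map: `S` is obtained from `T` (embedded in `S` by `ι`) by
replacing one edge `⟨a, b⟩` by the two edges `⟨a, x⟩`, `⟨x, b⟩`, where `x` is a new vertex; the root
is unchanged, `f` is the identity on `T`, and it maps `x` to `a` or to `b`. -/
def IsSplittingEdge (S T : FinRootedTree) (f : S.V → T.V) : Prop :=
  IsEpi S T f ∧ ∃ (ι : T.V → S.V) (x : S.V) (a b : T.V),
    Function.Injective ι ∧ range ι = {x}ᶜ ∧ ι T.root = S.root ∧ T.graph.Adj a b ∧
    (∀ u v, S.graph.Adj (ι u) (ι v) ↔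
      (T.graph.Adj u v ∧ ¬ (u = a ∧ v = b) ∧ ¬ (u = b ∧ v = a))) ∧
    (∀ u, S.graph.Adj x (ι u) ↔ (u = a ∨ u = b)) ∧
    (∀ u, f (ι u) = u) ∧ (f x = a ∨ f x = b)

/-- `f : S → T` is an adding edge map: `S` is obtained from `T` (embedded in `S` by `ι`) by adding a
new vertex `y` and an edge `⟨v, y⟩` for some `v` in `T`; the root is unchanged, `f` is the identity
on `T`, and it maps `y` to `v`. -/
def IsAddingEdge (S T : FinRootedTree) (f : S.V → T.V) : Prop :=
  IsEpi S T f ∧ ∃ (ι : T.V → S.V) (y : S.V) (v : T.V),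
    Function.Injective ι ∧ range ι = {y}ᶜ ∧ ι T.root = S.root ∧
    (∀ u w, S.graph.Adj (ι u) (ι w) ↔ T.graph.Adj u w) ∧
    (∀ u, S.graph.Adj y (ι u) ↔ u = v) ∧
    (∀ u, f (ι u) = u) ∧ f y = v

/-- Simple*-confluent epimorphisms: finite compositions of splitting edge maps, adding edge maps and
light confluent epimorphisms. (Identities are light confluent.) -/
inductive SimpleStarConfluent : ∀ S T : FinRootedTree, (S.V → T.V) → Prop
  | splitting {S T : FinRootedTree} {f : S.V → T.V} :
      IsSplittingEdge S T f → SimpleStarConfluent S T f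
  | adding {S T : FinRootedTree} {f : S.V → T.V} :
      IsAddingEdge S T f → SimpleStarConfluent S T f
  | light {S T : FinRootedTree} {f : S.V → T.V} :
      IsEpi S T f → IsLight S T f → IsConfluent S T f → SimpleStarConfluent S T f
  | comp {R S T : FinRootedTree} {f : R.V → S.V} {g : S.V → T.V} :
      SimpleStarConfluent R S f → SimpleStarConfluent S T g → SimpleStarConfluent R T (g ∘ f)

end FinRootedTree

/-! ## Inverse limits and projective Fraïssé limits

Below `M` is a class of epimorphisms between rooted trees; together with all rooted trees (with at
least two vertices) it forms a family. -/

/-- A class of maps between rooted trees. -/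
abbrev TreeMapClass := ∀ S T : FinRootedTree, (S.V → T.V) → Prop

/-- An inverse sequence of rooted trees with bonding maps in `M`. -/
structure TreeSequence (M : TreeMapClass) where
  F : ℕ → FinRootedTree
  bond : ∀ n, (F (n + 1)).V → (F n).V
  bond_mem : ∀ n, M (F (n + 1)) (F n) (bond n)

namespace TreeSequence

variable {M : TreeMapClass}

/-- The vertex space of the inverse limit, with the topology induced from the product of the
discrete spaces `F n`. -/
abbrev Limit (s : TreeSequence M) : Type :=
  {x : ∀ n, (s.F n).V // ∀ n, s.bond n (x (n + 1)) = x n}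

/-- The edge relation of the inverse limit. -/
def Edge (s : TreeSequence M) (x y : s.Limit) : Prop :=
  ∀ n, (s.F n).Edge (x.1 n) (y.1 n)

/-- The canonical projections of the inverse limit. -/
def proj (s : TreeSequence M) (n : ℕ) (x : s.Limit) : (s.F n).V := x.1 n

/-- Epimorphisms (in the enlarged family) from the inverse limit onto a tree `A`: those that factor
as a projection followed by a member of `M`. -/
def IsLimitEpi (s : TreeSequence M) (A : FinRootedTree) (h : s.Limit → A.V) : Prop :=
  ∃ (m : ℕ) (h' : (s.F m).V → A.V), M (s.F m) A h' ∧ h = h' ∘ s.proj m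

/-- The inverse limit of `s` is a projective Fraïssé limit of the family of all rooted trees with
the maps in `M`. In `small_fibres`, the vertex space being compact metrizable, "for every open
neighbourhood `U` of the diagonal some `f` has all pairs of points with equal image in `U`" says
that for every compatible metric and every `ε > 0` there is an `f` with fibres of diameter `< ε`. -/
structure IsProjectiveFraisseLimit (s : TreeSequence M) : Prop where
  projects : ∀ A : FinRootedTree, ∃ h : s.Limit → A.V, s.IsLimitEpi A h
  extends_epi : ∀ (A B : FinRootedTree) (f : s.Limit → A.V) (g : B.V → A.V),
    s.IsLimitEpi A f → M B A g → ∃ h : s.Limit → B.V, s.IsLimitEpi B h ∧ f = g ∘ h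
  small_fibres : ∀ U : Set (s.Limit × s.Limit), IsOpen U → (∀ x, (x, x) ∈ U) →
    ∃ (A : FinRootedTree) (f : s.Limit → A.V), s.IsLimitEpi A f ∧
      ∀ x y, f x = f y → (x, y) ∈ U

/-- When the edge relation of the inverse limit is transitive it is an equivalence relation. -/
def edgeSetoid (s : TreeSequence M) (h : ∀ x y z, s.Edge x y → s.Edge y z → s.Edge x z) :
    Setoid s.Limit where
  r := s.Edge
  iseqv :=
    { refl := fun _ _ => Or.inl rfl
      symm := fun hxy n => (hxy n).elim (fun e => Or.inl e.symm) (fun e => Or.inr e.symm)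
      trans := fun {x y z} => h x y z }

/-- The topological realization: the quotient of the vertex space by the edge relation, with the
quotient topology. -/
abbrev Realization (s : TreeSequence M)
    (h : ∀ x y z, s.Edge x y → s.Edge y z → s.Edge x z) : Type :=
  Quotient (s.edgeSetoid h)

end TreeSequence

/-! ## Continuum theory -/

section Continua

/-- A continuum: a compact connected metrizable space. -/
structure IsContinuum (X : Type*) [TopologicalSpace X] : Prop where
  compact : CompactSpace X
  connected : ConnectedSpace X
  metrizable : MetrizableSpace X

/-- `A` is an arc in `X` with endpoints `a` and `b` (so `a ≠ b`). In a Hausdorff space such an `A` is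
homeomorphic to `[0, 1]`. -/
def IsArc {X : Type*} [TopologicalSpace X] (A : Set X) (a b : X) : Prop :=
  ∃ f : unitInterval → X, Continuous f ∧ Function.Injective f ∧ f 0 = a ∧ f 1 = b ∧ range f = A

/-- `A` is the arc `[a, b]`, where `[a, a] = {a}`. -/
def IsArcOrPoint {X : Type*} [TopologicalSpace X] (A : Set X) (a b : X) : Prop :=
  IsArc A a b ∨ (a = b ∧ A = {a})

/-- Hereditary unicoherence: any two subcontinua have connected (possibly empty) intersection. -/
def IsHereditarilyUnicoherent (X : Type*) [TopologicalSpace X] : Prop :=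
  ∀ P Q : Set X, IsClosed P → IsConnected P → IsClosed Q → IsConnected Q → IsPreconnected (P ∩ Q)

/-- Any two distinct points are the endpoints of an arc. -/
def IsArcwiseConnected (X : Type*) [TopologicalSpace X] : Prop :=
  ∀ a b : X, a ≠ b → ∃ A : Set X, IsArc A a b

/-- A dendroid: a hereditarily unicoherent and arcwise connected continuum. -/
structure IsDendroid (X : Type*) [TopologicalSpace X] : Prop where
  continuum : IsContinuum X
  unicoherent : IsHereditarilyUnicoherent X
  arcwise : IsArcwiseConnected X

/-- A smooth dendroid: for some point `p`, if `xₙ → x` then `[p, xₙ] → [p, x]`. The topology on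
`NonemptyCompacts X` is the Vietoris topology, i.e. the one of the Hausdorff metric. -/
def IsSmoothDendroid (X : Type*) [TopologicalSpace X] : Prop :=
  IsDendroid X ∧ ∃ p : X, ∀ (x : X) (xs : ℕ → X), Tendsto xs atTop (𝓝 x) →
    ∀ (A : NonemptyCompacts X) (As : ℕ → NonemptyCompacts X),
      IsArcOrPoint (A : Set X) p x → (∀ n, IsArcOrPoint (As n : Set X) p (xs n)) →
        Tendsto As atTop (𝓝 A)

/-- A Kelley continuum: for every subcontinuum `K`, every `p ∈ K` and every sequence `pₙ → p` there
are subcontinua `Kₙ` with `pₙ ∈ Kₙ` and `Kₙ → K` in the Hausdorff metric (Vietoris topology). -/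
def IsKelleyContinuum (X : Type*) [TopologicalSpace X] : Prop :=
  IsContinuum X ∧ ∀ K : NonemptyCompacts X, IsConnected (K : Set X) → ∀ p ∈ K,
    ∀ ps : ℕ → X, Tendsto ps atTop (𝓝 p) →
      ∃ Ks : ℕ → NonemptyCompacts X, (∀ n, IsConnected (Ks n : Set X) ∧ ps n ∈ Ks n) ∧
        Tendsto Ks atTop (𝓝 K)

/-- Endpoint in the classical sense: an endpoint of every arc that contains it. -/
def IsEndpoint {X : Type*} [TopologicalSpace X] (p : X) : Prop :=
  ∀ (A : Set X) (a b : X), IsArc A a b → p ∈ A → p = a ∨ p = b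

/-- Ramification point in the classical sense: there are three arcs, any two of which meet in
exactly the point `p`. -/
def IsRamificationPoint {X : Type*} [TopologicalSpace X] (p : X) : Prop :=
  ∃ A B C : Set X, (∃ a b, IsArc A a b) ∧ (∃ a b, IsArc B a b) ∧ (∃ a b, IsArc C a b) ∧
    A ∩ B = {p} ∧ A ∩ C = {p} ∧ B ∩ C = {p}

end Continua

/-! The root is the bottom of a tree, and everything is expressed by the parent function.
Epimorphisms become surjective root preserving maps sending the parent of `a` to `f a` or to the
parent of `f a` (`isEpi_iff`); light confluent ones become level preserving maps that lift children
(`IsLC`).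

Existence is a Fraïssé argument. Pulling back one inserted vertex along a light confluent map
produces many, so splitting and adding edge maps are subsumed under simultaneous insertions of
pairwise nonadjacent vertices (`IsIns`), which factor back into single ones. Two maps that are
insertions or light confluent close up to a square whose opposite sides are of the same kind, and
grids of such squares amalgamate compositions (`SimpleStarConfluent.amalgamate`). There are only
countably many maps onto a given tree up to isomorphism, so a bookkeeping recursion builds a
sequence with `HasExtension`, a property of the stages alone that is equivalent to being a limit.

The geometry uses only `HasExtension`. Splitting the edge between the projections of two adjacent
points shows that a point has at most one neighbour besides itself, so the edge relation is
transitive with classes of at most two points. The order of the trees passes to the limit and then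
to a closed partial order on the realization, whose lower sets are connected chains varying
continuously. Hereditary unicoherence holds because connected vertex sets of a tree meet in
connected sets. These facts alone yield arcs and smoothness (`IsOrderedDendroid`). The Kelley
property is confluence of the projections passed to the limit. Adding a leaf over a given vertex
produces maximal points, hence endpoints, near every point. Finally, every tree has a light
confluent cover with three disjoint copies of all that lies above a vertex (`exists_tripling`);
using it at ever finer levels gives three branches above every nonmaximal point. -/

namespace FinRootedTree

-- Parents, depth and order in a rooted tree.

attribute [instance] FinRootedTree.finite FinRootedTree.nontrivial

/-- The path from the root to a vertex. -/
noncomputable def pathTo (T : FinRootedTree) (v : T.V) : T.graph.Walk T.root v :=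
  (T.isTree.existsUnique_path T.root v).choose

theorem pathTo_isPath (T : FinRootedTree) (v : T.V) : (T.pathTo v).IsPath :=
  (T.isTree.existsUnique_path T.root v).choose_spec.1

theorem eq_pathTo (T : FinRootedTree) {v : T.V} {p : T.graph.Walk T.root v} (hp : p.IsPath) :
    p = T.pathTo v :=
  (T.isTree.existsUnique_path T.root v).choose_spec.2 p hp

/-- The parent of a vertex; the root is its own parent. -/
noncomputable def parent (T : FinRootedTree) (v : T.V) : T.V := (T.pathTo v).penultimate

/-- The distance of a vertex to the root. -/
noncomputable def depth (T : FinRootedTree) (v : T.V) : ℕ := (T.pathTo v).length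

variable {T S R : FinRootedTree}

theorem pathTo_root : T.pathTo T.root = SimpleGraph.Walk.nil :=
  (T.eq_pathTo SimpleGraph.Walk.IsPath.nil).symm

@[simp] theorem parent_root : T.parent T.root = T.root := by
  simp [parent, pathTo_root]

@[simp] theorem depth_root : T.depth T.root = 0 := by
  simp [depth, pathTo_root]

theorem adj_parent {v : T.V} (hv : v ≠ T.root) : T.graph.Adj (T.parent v) v := by
  apply SimpleGraph.Walk.adj_penultimate
  intro h
  exact hv h.eq.symm

/-- Without cycles, one end of an edge lies on the root path of the other end, where it must be the
penultimate vertex. -/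
theorem adj_cases {u v : T.V} (h : T.graph.Adj u v) :
    (u ≠ T.root ∧ T.parent u = v) ∨ (v ≠ T.root ∧ T.parent v = u) := by
  have key : ∀ {u v : T.V}, T.graph.Adj u v → v ∈ (T.pathTo u).support →
      (u ≠ T.root ∧ T.parent u = v) := by
    intro u v h hv
    refine ⟨?_, (T.isTree.isAcyclic.eq_penultimate_of_adj_end (T.pathTo_isPath u) h hv).symm⟩
    rintro rfl
    rw [pathTo_root] at hv
    simp at hv
    exact h.ne hv.symm
  by_cases hv : v ∈ (T.pathTo u).support
  · exact Or.inl (key h hv)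
  · refine Or.inr (key h.symm ?_)
    exact T.isTree.isAcyclic.mem_support_of_ne_mem_support_of_adj_of_isPath
      (T.pathTo_isPath v) (T.pathTo_isPath u) h.symm hv

theorem pathTo_eq_concat {v : T.V} (hv : v ≠ T.root) :
    T.pathTo v = (T.pathTo (T.parent v)).concat (adj_parent hv) :=
  T.isTree.isAcyclic.path_concat (T.pathTo_isPath _) (T.pathTo_isPath _) _
    (SimpleGraph.Walk.getVert_mem_support _ _)

theorem depth_parent_add_one {v : T.V} (hv : v ≠ T.root) :
    T.depth (T.parent v) + 1 = T.depth v := by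
  rw [depth, depth, pathTo_eq_concat hv, SimpleGraph.Walk.length_concat]

theorem depth_parent_lt {v : T.V} (hv : v ≠ T.root) : T.depth (T.parent v) < T.depth v := by
  have := depth_parent_add_one hv; omega

theorem parent_ne {v : T.V} (hv : v ≠ T.root) : T.parent v ≠ v := (adj_parent hv).ne

theorem adj_iff {u v : T.V} : T.graph.Adj u v ↔
    (u ≠ T.root ∧ T.parent u = v) ∨ (v ≠ T.root ∧ T.parent v = u) := by
  refine ⟨adj_cases, ?_⟩
  rintro (⟨h, rfl⟩ | ⟨h, rfl⟩)
  · exact (adj_parent h).symm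
  · exact adj_parent h

theorem edge_parent (v : T.V) : T.Edge (T.parent v) v := by
  by_cases h : v = T.root
  · left; rw [h, parent_root]
  · exact Or.inr (adj_parent h)

theorem Edge.symm {u v : T.V} (h : T.Edge u v) : T.Edge v u :=
  h.elim (fun e => Or.inl e.symm) fun e => Or.inr e.symm

theorem edge_cases {u v : T.V} (h : T.Edge u v) : u = v ∨ (u ≠ T.root ∧ T.parent u = v) ∨
    (v ≠ T.root ∧ T.parent v = u) := h.imp_right adj_cases

theorem depth_eq_zero {v : T.V} : T.depth v = 0 ↔ v = T.root := by
  refine ⟨fun h => ?_, fun h => by rw [h, depth_root]⟩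
  by_contra hv
  have := depth_parent_add_one hv; omega

/-- A function that behaves like the parent function is the parent function. -/
theorem parent_eq_of_rank (p : T.V → T.V) (rank : T.V → ℕ)
    (hadj : ∀ v, v ≠ T.root → T.graph.Adj (p v) v)
    (hrank : ∀ v, v ≠ T.root → rank (p v) < rank v) :
    ∀ v, v ≠ T.root → T.parent v = p v := by
  have : ∀ n v, rank v ≤ n → v ≠ T.root → T.parent v = p v := by
    intro n
    induction n with
    | zero => intro v hn hv; have := hrank v hv; omega
    | succ n ih =>
      intro v hn hv
      rcases adj_cases (hadj v hv) with ⟨h, h'⟩ | ⟨_, h⟩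
      · have h1 := hrank v hv
        have h2 := hrank _ h
        rw [ih (p v) (by omega) h] at h'
        rw [h'] at h2; omega
      · exact h
  exact fun v => this _ v le_rfl

theorem le_iff_mem_support {x y : T.V} : T.le x y ↔ x ∈ (T.pathTo y).support := by
  constructor
  · rintro ⟨p, hp, hx⟩
    rwa [T.eq_pathTo hp] at hx
  · exact fun h => ⟨_, T.pathTo_isPath y, h⟩

theorem le_iff {x y : T.V} : T.le x y ↔ x = y ∨ (y ≠ T.root ∧ T.le x (T.parent y)) := by
  by_cases hy : y = T.root
  · subst hy
    simp [le_iff_mem_support, pathTo_root]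
  · rw [le_iff_mem_support, le_iff_mem_support, pathTo_eq_concat hy,
      SimpleGraph.Walk.support_concat]
    simp [hy, or_comm]

theorem le_refl (x : T.V) : T.le x x := le_iff.2 (Or.inl rfl)

theorem le_of_le_parent {x y : T.V} (h : T.le x (T.parent y)) : T.le x y := by
  by_cases hy : y = T.root
  · rwa [hy, parent_root, ← hy] at h
  · exact le_iff.2 (Or.inr ⟨hy, h⟩)

theorem parent_le (y : T.V) : T.le (T.parent y) y := le_of_le_parent (le_refl _)

theorem le_iff_iterate {x y : T.V} : T.le x y ↔ ∃ n, T.parent^[n] y = x := by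
  constructor
  · intro h
    induction hn : T.depth y generalizing y with
    | zero =>
      rcases le_iff.1 h with h | ⟨h, -⟩
      · exact ⟨0, h.symm⟩
      · exact absurd (depth_eq_zero.1 hn) h
    | succ n ih =>
      rcases le_iff.1 h with h | ⟨h, h'⟩
      · exact ⟨0, h.symm⟩
      · obtain ⟨m, hm⟩ := ih h' (by have := depth_parent_add_one h; omega)
        exact ⟨m + 1, hm⟩
  · rintro ⟨n, rfl⟩
    induction n generalizing y with
    | zero => exact le_refl _
    | succ n ih => exact le_of_le_parent (ih (y := T.parent y))

theorem le_trans {x y z : T.V} (h : T.le x y) (h' : T.le y z) : T.le x z := by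
  obtain ⟨m, rfl⟩ := le_iff_iterate.1 h
  obtain ⟨n, rfl⟩ := le_iff_iterate.1 h'
  exact le_iff_iterate.2 ⟨m + n, Function.iterate_add_apply _ _ _ _⟩

theorem depth_le_of_le {x y : T.V} (h : T.le x y) : T.depth x ≤ T.depth y := by
  obtain ⟨n, rfl⟩ := le_iff_iterate.1 h
  clear h
  induction n generalizing y with
  | zero => rfl
  | succ n ih =>
    refine (ih (y := T.parent y)).trans ?_
    by_cases hy : y = T.root
    · simp [hy]
    · exact (depth_parent_lt hy).le

theorem eq_of_le_of_depth_le {x y : T.V} (h : T.le x y) (h' : T.depth y ≤ T.depth x) : x = y := by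
  rcases le_iff.1 h with h | ⟨hy, h⟩
  · exact h
  · have := depth_le_of_le h
    have := depth_parent_add_one hy
    omega

theorem le_antisymm {x y : T.V} (h : T.le x y) (h' : T.le y x) : x = y :=
  eq_of_le_of_depth_le h (depth_le_of_le h')

theorem root_le (x : T.V) : T.le T.root x :=
  ⟨_, T.pathTo_isPath x, SimpleGraph.Walk.start_mem_support _⟩

theorem le_root {x : T.V} (h : T.le x T.root) : x = T.root := le_antisymm h (root_le x)

/-- The vertices below a given vertex form a chain. -/
theorem le_total_of_le {x y z : T.V} (hx : T.le x z) (hy : T.le y z) : T.le x y ∨ T.le y x := by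
  obtain ⟨m, rfl⟩ := le_iff_iterate.1 hx
  obtain ⟨n, rfl⟩ := le_iff_iterate.1 hy
  rcases Nat.le_total m n with h | h
  · right
    obtain ⟨d, rfl⟩ := Nat.exists_eq_add_of_le' h
    exact le_iff_iterate.2 ⟨d, (Function.iterate_add_apply _ _ _ _).symm⟩
  · left
    obtain ⟨d, rfl⟩ := Nat.exists_eq_add_of_le' h
    exact le_iff_iterate.2 ⟨d, (Function.iterate_add_apply _ _ _ _).symm⟩

theorem le_parent_of_le_of_ne {x y : T.V} (h : T.le x y) (hne : x ≠ y) : T.le x (T.parent y) :=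
  ((le_iff.1 h).resolve_left hne).2

theorem ne_root_of_le_of_ne {x y : T.V} (h : T.le x y) (hne : x ≠ y) : y ≠ T.root :=
  ((le_iff.1 h).resolve_left hne).1

/-- Adjacent comparable vertices. -/
theorem parent_eq_of_edge_of_le {x y : T.V} (h : T.Edge x y) (hle : T.le x y) (hne : x ≠ y) :
    T.parent y = x := by
  rcases edge_cases h with h | ⟨h1, h2⟩ | ⟨h1, h2⟩
  · exact absurd h hne
  · exfalso
    exact hne (le_antisymm hle (h2 ▸ parent_le x))
  · exact h2

theorem edge_le_total {x y : T.V} (h : T.Edge x y) : T.le x y ∨ T.le y x := by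
  rcases edge_cases h with rfl | ⟨-, rfl⟩ | ⟨-, rfl⟩
  · exact Or.inl (le_refl _)
  · exact Or.inr (parent_le _)
  · exact Or.inl (parent_le _)

/-- A child of `x` below `y`, for `x` strictly below `y`. -/
theorem exists_child_le {x y : T.V} (h : T.le x y) (hne : x ≠ y) :
    ∃ c, c ≠ T.root ∧ T.parent c = x ∧ T.le c y := by
  obtain ⟨n, rfl⟩ := le_iff_iterate.1 h
  clear h
  induction n with
  | zero => exact absurd rfl hne
  | succ n ih =>
    by_cases hr : T.parent^[n] y = T.root
    · have he : T.parent^[n + 1] y = T.parent^[n] y := by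
        rw [Function.iterate_succ_apply', hr, parent_root]
      rw [he] at hne ⊢
      exact ih hne
    · exact ⟨T.parent^[n] y, hr, (Function.iterate_succ_apply' _ _ _).symm,
        le_iff_iterate.2 ⟨n, rfl⟩⟩

/-! ### Connected sets of vertices -/

/-- A set of vertices that cannot be split into two nonempty parts without an edge between them. -/
def PC (T : FinRootedTree) (K : Set T.V) : Prop :=
  ∀ U : Set T.V, (K ∩ U).Nonempty → (K \ U).Nonempty → ∃ u ∈ K ∩ U, ∃ v ∈ K \ U, T.graph.Adj u v

theorem pc_iff_preconnected {K : Set T.V} : T.PC K ↔ (T.graph.induce K).Preconnected := by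
  constructor
  · intro h a b
    by_contra hab
    obtain ⟨u, ⟨huK, huU⟩, v, ⟨hvK, hvU⟩, huv⟩ :=
      h {v | ∃ hv : v ∈ K, (T.graph.induce K).Reachable a ⟨v, hv⟩}
        ⟨a, a.2, a.2, SimpleGraph.Reachable.refl _⟩ ⟨b, b.2, fun ⟨_, hb⟩ => hab hb⟩
    obtain ⟨_, hu⟩ := huU
    refine hvU ⟨hvK, hu.trans (SimpleGraph.Adj.reachable ?_)⟩
    exact huv
  · rintro h U ⟨a, haK, haU⟩ ⟨b, hbK, hbU⟩
    obtain ⟨w⟩ := h ⟨a, haK⟩ ⟨b, hbK⟩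
    obtain ⟨d, -, hd1, hd2⟩ := w.exists_boundary_dart {v | v.1 ∈ U} haU hbU
    exact ⟨d.fst.1, ⟨d.fst.2, hd1⟩, d.snd.1, ⟨d.snd.2, hd2⟩, d.adj⟩

theorem connected_iff_pc {K : Set T.V} : (T.graph.induce K).Connected ↔ T.PC K ∧ K.Nonempty := by
  rw [pc_iff_preconnected, SimpleGraph.connected_iff, Set.nonempty_coe_sort]

/-- Two vertices of a connected set are joined by a path inside it; paths in a tree are unique, so
the path in `K` is the path in `L`. This is the finite source of hereditary unicoherence. -/
theorem PC.inter {K L : Set T.V} (hK : T.PC K) (hL : T.PC L) : T.PC (K ∩ L) := by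
  classical
  have key : ∀ {K : Set T.V}, T.PC K → ∀ a ∈ K, ∀ b ∈ K, ∃ p : T.graph.Walk a b, p.IsPath ∧
      ∀ v ∈ p.support, v ∈ K := by
    intro K hK a ha b hb
    obtain ⟨w⟩ := pc_iff_preconnected.1 hK ⟨a, ha⟩ ⟨b, hb⟩
    let φ : T.graph.induce K →g T.graph := (SimpleGraph.Embedding.induce K).toHom
    refine ⟨(w.map φ).bypass, SimpleGraph.Walk.bypass_isPath _, fun v hv => ?_⟩
    have : v ∈ w.support.map φ := by
      rw [← SimpleGraph.Walk.support_map]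
      exact SimpleGraph.Walk.support_bypass_subset_support _ hv
    obtain ⟨u, -, rfl⟩ := List.mem_map.1 this
    exact u.2
  rw [pc_iff_preconnected]
  rintro ⟨a, haK, haL⟩ ⟨b, hbK, hbL⟩
  obtain ⟨p, hp, hpK⟩ := key hK a haK b hbK
  obtain ⟨q, hq, hqL⟩ := key hL a haL b hbL
  have hpq : p = q := by
    obtain ⟨_, _, h⟩ := T.isTree.existsUnique_path a b
    rw [h p hp, h q hq]
  subst hpq
  exact ⟨p.induce (K ∩ L) fun v hv => ⟨hpK v hv, hqL v hv⟩⟩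

/-- A set closed under taking parents, up to a smallest vertex `c`, is connected. -/
theorem pc_of_parent_mem {K : Set T.V} (c : T.V)
    (h : ∀ q ∈ K, q ≠ c → q ≠ T.root ∧ T.parent q ∈ K) : T.PC K := by
  have key : ∀ U : Set T.V, c ∈ U → (K \ U).Nonempty → ∃ u ∈ K ∩ U, ∃ v ∈ K \ U,
      T.graph.Adj u v := by
    rintro U hcU ⟨b, hbK, hbU⟩
    induction hn : T.depth b using Nat.strong_induction_on generalizing b with
    | _ n ih =>
      obtain ⟨hb, hbp⟩ := h b hbK (fun e => hbU (e ▸ hcU))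
      by_cases hpU : T.parent b ∈ U
      · exact ⟨_, ⟨hbp, hpU⟩, b, ⟨hbK, hbU⟩, adj_parent hb⟩
      · exact ih _ (hn ▸ depth_parent_lt hb) _ hbp hpU rfl
  intro U h1 h2
  by_cases hc : c ∈ U
  · exact key U hc h2
  · obtain ⟨u, ⟨hu, huU⟩, v, ⟨hv, hvU⟩, huv⟩ := key Uᶜ hc (by simpa [Set.sdiff_compl] using h1)
    exact ⟨v, ⟨hv, by simpa using hvU⟩, u, ⟨hu, huU⟩, huv.symm⟩

theorem pc_univ : T.PC univ :=
  pc_of_parent_mem T.root fun _ _ h => ⟨h, mem_univ _⟩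

theorem pc_Icc (c z : T.V) : T.PC {q | T.le c q ∧ T.le q z} :=
  pc_of_parent_mem c fun _ hx h => ⟨ne_root_of_le_of_ne hx.1 h.symm,
    le_parent_of_le_of_ne hx.1 h.symm, le_trans (parent_le _) hx.2⟩

/-- The only edge leaving the set of vertices above `c` joins `c` to its parent, and `C` does not
contain that edge. -/
theorem PC.le_of_parent_not_mem {C : Set T.V} (hC : T.PC C) {c z : T.V} (hc : c ∈ C)
    (hpc : c = T.root ∨ T.parent c ∉ C) (hz : z ∈ C) : T.le c z := by
  by_contra hcz
  obtain ⟨u, ⟨huC, hu⟩, v, ⟨hvC, hv⟩, huv⟩ := hC {v | T.le c v} ⟨c, hc, le_refl c⟩ ⟨z, hz, hcz⟩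
  rcases adj_cases huv with ⟨h1, rfl⟩ | ⟨h1, rfl⟩
  · have : c = u := by
      by_contra hne
      exact hv (le_parent_of_le_of_ne hu hne)
    subst this
    rcases hpc with h | h
    · exact h1 h
    · exact h hvC
  · exact hv (le_of_le_parent hu)

/-! ### Trees from parent functions -/

/-- The graph given by a parent function. -/
def parentGraph {V : Type} (root : V) (p : V → V) (rank : V → ℕ)
    (h : ∀ v, v ≠ root → rank (p v) < rank v) : SimpleGraph V where
  Adj u v := (u ≠ root ∧ p u = v) ∨ (v ≠ root ∧ p v = u)
  symm := ⟨fun _ _ h => h.symm⟩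
  loopless := ⟨fun v hv => by
    rcases hv with ⟨h1, h2⟩ | ⟨h1, h2⟩ <;> (have := h v h1; rw [h2] at this; omega)⟩

/-- Iterating `p` leads every vertex to the root, so the graph is connected; each edge is `s(v, p
v)` for some `v ≠ root`, so there are fewer edges than vertices. -/
theorem parentGraph_isTree {V : Type} [Finite V] (root : V) (p : V → V) (rank : V → ℕ)
    (h : ∀ v, v ≠ root → rank (p v) < rank v) : (parentGraph root p rank h).IsTree := by
  have hconn : (parentGraph root p rank h).Connected := by
    have key : ∀ n v, rank v ≤ n → (parentGraph root p rank h).Reachable v root := by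
      intro n
      induction n with
      | zero =>
        intro v hv
        by_cases hr : v = root
        · rw [hr]
        · have := h v hr; omega
      | succ n ih =>
        intro v hv
        by_cases hr : v = root
        · rw [hr]
        · have hadj : (parentGraph root p rank h).Adj v (p v) := Or.inl ⟨hr, rfl⟩
          exact hadj.reachable.trans (ih _ (by have := h v hr; omega))
    have : Nonempty V := ⟨root⟩
    exact ⟨fun u v => (key _ u le_rfl).trans (key _ v le_rfl).symm⟩
  rw [SimpleGraph.isTree_iff_connected_and_card]
  refine ⟨hconn, Nat.le_antisymm ?_ hconn.card_vert_le_card_edgeSet_add_one⟩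
  let e : {v : V // v ≠ root} → (parentGraph root p rank h).edgeSet := fun v =>
    ⟨s(v.1, p v.1), Or.inl ⟨v.2, rfl⟩⟩
  have he : Function.Surjective e := by
    rintro ⟨s, hs⟩
    induction s using Sym2.ind with
    | _ a b =>
      rcases hs with ⟨h1, h2⟩ | ⟨h1, h2⟩
      · exact ⟨⟨a, h1⟩, Subtype.ext (by simp only [e]; rw [h2])⟩
      · exact ⟨⟨b, h1⟩, Subtype.ext (by simp only [e]; rw [h2, Sym2.eq_swap])⟩
  have h1 := Nat.card_le_card_of_surjective e he
  have h2 : Nat.card {v : V // v ≠ root} + 1 = Nat.card V := by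
    have h3 := Set.ncard_add_ncard_compl {root}
    rw [Set.ncard_singleton, add_comm] at h3
    exact h3
  omega

/-- The rooted tree given by a parent function. -/
def ofParent {V : Type} [hf : Finite V] [hn : Nontrivial V] (root : V) (p : V → V) (rank : V → ℕ)
    (h : ∀ v, v ≠ root → rank (p v) < rank v) : FinRootedTree where
  V := V
  finite := hf
  nontrivial := hn
  graph := parentGraph root p rank h
  isTree := parentGraph_isTree root p rank h
  root := root

theorem ofParent_parent {V : Type} [hf : Finite V] [hn : Nontrivial V] (root : V) (p : V → V)
    (rank : V → ℕ) (h : ∀ v, v ≠ root → rank (p v) < rank v) (v : V) (hv : v ≠ root) :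
    (ofParent root p rank h).parent v = p v :=
  parent_eq_of_rank (T := ofParent root p rank h) p rank (fun _ hv => Or.inr ⟨hv, rfl⟩) h v hv

end FinRootedTree

namespace FinRootedTree

/-! ### Epimorphisms in terms of parents. -/

variable {T S R : FinRootedTree}

/-- Root preserving maps that send the parent of `a` to `f a` or to the parent of `f a`. -/
def IsRT (S T : FinRootedTree) (f : S.V → T.V) : Prop :=
  f S.root = T.root ∧ ∀ a, a ≠ S.root →
    f (S.parent a) = f a ∨ (f a ≠ T.root ∧ f (S.parent a) = T.parent (f a))

theorem IsRT.edge {f : S.V → T.V} (h : IsRT S T f) {a b : S.V} (hab : S.Edge a b) :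
    T.Edge (f a) (f b) := by
  have key : ∀ a, a ≠ S.root → T.Edge (f (S.parent a)) (f a) := by
    intro a ha
    rcases h.2 a ha with h1 | ⟨h1, h2⟩
    · exact Or.inl h1
    · rw [h2]; exact edge_parent _
  rcases edge_cases hab with rfl | ⟨h1, rfl⟩ | ⟨h1, rfl⟩
  · exact Or.inl rfl
  · exact (key _ h1).symm
  · exact key _ h1

theorem IsRT.le {f : S.V → T.V} (h : IsRT S T f) {a b : S.V} (hab : S.le a b) :
    T.le (f a) (f b) := by
  obtain ⟨n, rfl⟩ := le_iff_iterate.1 hab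
  clear hab
  induction n generalizing b with
  | zero => exact le_refl _
  | succ n ih =>
    refine le_trans (ih (b := S.parent b)) ?_
    by_cases hb : b = S.root
    · rw [hb, parent_root]; exact le_refl _
    · rcases h.2 b hb with h1 | ⟨h1, h2⟩
      · rw [h1]; exact le_refl _
      · rw [h2]; exact parent_le _

theorem IsEpi.isRT {f : S.V → T.V} (h : IsEpi S T f) : IsRT S T f := by
  refine ⟨h.map_root, fun a ha => ?_⟩
  by_cases hne : f (S.parent a) = f a
  · exact Or.inl hne
  · have h1 := h.map_le _ _ (parent_le a)
    exact Or.inr ⟨ne_root_of_le_of_ne h1 hne,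
      (parent_eq_of_edge_of_le (h.map_edge _ _ (edge_parent a)) h1 hne).symm⟩

/-- The vertices below `f w` lift to vertices below `w`; a lift can be chosen so that its parent
does not lie above the given vertex. -/
theorem IsRT.exists_le {f : S.V → T.V} (h : IsRT S T f) {w : S.V} {c : T.V} (hc : T.le c (f w)) :
    ∃ c', S.le c' w ∧ f c' = c ∧ (c' = S.root ∨ ¬ T.le c (f (S.parent c'))) := by
  induction hn : S.depth w using Nat.strong_induction_on generalizing w with
  | _ n ih =>
    by_cases hw : w = S.root
    · subst hw
      rw [h.1] at hc
      exact ⟨_, le_refl _, by rw [h.1, le_root hc], Or.inl rfl⟩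
    · by_cases hp : T.le c (f (S.parent w))
      · obtain ⟨c', h1, h2⟩ := ih _ (hn ▸ depth_parent_lt hw) hp rfl
        exact ⟨c', le_trans h1 (parent_le w), h2⟩
      · refine ⟨w, le_refl _, ?_, Or.inr hp⟩
        rcases h.2 w hw with h1 | ⟨h1, h2⟩
        · exact absurd (h1 ▸ hc) hp
        · by_contra hne
          exact hp (h2 ▸ le_parent_of_le_of_ne hc (Ne.symm hne))

/-- Surjectivity on edges is automatic: a lift `c` of `v` chosen lowest on its chain has a parent
not mapped to `v`, hence mapped to the parent of `v`. -/
theorem isEpi_iff {f : S.V → T.V} : IsEpi S T f ↔ Function.Surjective f ∧ IsRT S T f := by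
  refine ⟨fun h => ⟨h.surj, h.isRT⟩, fun ⟨hs, h⟩ => ⟨fun _ _ => h.edge, hs, ?_, h.1,
    fun _ _ => h.le⟩⟩
  have key : ∀ v, v ≠ T.root → ∃ a b, S.Edge a b ∧ f a = T.parent v ∧ f b = v := by
    intro v hv
    obtain ⟨w, rfl⟩ := hs v
    obtain ⟨c, -, hc, hc'⟩ := h.exists_le (le_refl (f w))
    have hcr : c ≠ S.root := by
      rintro rfl
      exact hv (hc ▸ h.1)
    refine ⟨S.parent c, c, edge_parent c, ?_, hc⟩
    rcases h.2 c hcr with h1 | ⟨h1, h2⟩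
    · rw [h1, hc] at hc'
      exact absurd (le_refl _) (hc'.resolve_left hcr)
    · rw [h2, hc]
  intro u v huv
  rcases edge_cases huv with rfl | ⟨h1, rfl⟩ | ⟨h1, rfl⟩
  · obtain ⟨a, rfl⟩ := hs u
    exact ⟨a, a, Or.inl rfl, rfl, rfl⟩
  · obtain ⟨a, b, h, h1, h2⟩ := key u h1
    exact ⟨b, a, h.symm, h2, h1⟩
  · exact key v h1

theorem IsRT.comp {f : R.V → S.V} {g : S.V → T.V} (hg : IsRT S T g) (hf : IsRT R S f) :
    IsRT R T (g ∘ f) := by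
  refine ⟨by simp [hf.1, hg.1], fun a ha => ?_⟩
  simp only [Function.comp_apply]
  rcases hf.2 a ha with h | ⟨h1, h2⟩
  · exact Or.inl (by rw [h])
  · rw [h2]; exact hg.2 _ h1

theorem IsEpi.comp {f : R.V → S.V} {g : S.V → T.V} (hg : IsEpi S T g) (hf : IsEpi R S f) :
    IsEpi R T (g ∘ f) :=
  isEpi_iff.2 ⟨hg.surj.comp hf.surj, hg.isRT.comp hf.isRT⟩

/-! ### Confluence -/

theorem IsConfluent.comp {f : R.V → S.V} {g : S.V → T.V} (hg : IsConfluent S T g)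
    (hf : IsConfluent R S f) : IsConfluent R T (g ∘ f) := by
  intro Q hQ a ha
  obtain ⟨C, hC, haC, hCQ⟩ := hg Q hQ (f a) ha
  obtain ⟨D, hD, haD, hDC⟩ := hf C hC a haC
  exact ⟨D, hD, haD, by rw [image_comp, hDC, hCQ]⟩

/-- Confluence follows from lifting of single edges, up to moving inside of a fibre. -/
theorem isConfluent_of_lift {f : S.V → T.V}
    (h : ∀ a v, T.graph.Adj (f a) v → ∃ a' b, f a' = f a ∧ S.Edge a a' ∧ S.Edge a' b ∧ f b = v) :
    IsConfluent S T f := by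
  intro Q hQ a ha
  rw [connected_iff_pc] at hQ
  -- The component of `a` in the preimage of `Q`.
  let C : Set S.V := {v | ∃ D : Set S.V, S.PC D ∧ a ∈ D ∧ v ∈ D ∧ f '' D ⊆ Q}
  have haC : a ∈ C := ⟨{a}, fun U hU hU' => by
    obtain ⟨_, rfl, h1⟩ := hU
    obtain ⟨_, rfl, h2⟩ := hU'
    exact absurd h1 h2, rfl, rfl, by simpa using ha⟩
  have hCQ : f '' C ⊆ Q := by
    rintro _ ⟨v, ⟨D, -, -, hv, hD⟩, rfl⟩
    exact hD (mem_image_of_mem _ hv)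
  have hC : S.PC C := by
    have key : ∀ U : Set S.V, a ∈ U → (C \ U).Nonempty → ∃ u ∈ C ∩ U, ∃ v ∈ C \ U,
        S.graph.Adj u v := by
      rintro U haU ⟨v, ⟨D, hD, haD, hv, hDQ⟩, hvU⟩
      obtain ⟨x, hx, y, hy, hxy⟩ := hD U ⟨a, haD, haU⟩ ⟨v, hv, hvU⟩
      exact ⟨x, ⟨⟨D, hD, haD, hx.1, hDQ⟩, hx.2⟩, y, ⟨⟨D, hD, haD, hy.1, hDQ⟩, hy.2⟩, hxy⟩
    intro U h1 h2
    by_cases haU : a ∈ U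
    · exact key U haU h2
    · obtain ⟨u, ⟨hu, huU⟩, v, ⟨hv, hvU⟩, huv⟩ := key Uᶜ haU (by simpa [Set.sdiff_compl] using h1)
      exact ⟨v, ⟨hv, by simpa using hvU⟩, u, ⟨hu, huU⟩, huv.symm⟩
  have hstep : ∀ {u v}, u ∈ C → S.Edge u v → f v ∈ Q → v ∈ C := by
    rintro u v ⟨D, hD, haD, hu, hDQ⟩ huv hv
    rcases huv with rfl | huv
    · exact ⟨D, hD, haD, hu, hDQ⟩
    refine ⟨insert v D, ?_, Or.inr haD, Or.inl rfl, by
      rw [image_insert_eq]; exact insert_subset hv hDQ⟩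
    intro U h1 h2
    by_cases hvD : v ∈ D
    · rw [insert_eq_of_mem hvD] at *; exact hD U h1 h2
    by_cases h3 : (D ∩ U).Nonempty
    · by_cases h4 : (D \ U).Nonempty
      · obtain ⟨x, hx, y, hy, hxy⟩ := hD U h3 h4
        exact ⟨x, ⟨Or.inr hx.1, hx.2⟩, y, ⟨Or.inr hy.1, hy.2⟩, hxy⟩
      · obtain ⟨y, hy | hy, hyU⟩ := h2
        · subst hy
          refine ⟨u, ⟨Or.inr hu, ?_⟩, y, ⟨Or.inl rfl, hyU⟩, huv⟩
          by_contra huU; exact h4 ⟨u, hu, huU⟩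
        · exact absurd ⟨y, hy, hyU⟩ h4
    · obtain ⟨y, hy | hy, hyU⟩ := h1
      · subst hy
        refine ⟨y, ⟨Or.inl rfl, hyU⟩, u, ⟨Or.inr hu, ?_⟩, huv.symm⟩
        intro huU; exact h3 ⟨u, hu, huU⟩
      · exact absurd ⟨y, hy, hyU⟩ h3
  refine ⟨C, connected_iff_pc.2 ⟨hC, a, haC⟩, haC, hCQ.antisymm ?_⟩
  -- If the image were smaller, some edge of `Q` would leave it, and lifting that edge would enlarge
  -- `C`.
  by_contra hne
  obtain ⟨q, hq, hqC⟩ := not_subset.1 hne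
  obtain ⟨u, ⟨-, c, hc, rfl⟩, v, ⟨hvQ, hvC⟩, huv⟩ := hQ.1 (f '' C)
    ⟨f a, ha, mem_image_of_mem _ haC⟩ ⟨q, hq, hqC⟩
  obtain ⟨c', b, h1, h2, h3, rfl⟩ := h c v huv
  have hc' : c' ∈ C := hstep hc h2 (h1 ▸ hCQ (mem_image_of_mem _ hc))
  exact hvC (mem_image_of_mem _ (hstep hc' h3 hvQ))

/-- When fibres are cliques, the start of any lift of an edge is one step away inside the fibre.
Both splitting and adding edge maps are of this kind. -/
theorem IsEpi.isConfluent_of_fibres {f : S.V → T.V} (hf : IsEpi S T f)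
    (h : ∀ a b, f a = f b → S.Edge a b) : IsConfluent S T f := by
  refine isConfluent_of_lift fun a v hv => ?_
  obtain ⟨a', b, hab, h1, h2⟩ := hf.surj_edge _ _ (Or.inr hv)
  exact ⟨a', b, h1, h _ _ h1.symm, hab, h2⟩

theorem IsSplittingEdge.isConfluent {f : S.V → T.V} (h : IsSplittingEdge S T f) :
    IsConfluent S T f := by
  obtain ⟨hf, ι, x, a, b, hι, hr, -, hab, -, hx, hfι, hfx⟩ := h
  have hmem : ∀ s, s = x ∨ ∃ u, ι u = s := fun s => by
    by_cases hs : s = x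
    · exact Or.inl hs
    · exact Or.inr (by simpa [← hr] using (show s ∈ ({x}ᶜ : Set S.V) from hs))
  have hxe : ∀ u, f x = u → S.Edge x (ι u) := by
    rintro u rfl
    exact Or.inr ((hx _).2 (by simpa using hfx))
  refine hf.isConfluent_of_fibres fun s t hst => ?_
  rcases hmem s with rfl | ⟨u, rfl⟩ <;> rcases hmem t with rfl | ⟨v, rfl⟩
  · exact Or.inl rfl
  · exact hxe _ (by rw [hst, hfι])
  · exact (hxe _ (by rw [← hst, hfι])).symm
  · rw [hfι, hfι] at hst
    exact Or.inl (by rw [hst])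

theorem IsAddingEdge.isConfluent {f : S.V → T.V} (h : IsAddingEdge S T f) :
    IsConfluent S T f := by
  obtain ⟨hf, ι, x, a, hι, hr, -, -, hx, hfι, hfx⟩ := h
  have hmem : ∀ s, s = x ∨ ∃ u, ι u = s := fun s => by
    by_cases hs : s = x
    · exact Or.inl hs
    · exact Or.inr (by simpa [← hr] using (show s ∈ ({x}ᶜ : Set S.V) from hs))
  have hxe : ∀ u, f x = u → S.Edge x (ι u) := by
    rintro u rfl
    exact Or.inr ((hx _).2 hfx)
  refine hf.isConfluent_of_fibres fun s t hst => ?_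
  rcases hmem s with rfl | ⟨u, rfl⟩ <;> rcases hmem t with rfl | ⟨v, rfl⟩
  · exact Or.inl rfl
  · exact hxe _ (by rw [hst, hfι])
  · exact (hxe _ (by rw [← hst, hfι])).symm
  · rw [hfι, hfι] at hst
    exact Or.inl (by rw [hst])

theorem SimpleStarConfluent.isEpi {f : S.V → T.V} (h : SimpleStarConfluent S T f) :
    IsEpi S T f := by
  induction h with
  | splitting h => exact h.1
  | adding h => exact h.1
  | light h _ _ => exact h
  | comp _ _ h1 h2 => exact h2.comp h1

theorem SimpleStarConfluent.isConfluent {f : S.V → T.V} (h : SimpleStarConfluent S T f) :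
    IsConfluent S T f := by
  induction h with
  | splitting h => exact h.isConfluent
  | adding h => exact h.isConfluent
  | light _ _ h => exact h
  | comp _ _ h1 h2 => exact h2.comp h1

theorem IsConfluent.exists_pc {f : S.V → T.V} (h : IsConfluent S T f) {Q : Set T.V}
    (hQ : T.PC Q) {a : S.V} (ha : f a ∈ Q) : ∃ C, S.PC C ∧ a ∈ C ∧ f '' C = Q := by
  obtain ⟨C, hC, haC, hCQ⟩ := h Q (connected_iff_pc.2 ⟨hQ, _, ha⟩) a ha
  exact ⟨C, (connected_iff_pc.1 hC).1, haC, hCQ⟩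

/-! ### Light confluent maps -/

/-- Level preserving maps that lift children. -/
structure IsLC (S T : FinRootedTree) (f : S.V → T.V) : Prop where
  root : f S.root = T.root
  ne_root : ∀ a, a ≠ S.root → f a ≠ T.root
  parent : ∀ a, a ≠ S.root → f (S.parent a) = T.parent (f a)
  lift : ∀ a v, v ≠ T.root → T.parent v = f a → ∃ b, b ≠ S.root ∧ S.parent b = a ∧ f b = v

theorem IsLC.isRT {f : S.V → T.V} (h : IsLC S T f) : IsRT S T f :=
  ⟨h.root, fun a ha => Or.inr ⟨h.ne_root a ha, h.parent a ha⟩⟩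

theorem IsLC.surjective {f : S.V → T.V} (h : IsLC S T f) : Function.Surjective f := by
  intro v
  induction hn : T.depth v using Nat.strong_induction_on generalizing v with
  | _ n ih =>
    by_cases hv : v = T.root
    · exact ⟨S.root, by rw [h.root, hv]⟩
    · obtain ⟨a, ha⟩ := ih _ (hn ▸ depth_parent_lt hv) _ rfl
      obtain ⟨b, -, -, hb⟩ := h.lift a v hv ha.symm
      exact ⟨b, hb⟩

theorem IsLC.isEpi {f : S.V → T.V} (h : IsLC S T f) : IsEpi S T f :=
  isEpi_iff.2 ⟨h.surjective, h.isRT⟩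

theorem IsLC.isLight {f : S.V → T.V} (h : IsLC S T f) : IsLight S T f := by
  intro a b hab
  rcases adj_cases hab with ⟨h1, rfl⟩ | ⟨h1, rfl⟩
  · rw [h.parent a h1]; exact (parent_ne (h.ne_root a h1)).symm
  · rw [h.parent b h1]; exact parent_ne (h.ne_root b h1)

theorem IsLC.isConfluent {f : S.V → T.V} (h : IsLC S T f) : IsConfluent S T f := by
  refine isConfluent_of_lift fun a v hv => ⟨a, ?_⟩
  rcases adj_cases hv with ⟨h1, h2⟩ | ⟨h1, h2⟩
  · refine ⟨S.parent a, rfl, Or.inl rfl, (edge_parent a).symm, ?_⟩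
    rw [h.parent a (fun e => h1 (e ▸ h.root)), h2]
  · obtain ⟨b, hb, rfl, rfl⟩ := h.lift a v h1 h2
    exact ⟨b, rfl, Or.inl rfl, edge_parent b, rfl⟩

theorem IsLC.simpleStarConfluent {f : S.V → T.V} (h : IsLC S T f) : SimpleStarConfluent S T f :=
  .light h.isEpi h.isLight h.isConfluent

/-- Lightness excludes `f (S.parent a) = f a`, so levels are preserved; a child `v` of `f a` is
lifted by confluence over the pair `{f a, v}`. -/
theorem IsLight.isLC {f : S.V → T.V} (hl : IsLight S T f) (he : IsEpi S T f)
    (hc : IsConfluent S T f) : IsLC S T f := by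
  have hp : ∀ a, a ≠ S.root → f a ≠ T.root ∧ f (S.parent a) = T.parent (f a) := fun a ha =>
    (he.isRT.2 a ha).resolve_left (hl _ _ (adj_parent ha))
  refine ⟨he.map_root, fun a ha => (hp a ha).1, fun a ha => (hp a ha).2, fun a v hv hav => ?_⟩
  have hQ : T.PC {f a, v} := by
    apply pc_of_parent_mem (f a)
    rintro q (rfl | rfl) hq
    · exact absurd rfl hq
    · exact ⟨hv, Or.inl hav⟩
  obtain ⟨C, hC, haC, hCQ⟩ := hc.exists_pc hQ (a := a) (Or.inl rfl)
  have hne : f a ≠ v := hav ▸ parent_ne hv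
  obtain ⟨u, hu, w, hw, huw⟩ := hC {a} ⟨a, haC, rfl⟩ (by
    obtain ⟨b, hb, hbv⟩ : v ∈ f '' C := hCQ ▸ Or.inr rfl
    refine ⟨b, hb, ?_⟩
    rintro rfl
    exact hne hbv)
  obtain rfl : u = a := hu.2
  have hfw : f w = v := by
    have : f w ∈ f '' C := mem_image_of_mem _ hw.1
    rw [hCQ] at this
    exact this.resolve_left fun h => hl _ _ huw h.symm
  subst hfw
  rcases adj_cases huw with ⟨h1, rfl⟩ | ⟨h1, h2⟩
  -- The neighbour over `v` is not the parent of `a`: levels are preserved, and `v` has larger depth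
  -- than `f a`.
  · exfalso
    have h3 := (hp u h1).2
    have h4 := depth_parent_lt hv
    have h5 := depth_parent_lt (hp u h1).1
    rw [hav] at h4
    rw [← h3] at h5
    omega
  · exact ⟨w, h1, h2, rfl⟩

theorem isLC_of_equiv (e : S.V ≃ T.V) (hr : e S.root = T.root)
    (hp : ∀ a, a ≠ S.root → e (S.parent a) = T.parent (e a)) : IsLC S T e := by
  have hne : ∀ a, a ≠ S.root → e a ≠ T.root := fun a ha h => ha (e.injective (h.trans hr.symm))
  refine ⟨hr, hne, hp, fun a v hv h => ⟨e.symm v, ?_, ?_, by simp⟩⟩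
  · intro h'
    exact hv (by rw [← hr, ← h']; simp)
  · have hv' : e.symm v ≠ S.root := fun h' => hv (by rw [← hr, ← h']; simp)
    apply e.injective
    rw [hp _ hv']
    simpa using h

theorem isLC_id (T : FinRootedTree) : IsLC T T id :=
  isLC_of_equiv (Equiv.refl _) rfl fun _ _ => rfl

theorem SimpleStarConfluent.id (T : FinRootedTree) : SimpleStarConfluent T T id :=
  (isLC_id T).simpleStarConfluent

end FinRootedTree

namespace FinRootedTree

/-! ### Simultaneous insertions of vertices. -/

variable {T S R : FinRootedTree}

/-- `S` arises from `T` (embedded by `ι`) by inserting new vertices, no two of them adjacent: either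
a leaf attached to a vertex `κ x`, or a vertex `x` inside the edge below a vertex `κ x`. The map `f`
is the identity on `T` and sends every new vertex to a neighbour. -/
structure IsIns (S T : FinRootedTree) (f : S.V → T.V) (ι : T.V → S.V) (κ : S.V → T.V) : Prop where
  f_ι : ∀ u, f (ι u) = u
  κ_ι : ∀ u, κ (ι u) = u
  ι_root : ι T.root = S.root
  old : ∀ u, u ≠ T.root → S.parent (ι u) = ι (T.parent u) ∨
    (S.parent (ι u) ∉ range ι ∧ κ (S.parent (ι u)) = u ∧
      S.parent (S.parent (ι u)) = ι (T.parent u) ∧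
      (f (S.parent (ι u)) = u ∨ f (S.parent (ι u)) = T.parent u))
  new : ∀ x, x ∉ range ι → (κ x ≠ T.root ∧ S.parent (ι (κ x)) = x) ∨
    (S.parent x = ι (κ x) ∧ f x = κ x)

namespace IsIns

variable {f : S.V → T.V} {ι : T.V → S.V} {κ : S.V → T.V}

theorem injective (h : IsIns S T f ι κ) : Function.Injective ι :=
  Function.LeftInverse.injective h.f_ι

theorem ne_root (h : IsIns S T f ι κ) {x : S.V} (hx : x ∉ range ι) : x ≠ S.root :=
  fun e => hx ⟨T.root, by rw [h.ι_root, e]⟩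

theorem ι_ne_root (h : IsIns S T f ι κ) {u : T.V} (hu : u ≠ T.root) : ι u ≠ S.root :=
  fun e => hu (h.injective (e.trans h.ι_root.symm))

/-- The vertices inserted into an edge. -/
theorem new_edge (h : IsIns S T f ι κ) {x : S.V} (hx : x ∉ range ι)
    (h1 : κ x ≠ T.root) (h2 : S.parent (ι (κ x)) = x) :
    S.parent x = ι (T.parent (κ x)) ∧ (f x = κ x ∨ f x = T.parent (κ x)) := by
  rcases h.old _ h1 with h3 | ⟨-, -, h3, h4⟩
  · exact absurd ⟨_, h3.symm.trans h2⟩ hx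
  · rw [h2] at h3 h4
    exact ⟨h3, h4⟩

theorem isRT (h : IsIns S T f ι κ) : IsRT S T f := by
  refine ⟨by rw [← h.ι_root, h.f_ι], fun a ha => ?_⟩
  by_cases hx : a ∈ range ι
  · obtain ⟨u, rfl⟩ := hx
    have hu : u ≠ T.root := fun e => ha (by rw [e, h.ι_root])
    rw [h.f_ι]
    rcases h.old u hu with h1 | ⟨-, -, -, h1⟩
    · rw [h1, h.f_ι]; exact Or.inr ⟨hu, rfl⟩
    · exact h1.imp_right fun h2 => ⟨hu, h2⟩
  · rcases h.new a hx with ⟨h1, h2⟩ | ⟨h1, h2⟩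
    · obtain ⟨h3, h4⟩ := h.new_edge hx h1 h2
      rw [h3, h.f_ι]
      rcases h4 with h4 | h4
      · exact Or.inr ⟨h4 ▸ h1, by rw [h4]⟩
      · exact Or.inl h4.symm
    · rw [h1, h.f_ι, h2]; exact Or.inl rfl

theorem isEpi (h : IsIns S T f ι κ) : IsEpi S T f :=
  isEpi_iff.2 ⟨fun u => ⟨ι u, h.f_ι u⟩, h.isRT⟩

/-- Pullbacks are formed along `κ` rather than `f`: an inserted vertex `x` has to be copied once for
every lift of `κ x`, even if `f x` is the parent of `κ x`, one lift of which may have several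
children over `κ x`. -/
theorem κ_isRT (h : IsIns S T f ι κ) : IsRT S T κ := by
  refine ⟨by rw [← h.ι_root, h.κ_ι], fun a ha => ?_⟩
  by_cases hx : a ∈ range ι
  · obtain ⟨u, rfl⟩ := hx
    have hu : u ≠ T.root := fun e => ha (by rw [e, h.ι_root])
    rw [h.κ_ι]
    rcases h.old u hu with h1 | ⟨-, h1, -, -⟩
    · rw [h1, h.κ_ι]; exact Or.inr ⟨hu, rfl⟩
    · exact Or.inl h1
  · rcases h.new a hx with ⟨h1, h2⟩ | ⟨h1, h2⟩
    · rw [(h.new_edge hx h1 h2).1, h.κ_ι]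
      exact Or.inr ⟨h1, rfl⟩
    · rw [h1, h.κ_ι]; exact Or.inl rfl

/-- Insertion of a single vertex. -/
theorem simpleStarConfluent_of_single (h : IsIns S T f ι κ) {x : S.V} (hr : range ι = {x}ᶜ) :
    SimpleStarConfluent S T f := by
  have hx : x ∉ range ι := by rw [hr]; simp
  have hιx : ∀ u, ι u ≠ x := fun u e => hx ⟨u, e⟩
  have hxr := h.ne_root hx
  have hinj := h.injective
  rcases h.new x hx with ⟨h1, h2⟩ | ⟨h1, h2⟩
  · obtain ⟨h3, h4⟩ := h.new_edge hx h1 h2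
    have hpar : ∀ u, u ≠ T.root → u ≠ κ x → S.parent (ι u) = ι (T.parent u) := by
      intro u hu huκ
      refine (h.old u hu).resolve_right fun h5 => huκ ?_
      have : S.parent (ι u) = x := by
        by_contra hne
        exact h5.1 (by rw [hr]; exact hne)
      rw [← h5.2.1, this]
    have hadj : ∀ u v, (ι u ≠ S.root ∧ S.parent (ι u) = ι v) ↔
        (u ≠ T.root ∧ T.parent u = v ∧ ¬ (u = κ x)) := by
      intro u v
      constructor
      · rintro ⟨h5, h6⟩
        have hu : u ≠ T.root := fun e => h5 (by rw [e, h.ι_root])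
        have huκ : u ≠ κ x := by
          rintro rfl
          exact hιx v (h6.symm.trans h2)
        rw [hpar u hu huκ] at h6
        exact ⟨hu, hinj h6, huκ⟩
      · rintro ⟨h5, rfl, h6⟩
        exact ⟨h.ι_ne_root h5, hpar u h5 h6⟩
    refine .splitting ⟨h.isEpi, ι, x, T.parent (κ x), κ x, hinj, hr, h.ι_root, adj_parent h1, ?_,
      ?_, h.f_ι, h4.symm⟩
    · intro u v
      rw [adj_iff, adj_iff, hadj, hadj]
      have hne := parent_ne h1
      have hpp : ∀ {w}, T.parent (T.parent w) = w → w ≠ T.root → T.parent w ≠ T.root → False := by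
        intro w hw h5 h6
        have := depth_parent_lt h5
        have := depth_parent_lt h6
        rw [hw] at this; omega
      constructor
      · rintro (⟨h5, rfl, h6⟩ | ⟨h5, rfl, h6⟩)
        · refine ⟨Or.inl ⟨h5, rfl⟩, ?_, fun h7 => h6 h7.1⟩
          rintro ⟨h7, h8⟩
          exact hpp (by rw [h8, ← h7]) h5 (h8 ▸ h1)
        · refine ⟨Or.inr ⟨h5, rfl⟩, fun h7 => h6 h7.2, ?_⟩
          rintro ⟨h7, h8⟩
          exact hpp (by rw [h7, ← h8]) h5 (h7 ▸ h1)
      · rintro ⟨⟨h5, rfl⟩ | ⟨h5, rfl⟩, h6, h7⟩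
        · exact Or.inl ⟨h5, rfl, fun h8 => h7 ⟨h8, by rw [h8]⟩⟩
        · exact Or.inr ⟨h5, rfl, fun h8 => h6 ⟨by rw [h8], h8⟩⟩
    · intro u
      rw [adj_iff, h3, hinj.eq_iff]
      constructor
      · rintro (⟨-, h5⟩ | ⟨h5, h6⟩)
        · exact Or.inl h5.symm
        · right
          have hu : u ≠ T.root := fun e => h5 (by rw [e, h.ι_root])
          by_contra hne
          rw [hpar u hu hne] at h6
          exact hιx _ h6
      · rintro (rfl | rfl)
        · exact Or.inl ⟨hxr, rfl⟩
        · exact Or.inr ⟨h.ι_ne_root h1, h2⟩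
  · have hpar : ∀ u, u ≠ T.root → S.parent (ι u) = ι (T.parent u) := by
      intro u hu
      refine (h.old u hu).resolve_right fun h5 => ?_
      have : S.parent (ι u) = x := by
        by_contra hne
        exact h5.1 (by rw [hr]; exact hne)
      rw [this] at h5
      rw [h5.2.1, h5.2.2.1] at h1
      exact parent_ne hu (hinj h1)
    have hadj : ∀ u v, (ι u ≠ S.root ∧ S.parent (ι u) = ι v) ↔
        (u ≠ T.root ∧ T.parent u = v) := by
      intro u v
      constructor
      · rintro ⟨h5, h6⟩
        have hu : u ≠ T.root := fun e => h5 (by rw [e, h.ι_root])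
        rw [hpar u hu] at h6
        exact ⟨hu, hinj h6⟩
      · rintro ⟨h5, rfl⟩
        exact ⟨h.ι_ne_root h5, hpar u h5⟩
    refine .adding ⟨h.isEpi, ι, x, κ x, hinj, hr, h.ι_root, ?_, ?_, h.f_ι, h2⟩
    · intro u v
      rw [adj_iff, adj_iff, hadj, hadj]
    · intro u
      rw [adj_iff, h1, hinj.eq_iff]
      constructor
      · rintro (⟨-, h5⟩ | ⟨h5, h6⟩)
        · exact h5.symm
        · have hu : u ≠ T.root := fun e => h5 (by rw [e, h.ι_root])
          rw [hpar u hu] at h6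
          exact absurd h6 (hιx _)
      · rintro rfl
        exact Or.inl ⟨hxr, rfl⟩

/-- Contracting the edge above a vertex different from the root. -/
theorem _root_.FinRootedTree.exists_delete_vertex {S : FinRootedTree} {x : S.V}
    (hxr : x ≠ S.root) (hn : ∃ a b : S.V, a ≠ b ∧ a ≠ x ∧ b ≠ x) :
    ∃ (S' : FinRootedTree) (j : S'.V → S.V), Function.Injective j ∧ range j = {x}ᶜ ∧
      j S'.root = S.root ∧ ∀ v, v ≠ S'.root → (S.parent (j v) = x → j (S'.parent v) = S.parent x) ∧
        (S.parent (j v) ≠ x → j (S'.parent v) = S.parent (j v)) := by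
  classical
  have hpxx : S.parent x ≠ x := parent_ne hxr
  have hf : Finite {v : S.V // v ≠ x} := inferInstance
  have hn : Nontrivial {v : S.V // v ≠ x} := by
    obtain ⟨a, b, hab, ha, hb⟩ := hn
    exact ⟨⟨a, ha⟩, ⟨b, hb⟩, fun e => hab (congrArg Subtype.val e)⟩
  let p : {v : S.V // v ≠ x} → {v : S.V // v ≠ x} := fun v =>
    if hv : S.parent v.1 = x then ⟨S.parent x, hpxx⟩ else ⟨S.parent v.1, hv⟩
  have hp : ∀ v, v ≠ (⟨S.root, hxr.symm⟩ : {v : S.V // v ≠ x}) →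
      S.depth (p v).1 < S.depth v.1 := by
    intro v hv
    have hv' : v.1 ≠ S.root := fun e => hv (Subtype.ext e)
    have := depth_parent_lt hv'
    simp only [p]
    split_ifs with hvx
    · have h2 := depth_parent_lt hxr
      rw [hvx] at this
      exact h2.trans this
    · exact this
  refine ⟨ofParent (⟨S.root, hxr.symm⟩ : {v : S.V // v ≠ x}) p (fun v => S.depth v.1) hp,
    Subtype.val, Subtype.val_injective, Subtype.range_val, rfl, fun v hv => ⟨?_, ?_⟩⟩
  · intro h
    exact (congrArg Subtype.val (ofParent_parent _ p _ hp v hv)).trans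
      (congrArg Subtype.val (dif_pos h))
  · intro h
    exact (congrArg Subtype.val (ofParent_parent _ p _ hp v hv)).trans
      (congrArg Subtype.val (dif_neg h))

/-- Removing one of the inserted vertices. -/
theorem exists_delete (h : IsIns S T f ι κ) {x : S.V} (hx : x ∉ range ι) :
    ∃ (S' : FinRootedTree) (g : S.V → S'.V) (j : S'.V → S.V) (f' : S'.V → T.V) (ι' : T.V → S'.V)
      (κ' : S'.V → T.V) (κ'' : S.V → S'.V),
      IsIns S S' g j κ'' ∧ range j = {x}ᶜ ∧ IsIns S' T f' ι' κ' ∧ f = f' ∘ g ∧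
      ∀ s, s ∈ range ι' ↔ j s ∈ range ι := by
  classical
  have hxr := h.ne_root hx
  have hιx : ∀ u, ι u ≠ x := fun u e => hx ⟨u, e⟩
  obtain ⟨S', j, hj, hrange, hjr, hS'⟩ := exists_delete_vertex hxr (by
    obtain ⟨a, b, hab⟩ := exists_pair_ne T.V
    exact ⟨ι a, ι b, h.injective.ne hab, hιx a, hιx b⟩)
  have hlift : ∀ s, s ≠ x → ∃ t, j t = s := fun s hs => by
    have : s ∈ range j := by rw [hrange]; exact hs
    exact this
  have hpxx : S.parent x ≠ x := parent_ne hxr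
  have hchild : ∀ v, v ≠ S.root → S.parent v = x → κ x ≠ T.root ∧ v = ι (κ x) ∧
      S.parent x = ι (T.parent (κ x)) ∧ (f x = κ x ∨ f x = T.parent (κ x)) := by
    intro v hv hvx
    by_cases hvι : v ∈ range ι
    · obtain ⟨u, rfl⟩ := hvι
      have hu : u ≠ T.root := fun e => hv (by rw [e, h.ι_root])
      rcases h.old u hu with h1 | h1
      · exact absurd (h1.symm.trans hvx) (hιx _)
      · rw [hvx] at h1
        obtain ⟨-, rfl, h3, h4⟩ := h1
        exact ⟨hu, rfl, h3, h4⟩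
    · rcases h.new v hvι with ⟨h1, h2⟩ | ⟨h1, h2⟩
      · exact absurd ((h.new_edge hvι h1 h2).1.symm.trans hvx) (hιx _)
      · exact absurd (h1.symm.trans hvx) (hιx _)
  -- The removed vertex is retracted to a neighbour with the same value under `f`: the upper end of
  -- its edge if `f x` is that end, its parent in all other cases.
  have hgex : ∀ v, ∃ t, (v ≠ x → j t = v) ∧ (v = x →
      j t = if S.parent (ι (κ x)) = x ∧ f x = κ x then ι (κ x) else S.parent x) := by
    intro v
    by_cases hv : v = x
    · obtain ⟨t, ht⟩ := hlift (if S.parent (ι (κ x)) = x ∧ f x = κ x then ι (κ x)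
        else S.parent x) (by split_ifs; exacts [hιx _, hpxx])
      exact ⟨t, fun h => absurd hv h, fun _ => ht⟩
    · obtain ⟨t, ht⟩ := hlift v hv
      exact ⟨t, fun _ => ht, fun h => absurd h hv⟩
  choose g hg hgx using hgex
  have hκex : ∀ v, ∃ t, (v ≠ x → j t = v) ∧ (v = x → j t = ι (κ x)) := by
    intro v
    by_cases hv : v = x
    · obtain ⟨t, ht⟩ := hlift _ (hιx (κ x))
      exact ⟨t, fun h => absurd hv h, fun _ => ht⟩
    · obtain ⟨t, ht⟩ := hlift v hv
      exact ⟨t, fun _ => ht, fun h => absurd h hv⟩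
  choose κ'' hκ hκx using hκex
  choose ι' hι' using fun u => hlift _ (hιx u)
  have hjx : ∀ t, j t ≠ x := fun t => by
    have : j t ∈ ({x}ᶜ : Set S.V) := hrange ▸ mem_range_self t
    exact this
  have hjne : ∀ t, t ≠ S'.root → j t ≠ S.root := fun t ht e => ht (hj (e.trans hjr.symm))
  have hmem : ∀ s, s ∈ range ι' ↔ j s ∈ range ι := by
    intro s
    constructor
    · rintro ⟨u, rfl⟩
      exact ⟨u, (hι' u).symm⟩
    · rintro ⟨u, hu⟩
      exact ⟨u, hj ((hι' u).trans hu)⟩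
  have hjne' : ∀ t, j t ≠ S.root → t ≠ S'.root := fun t ht e => ht (by rw [e, hjr])
  refine ⟨S', g, j, f ∘ j, ι', κ ∘ j, κ'',
    ⟨fun t => hj (hg _ (hjx t)), fun t => hj (hκ _ (hjx t)), hjr, ?_, ?_⟩, hrange,
    ⟨fun u => by simp [hι', h.f_ι], fun u => by simp [hι', h.κ_ι],
      hj (by rw [hι', hjr, h.ι_root]), ?_, ?_⟩, ?_, hmem⟩
  · rintro v hv
    have hv' := hjne v hv
    by_cases hvx : S.parent (j v) = x
    · right
      obtain ⟨h0, h1, h2, h3⟩ := hchild _ hv' hvx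
      rw [hvx, (hS' v hv).1 hvx]
      refine ⟨by rw [hrange]; simp, hj (by rw [hκx _ rfl, h1]), rfl, ?_⟩
      by_cases h4 : S.parent (ι (κ x)) = x ∧ f x = κ x
      · exact Or.inl (hj (by rw [hgx _ rfl, if_pos h4, h1]))
      · exact Or.inr (hj (by rw [hgx _ rfl, if_neg h4, (hS' v hv).1 hvx]))
    · exact Or.inl ((hS' v hv).2 hvx).symm
  · intro y hy
    have hyx : y = x := by
      rw [hrange] at hy
      simpa using hy
    subst hyx
    rw [hκx _ rfl]
    rcases h.new y hx with ⟨h1, h2⟩ | ⟨h1, h2⟩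
    · left
      exact ⟨hjne' _ (by rw [hκx _ rfl]; exact h.ι_ne_root h1), h2⟩
    · right
      refine ⟨h1, hj ?_⟩
      rw [hκx _ rfl, hgx _ rfl]
      split_ifs with h4
      exacts [rfl, h1]
  · intro u hu
    have hu' : ι' u ≠ S'.root := hjne' _ (by rw [hι']; exact h.ι_ne_root hu)
    have hS := hS' _ hu'
    rw [hι'] at hS
    by_cases hux : S.parent (ι u) = x
    · left
      apply hj
      obtain ⟨-, h1, h2, -⟩ := hchild _ (h.ι_ne_root hu) hux
      rw [hS.1 hux, hι', h2, h.injective h1]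
    · have h0 := hS.2 hux
      rcases h.old u hu with h1 | ⟨h1, h2, h3, h4⟩
      · exact Or.inl (hj (by rw [h0, hι', h1]))
      · right
        simp only [hmem, Function.comp_apply, h0]
        refine ⟨h1, h2, hj ?_, h4⟩
        rw [hι', ← h3, (hS' _ (hjne' _ (by rw [h0]; exact h.ne_root h1))).2, h0]
        rw [h0, h3]; exact hιx _
  · rintro y hy
    rw [hmem] at hy
    have hyr := hjne' _ (h.ne_root hy)
    rcases h.new _ hy with ⟨h1, h2⟩ | ⟨h1, h2⟩
    · left
      have hu' : ι' (κ (j y)) ≠ S'.root := hjne' _ (by rw [hι']; exact h.ι_ne_root h1)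
      have hS := hS' _ hu'
      rw [hι'] at hS
      exact ⟨h1, hj (by rw [Function.comp_apply, hS.2 (by rw [h2]; exact hjx y), h2])⟩
    · right
      refine ⟨hj ?_, h2⟩
      rw [Function.comp_apply, hι', (hS' _ hyr).2 (by rw [h1]; exact hιx _), h1]
  · funext v
    by_cases hv : v = x
    · subst hv
      simp only [Function.comp_apply]
      rw [hgx _ rfl]
      split_ifs with h4
      · rw [h.f_ι, h4.2]
      · rcases h.new v hx with ⟨h1, h2⟩ | ⟨h1, h2⟩
        · obtain ⟨h5, h6⟩ := h.new_edge hx h1 h2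
          rw [h5, h.f_ι]
          exact h6.resolve_left fun h7 => h4 ⟨h2, h7⟩
        · rw [h1, h.f_ι, h2]
    · simp only [Function.comp_apply]
      rw [hg v hv]

theorem isLC_of_surjective (h : IsIns S T f ι κ) (hs : Function.Surjective ι) : IsLC S T f := by
  let e : S.V ≃ T.V := ⟨f, ι, fun s => by obtain ⟨u, rfl⟩ := hs s; rw [h.f_ι], h.f_ι⟩
  refine isLC_of_equiv e h.isRT.1 fun a ha => ?_
  obtain ⟨u, rfl⟩ := hs a
  have hu : u ≠ T.root := fun e => ha (by rw [e, h.ι_root])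
  change f _ = T.parent (f (ι u))
  rcases h.old u hu with h1 | h1
  · rw [h1, h.f_ι, h.f_ι]
  · exact absurd (hs _) h1.1

/-- Removing the inserted vertices one by one factors `f` into single insertions; with none left,
`f` is an isomorphism and so light confluent. -/
theorem simpleStarConfluent (h : IsIns S T f ι κ) : SimpleStarConfluent S T f := by
  induction hn : (range ι)ᶜ.ncard generalizing S with
  | zero =>
    rw [Set.ncard_eq_zero, compl_empty_iff] at hn
    exact (h.isLC_of_surjective (range_eq_univ.1 hn)).simpleStarConfluent
  | succ n ih =>
    have hne : (range ι)ᶜ.Nonempty := by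
      rw [nonempty_iff_ne_empty]
      intro h0
      rw [h0] at hn
      simp at hn
    obtain ⟨x, hx⟩ := hne
    obtain ⟨S', g, j, f', ι', κ', κ'', h1, h2, h3, rfl, h5⟩ := h.exists_delete hx
    refine .comp (h1.simpleStarConfluent_of_single h2) (ih h3 ?_)
    have h6 : j '' (range ι')ᶜ = (range ι)ᶜ \ {x} := by
      ext s
      constructor
      · rintro ⟨t, ht, rfl⟩
        have h7 : j t ∈ ({x}ᶜ : Set S.V) := h2 ▸ mem_range_self t
        exact ⟨fun h8 => ht ((h5 t).2 h8), h7⟩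
      · rintro ⟨hs, hs'⟩
        obtain ⟨t, rfl⟩ : s ∈ range j := by rw [h2]; exact hs'
        exact ⟨t, fun h8 => hs ((h5 t).1 h8), rfl⟩
    have h7 := Set.ncard_image_of_injective (range ι')ᶜ h1.injective
    have h8 := Set.ncard_sdiff_singleton_add_one hx
    rw [h6] at h7
    omega

end IsIns

/-! ### The generators are insertions -/

theorem IsAddingEdge.exists_isIns {f : S.V → T.V} (h : IsAddingEdge S T f) :
    ∃ ι κ, IsIns S T f ι κ := by
  classical
  obtain ⟨-, ι, y, v, hι, hr, hroot, hadj, hy, hfι, hfy⟩ := h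
  have hιy : ∀ u, ι u ≠ y := fun u e => by
    have : ι u ∈ ({y}ᶜ : Set S.V) := hr ▸ mem_range_self u
    exact this e
  have hmem : ∀ s, s ≠ y → ∃ u, ι u = s := fun s hs => by
    have : s ∈ range ι := by rw [hr]; exact hs
    exact this
  have hyr : y ≠ S.root := fun e => hιy _ (hroot.trans e.symm)
  -- The parents in `S` are guessed and then confirmed by a rank that the guess decreases.
  have hpar := parent_eq_of_rank (T := S) (fun s => if s = y then ι v else ι (T.parent (f s)))
    (fun s => if s = y then T.depth v + 1 else T.depth (f s)) (by
      intro s hs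
      by_cases hsy : s = y
      · subst hsy
        simpa using ((hy v).2 rfl).symm
      · obtain ⟨u, rfl⟩ := hmem s hsy
        have hu : u ≠ T.root := fun e => hs (by rw [e, hroot])
        simp only [hιy, if_false, hfι]
        exact (hadj _ _).2 (adj_parent hu)) (by
      intro s hs
      by_cases hsy : s = y
      · subst hsy
        simp [hιy, hfι]
      · obtain ⟨u, rfl⟩ := hmem s hsy
        have hu : u ≠ T.root := fun e => hs (by rw [e, hroot])
        simpa [hιy, hfι] using depth_parent_lt hu)
  refine ⟨ι, f, hfι, hfι, hroot, fun u hu => Or.inl ?_, fun x hx => Or.inr ⟨?_, rfl⟩⟩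
  · rw [hpar (ι u) (fun e => hu (hι (e.trans hroot.symm)))]
    simp [hιy, hfι]
  · have : x = y := by
      by_contra hne
      exact hx (hmem x hne)
    subst this
    rw [hpar x hyr, hfy]
    simp

theorem IsSplittingEdge.exists_isIns {f : S.V → T.V} (h : IsSplittingEdge S T f) :
    ∃ ι κ, IsIns S T f ι κ := by
  classical
  obtain ⟨-, ι, x, a, b, hι, hr, hroot, hab, hadj, hx, hfι, hfx⟩ := h
  -- The ends of the split edge enter symmetrically, so `b` may be taken to be the upper one.
  wlog hba : b ≠ T.root ∧ T.parent b = a generalizing a b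
  · refine this b a hab.symm (fun u v => ?_) (fun u => (hx u).trans or_comm) hfx.symm ?_
    · rw [hadj]; tauto
    · exact (adj_cases hab).resolve_right hba
  obtain ⟨hbr, rfl⟩ := hba
  have hιx : ∀ u, ι u ≠ x := fun u e => by
    have : ι u ∈ ({x}ᶜ : Set S.V) := hr ▸ mem_range_self u
    exact this e
  have hmem : ∀ s, s ≠ x → ∃ u, ι u = s := fun s hs => by
    have : s ∈ range ι := by rw [hr]; exact hs
    exact this
  have hxr : x ≠ S.root := fun e => hιx _ (hroot.trans e.symm)
  have hpar := parent_eq_of_rank (T := S)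
    (fun s => if s = x then ι (T.parent b) else if s = ι b then x else ι (T.parent (f s)))
    -- Doubling the depths leaves an odd number for `x` between the two ends of its edge.
    (fun s => if s = x then 2 * T.depth b - 1 else 2 * T.depth (f s)) (by
      intro s hs
      by_cases hsy : s = x
      · subst hsy
        simpa using ((hx _).2 (Or.inl rfl)).symm
      · obtain ⟨u, rfl⟩ := hmem s hsy
        have hu : u ≠ T.root := fun e => hs (by rw [e, hroot])
        by_cases hub : u = b
        · subst hub
          simpa [hιx] using ((hx _).2 (Or.inr rfl))
        · simp only [hιx, if_false, hfι, hι.eq_iff, hub]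
          refine (hadj _ _).2 ⟨adj_parent hu, fun h1 => hub h1.2, ?_⟩
          rintro ⟨h1, rfl⟩
          have h2 := depth_parent_lt hu
          rw [h1] at h2
          have h3 := depth_parent_lt hbr
          omega) (by
      intro s hs
      have hb := depth_parent_add_one hbr
      by_cases hsy : s = x
      · subst hsy
        simp only [if_true, hιx, hfι, if_false]
        omega
      · obtain ⟨u, rfl⟩ := hmem s hsy
        have hu : u ≠ T.root := fun e => hs (by rw [e, hroot])
        by_cases hub : u = b
        · subst hub
          simp only [hιx, if_false, if_true, hfι]
          omega
        · simpa [hιx, hfι, hι.eq_iff, hub] using depth_parent_lt hu)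
  have hpx : S.parent x = ι (T.parent b) := by rw [hpar x hxr]; simp
  have hne : ∀ u, u ≠ T.root → ι u ≠ S.root := fun u hu e => hu (hι (e.trans hroot.symm))
  have hpb : S.parent (ι b) = x := by rw [hpar _ (hne b hbr)]; simp [hιx]
  have hxn : x ∉ range ι := fun ⟨u, hu⟩ => hιx u hu
  refine ⟨ι, fun s => if s = x then b else f s, hfι, fun u => by simp [hιx, hfι], hroot,
    fun u hu => ?_, fun s hs => Or.inl ?_⟩
  · by_cases hub : u = b
    · subst hub
      right
      rw [hpb, hpx]
      exact ⟨hxn, by simp, rfl, hfx.symm⟩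
    · left
      rw [hpar _ (hne u hu)]
      simp [hιx, hfι, hι.eq_iff, hub]
  · have : s = x := by
      by_contra hne
      exact hs (hmem s hne)
    subst this
    simp [hbr, hpb]

/-- Induction principle: simple*-confluent maps are generated by insertions and light confluent
maps. -/
theorem SimpleStarConfluent.induction_isIns
    {P : ∀ S T : FinRootedTree, (S.V → T.V) → Prop}
    (ins : ∀ {S T f ι κ}, IsIns S T f ι κ → P S T f)
    (lc : ∀ {S T f}, IsLC S T f → P S T f)
    (comp : ∀ {R S T f g}, P R S f → P S T g → P R T (g ∘ f))
    {S T : FinRootedTree} {f : S.V → T.V} (h : SimpleStarConfluent S T f) : P S T f := by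
  induction h with
  | splitting h => obtain ⟨ι, κ, h⟩ := h.exists_isIns; exact ins h
  | adding h => obtain ⟨ι, κ, h⟩ := h.exists_isIns; exact ins h
  | light h1 h2 h3 => exact lc (h2.isLC h1 h3)
  | comp _ _ h1 h2 => exact comp h1 h2

end FinRootedTree

namespace FinRootedTree

variable {A B C : FinRootedTree}

/-! ### Constructions of trees over a given tree -/

/-- Insertion of a family `N` of new vertices into `B`: a leaf at `k n`, or, if `e n` holds, a vertex
inside the edge below `k n`, mapped to `k n` iff `side n` holds. -/
theorem exists_insertion (B : FinRootedTree) (N : Type) [Finite N] (k : N → B.V) (e side : N → Prop)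
    (hroot : ∀ n, e n → k n ≠ B.root) (hinj : ∀ n m, e n → e m → k n = k m → n = m) :
    ∃ (D : FinRootedTree) (f : D.V → B.V) (ι : B.V → D.V) (κ : D.V → B.V) (m : N → D.V),
      IsIns D B f ι κ ∧ Function.Injective m ∧ (∀ d, d ∈ range m ↔ d ∉ range ι) ∧
      (∀ n, e n → D.parent (ι (k n)) = m n) ∧
      (∀ b, b ≠ B.root → (∀ n, e n → k n ≠ b) → D.parent (ι b) = ι (B.parent b)) ∧
      (∀ n, e n → D.parent (m n) = ι (B.parent (k n))) ∧
      (∀ n, ¬ e n → D.parent (m n) = ι (k n)) ∧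
      (∀ n, e n → ¬ side n → f (m n) = B.parent (k n)) ∧
      (∀ n, (¬ e n ∨ side n) → f (m n) = k n) := by
  classical
  let p : B.V ⊕ N → B.V ⊕ N := Sum.elim
    (fun b => if h : ∃ n, e n ∧ k n = b then Sum.inr h.choose else Sum.inl (B.parent b))
    (fun n => if e n then Sum.inl (B.parent (k n)) else Sum.inl (k n))
  have hp1 : ∀ n, e n → p (Sum.inl (k n)) = Sum.inr n := by
    intro n hn
    have h : ∃ n', e n' ∧ k n' = k n := ⟨n, hn, rfl⟩
    have h2 := h.choose_spec
    change (if h : ∃ n', e n' ∧ k n' = k n then Sum.inr h.choose else _) = _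
    rw [dif_pos h, hinj _ _ h2.1 hn h2.2]
  have hp2 : ∀ b, (∀ n, e n → k n ≠ b) → p (Sum.inl b) = Sum.inl (B.parent b) := by
    intro b hb
    exact dif_neg fun ⟨n, h1, h2⟩ => hb n h1 h2
  have hp3 : ∀ n, e n → p (Sum.inr n) = Sum.inl (B.parent (k n)) := fun n hn => if_pos hn
  have hp4 : ∀ n, ¬ e n → p (Sum.inr n) = Sum.inl (k n) := fun n hn => if_neg hn
  -- Even ranks for old vertices; a new vertex gets the odd number just below or just above that of
  -- `k n`, according as it subdivides an edge or is a leaf.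
  let rank : B.V ⊕ N → ℕ := Sum.elim (fun b => 2 * B.depth b)
    (fun n => if e n then 2 * B.depth (k n) - 1 else 2 * B.depth (k n) + 1)
  have hr1 : ∀ b, rank (Sum.inl b) = 2 * B.depth b := fun b => rfl
  have hr2 : ∀ n, rank (Sum.inr n) =
    if e n then 2 * B.depth (k n) - 1 else 2 * B.depth (k n) + 1 := fun n => rfl
  have hp : ∀ v, v ≠ Sum.inl B.root → rank (p v) < rank v := by
    rintro (b | n) hv
    · have hb : b ≠ B.root := fun h => hv (by rw [h])
      have hd := depth_parent_add_one hb
      by_cases h : ∃ n, e n ∧ k n = b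
      · obtain ⟨n, hn, rfl⟩ := h
        rw [hp1 n hn, hr1, hr2, if_pos hn]
        omega
      · rw [hp2 b (fun n h1 h2 => h ⟨n, h1, h2⟩), hr1, hr1]
        omega
    · by_cases hn : e n
      · have hd := depth_parent_add_one (hroot n hn)
        rw [hp3 n hn, hr1, hr2, if_pos hn]
        omega
      · rw [hp4 n hn, hr1, hr2, if_neg hn]
        omega
  have hnt : Nontrivial (B.V ⊕ N) := Sum.inl_injective.nontrivial
  let D : FinRootedTree := ofParent (Sum.inl B.root : B.V ⊕ N) p rank hp
  let i : B.V → D.V := fun b => (Sum.inl b : B.V ⊕ N)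
  let m : N → D.V := fun n => (Sum.inr n : B.V ⊕ N)
  have hpar : ∀ v : B.V ⊕ N, v ≠ Sum.inl B.root → D.parent v = p v :=
    fun v hv => ofParent_parent _ p _ hp v hv
  have hi : ∀ b, b ≠ B.root → (i b : B.V ⊕ N) ≠ Sum.inl B.root := fun b hb h =>
    hb (Sum.inl_injective h)
  have hm : ∀ n, (m n : B.V ⊕ N) ≠ Sum.inl B.root := fun n h => by cases h
  have h1 : ∀ n, e n → D.parent (i (k n)) = m n := fun n hn =>
    (hpar _ (hi _ (hroot n hn))).trans (hp1 n hn)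
  have h2 : ∀ b, b ≠ B.root → (∀ n, e n → k n ≠ b) → D.parent (i b) = i (B.parent b) :=
    fun b hb h => (hpar _ (hi b hb)).trans (hp2 b h)
  have h3 : ∀ n, e n → D.parent (m n) = i (B.parent (k n)) := fun n hn =>
    (hpar _ (hm n)).trans (hp3 n hn)
  have h4 : ∀ n, ¬ e n → D.parent (m n) = i (k n) := fun n hn =>
    (hpar _ (hm n)).trans (hp4 n hn)
  let f : D.V → B.V := Sum.elim (fun b => b)
    (fun n => if e n ∧ ¬ side n then B.parent (k n) else k n)
  let κ : D.V → B.V := Sum.elim (fun b => b) k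
  have h5 : ∀ n, e n → ¬ side n → f (m n) = B.parent (k n) := fun n h h' => if_pos ⟨h, h'⟩
  have h6 : ∀ n, (¬ e n ∨ side n) → f (m n) = k n := fun n h => if_neg (by tauto)
  have hmi : ∀ n, m n ∉ range i := by
    rintro n ⟨b, hb⟩
    exact Sum.inl_ne_inr hb
  have hrange : ∀ d, d ∈ range m ↔ d ∉ range i := by
    intro d
    constructor
    · rintro ⟨n, rfl⟩; exact hmi n
    · intro hd
      have h : ∀ d : B.V ⊕ N, (∃ b, Sum.inl b = d) ∨ ∃ n, Sum.inr n = d := by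
        rintro (b | n)
        exacts [Or.inl ⟨b, rfl⟩, Or.inr ⟨n, rfl⟩]
      exact (h d).resolve_left hd
  refine ⟨D, f, i, κ, m, ⟨fun _ => rfl, fun _ => rfl, rfl, ?_, ?_⟩, Sum.inr_injective, hrange,
    h1, h2, h3, h4, h5, h6⟩
  · intro b hb
    by_cases h : ∃ n, e n ∧ k n = b
    · obtain ⟨n, hn, rfl⟩ := h
      right
      rw [h1 n hn]
      refine ⟨hmi n, rfl, h3 n hn, ?_⟩
      by_cases hs : side n
      · exact Or.inl (h6 n (Or.inr hs))
      · exact Or.inr (h5 n hn hs)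
    · exact Or.inl (h2 b hb fun n h3 h4 => h ⟨n, h3, h4⟩)
  · intro d hd
    obtain ⟨n, rfl⟩ := (hrange d).2 hd
    by_cases hn : e n
    · exact Or.inl ⟨hroot n hn, h1 n hn⟩
    · exact Or.inr ⟨h4 n hn, h6 n (Or.inl hn)⟩

/-- The pullback of a map `κ` along a light confluent map `g`. -/
theorem exists_pullback {κ : B.V → A.V} {g : C.V → A.V} (hκ : IsRT B A κ) (hg : IsLC C A g) :
    ∃ (D : FinRootedTree) (π₁ : D.V → B.V) (π₂ : D.V → C.V),
      (∀ d, κ (π₁ d) = g (π₂ d)) ∧ (∀ d d', π₁ d = π₁ d' → π₂ d = π₂ d' → d = d') ∧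
      (∀ b c, κ b = g c → ∃ d, π₁ d = b ∧ π₂ d = c) ∧ π₁ D.root = B.root ∧ π₂ D.root = C.root ∧
      IsLC D B π₁ ∧ (∀ d, d ≠ D.root → κ (B.parent (π₁ d)) = κ (π₁ d) → π₂ (D.parent d) = π₂ d) ∧
      (∀ d, d ≠ D.root → κ (B.parent (π₁ d)) ≠ κ (π₁ d) → π₂ (D.parent d) = C.parent (π₂ d)) := by
  classical
  let W := {q : B.V × C.V // κ q.1 = g q.2}
  have hgne : ∀ q : W, q.1.1 ≠ B.root → κ (B.parent q.1.1) ≠ κ q.1.1 → q.1.2 ≠ C.root ∧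
      κ (B.parent q.1.1) = g (C.parent q.1.2) := by
    intro q h1 h2
    have h3 := (hκ.2 _ h1).resolve_left h2
    have h4 : q.1.2 ≠ C.root := fun h => h3.1 (by rw [q.2, h, hg.root])
    exact ⟨h4, by rw [h3.2, hg.parent _ h4, q.2]⟩
  let r : W := ⟨(B.root, C.root), by rw [hκ.1, hg.root]⟩
  -- Since `g` preserves levels, the second coordinate moves down exactly when `κ` changes along the
  -- step in `B`.
  let p : W → W := fun q => if h : q.1.1 = B.root then r else
    if h' : κ (B.parent q.1.1) = κ q.1.1 then ⟨(B.parent q.1.1, q.1.2), by simp only; rw [h', q.2]⟩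
    else ⟨(B.parent q.1.1, C.parent q.1.2), (hgne q h h').2⟩
  have hwr : ∀ q : W, q ≠ r → q.1.1 ≠ B.root := by
    intro q hq h
    refine hq (Subtype.ext (Prod.ext h ?_))
    by_contra h2
    exact hg.ne_root _ h2 (by rw [← q.2, h, hκ.1])
  have hp1 : ∀ q : W, (h : q.1.1 ≠ B.root) → (p q).1.1 = B.parent q.1.1 := by
    intro q h
    simp only [p, dif_neg h]
    split_ifs <;> rfl
  have hp2 : ∀ q : W, (h : q.1.1 ≠ B.root) → κ (B.parent q.1.1) = κ q.1.1 →
      (p q).1.2 = q.1.2 := by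
    intro q h h'
    simp only [p, dif_neg h, dif_pos h']
  have hp3 : ∀ q : W, (h : q.1.1 ≠ B.root) → κ (B.parent q.1.1) ≠ κ q.1.1 →
      (p q).1.2 = C.parent q.1.2 := by
    intro q h h'
    simp only [p, dif_neg h, dif_neg h']
  have hp : ∀ q : W, q ≠ r → B.depth (p q).1.1 < B.depth q.1.1 := fun q hq => by
    rw [hp1 q (hwr q hq)]; exact depth_parent_lt (hwr q hq)
  have hfin : Finite W := inferInstance
  have hnt : Nontrivial W := by
    obtain ⟨a, b, hab⟩ := exists_pair_ne B.V
    obtain ⟨c, hc⟩ := hg.surjective (κ a)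
    obtain ⟨d, hd⟩ := hg.surjective (κ b)
    exact ⟨⟨(a, c), hc.symm⟩, ⟨(b, d), hd.symm⟩, fun h => hab (by injection h with h; injection h)⟩
  let D : FinRootedTree := ofParent r p (fun q => B.depth q.1.1) hp
  have hD : ∀ q : W, q ≠ r → D.parent q = p q := fun q hq => ofParent_parent _ p _ hp q hq
  let π₁ : D.V → B.V := fun q : W => q.1.1
  let π₂ : D.V → C.V := fun q : W => q.1.2
  have hc : ∀ d : D.V, κ (π₁ d) = g (π₂ d) := fun d : W => d.2
  have hext : ∀ d d' : D.V, π₁ d = π₁ d' → π₂ d = π₂ d' → d = d' :=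
    fun d d' h1 h2 => Subtype.ext (Prod.ext h1 h2)
  have hex : ∀ b c, κ b = g c → ∃ d : D.V, π₁ d = b ∧ π₂ d = c :=
    fun b c h => ⟨(⟨(b, c), h⟩ : W), rfl, rfl⟩
  have hne : ∀ d, d ≠ D.root → π₁ d ≠ B.root := hwr
  have hpar1 : ∀ d : D.V, d ≠ D.root → π₁ (D.parent d) = B.parent (π₁ d) := fun d hd => by
    rw [hD d hd]; exact hp1 d (hwr d hd)
  have hpar2 : ∀ d : D.V, d ≠ D.root → κ (B.parent (π₁ d)) = κ (π₁ d) → π₂ (D.parent d) = π₂ d :=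
    fun d hd h => by rw [hD d hd]; exact hp2 d (hwr d hd) h
  have hpar3 : ∀ d : D.V, d ≠ D.root → κ (B.parent (π₁ d)) ≠ κ (π₁ d) →
      π₂ (D.parent d) = C.parent (π₂ d) :=
    fun d hd h => by rw [hD d hd]; exact hp3 d (hwr d hd) h
  refine ⟨D, π₁, π₂, hc, hext, hex, rfl, rfl, ⟨rfl, hne, hpar1, ?_⟩, hpar2, hpar3⟩
  intro d b hb hbd
  have key : ∀ d', π₁ d' = b → d' ≠ D.root := by
    rintro d' rfl rfl
    exact hb rfl
  by_cases h : κ (B.parent b) = κ b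
  · obtain ⟨d', h1, h2⟩ := hex b (π₂ d) (by rw [← h, hbd, hc])
    refine ⟨d', key d' h1, hext _ _ ?_ ?_, h1⟩
    · rw [hpar1 _ (key d' h1), h1, hbd]
    · rw [hpar2 _ (key d' h1) (by rw [h1, h]), h2]
  · obtain ⟨h3, h4⟩ := (hκ.2 b hb).resolve_left h
    obtain ⟨c, hc0, hc1, hc2⟩ := hg.lift (π₂ d) (κ b) h3 (by rw [← h4, hbd, hc])
    obtain ⟨d', h1, h2⟩ := hex b c hc2.symm
    refine ⟨d', key d' h1, hext _ _ ?_ ?_, h1⟩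
    · rw [hpar1 _ (key d' h1), h1, hbd]
    · rw [hpar3 _ (key d' h1) (by rwa [h1]), h2, hc1]

/-- Amalgamation of two light confluent maps. -/
theorem IsLC.amalgamate {f : B.V → A.V} {g : C.V → A.V} (hf : IsLC B A f) (hg : IsLC C A g) :
    ∃ (D : FinRootedTree) (p : D.V → B.V) (q : D.V → C.V), IsLC D B p ∧ IsLC D C q ∧
      f ∘ p = g ∘ q := by
  obtain ⟨D, p, q, hc, hext, hex, hr1, hr2, hp, -, hq⟩ := exists_pullback hf.isRT hg
  have hqp : ∀ d, d ≠ D.root → q (D.parent d) = C.parent (q d) := fun d hd => hq d hd (by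
    rw [hf.parent _ (hp.ne_root d hd)]
    exact parent_ne (hf.ne_root _ (hp.ne_root d hd)))
  refine ⟨D, p, q, hp, ⟨hr2, fun d hd h => ?_, hqp, fun d c hcr hcd => ?_⟩, funext hc⟩
  · exact hf.ne_root _ (hp.ne_root d hd) (by rw [hc, h, hg.root])
  · obtain ⟨b, hb, hb1, hb2⟩ := hf.lift (p d) (g c) (hg.ne_root c hcr) (by
      rw [← hg.parent c hcr, hcd, hc])
    obtain ⟨d', h1, h2⟩ := hex b c hb2
    have hd' : d' ≠ D.root := by
      rintro rfl
      exact hb (h1.symm.trans hr1)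
    exact ⟨d', hd', hext _ _ (by rw [hp.parent _ hd', h1, hb1]) (by rw [hqp _ hd', h2, hcd]), h2⟩

/-- Amalgamation of an insertion and a light confluent map. -/
theorem IsIns.amalgamate_isLC {f : B.V → A.V} {ι : A.V → B.V} {κ : B.V → A.V} {g : C.V → A.V}
    (hf : IsIns B A f ι κ) (hg : IsLC C A g) :
    ∃ (D : FinRootedTree) (p : D.V → B.V) (q : D.V → C.V), IsLC D B p ∧
      (∃ ι' κ', IsIns D C q ι' κ') ∧ f ∘ p = g ∘ q := by
  classical
  -- This `q` commutes with `κ`, not with `f`; it will serve as the `κ` of the new insertion.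
  obtain ⟨D, p, q, hc, hext, hex, hr1, hr2, hp, hq1, hq2⟩ := exists_pullback hf.κ_isRT hg
  choose j hj1 hj2 using fun c => hex (ι (g c)) c (hf.κ_ι _)
  have hj : ∀ d u, p d = ι u → j (q d) = d := by
    intro d u h
    apply hext
    · rw [hj1, ← hc, h, hf.κ_ι]
    · rw [hj2]
  have hrange : ∀ d, d ∈ range j ↔ p d ∈ range ι := by
    intro d
    constructor
    · rintro ⟨c, rfl⟩; exact ⟨_, (hj1 c).symm⟩
    · rintro ⟨u, hu⟩; exact ⟨_, hj d u hu.symm⟩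
  have hqne : ∀ d, d ≠ D.root → κ (p d) ≠ A.root → q d ≠ C.root := by
    intro d _ h h'
    exact h (by rw [hc, h', hg.root])
  -- Correction of `q` to a map over `f`: an inserted vertex that `f` sends to the lower end of its
  -- edge goes to the parent.
  let φ : D.V → C.V := fun d => if f (p d) = κ (p d) then q d else C.parent (q d)
  have hφ1 : ∀ d, f (p d) = κ (p d) → φ d = q d := fun d h => if_pos h
  have hφ2 : ∀ d, f (p d) ≠ κ (p d) → φ d = C.parent (q d) := fun d h => if_neg h
  refine ⟨D, p, φ, hp, ⟨j, q, fun c => ?_, hj2, ?_, ?_, ?_⟩, ?_⟩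
  · rw [hφ1, hj2]
    rw [hj1, hf.f_ι, hf.κ_ι]
  · exact hext _ _ (by rw [hj1, hr1, hg.root, hf.ι_root]) (by rw [hj2, hr2])
  · intro c hcr
    have hu := hg.ne_root c hcr
    have hjr : j c ≠ D.root := fun h => hcr (by rw [← hj2 c, h, hr2])
    have hpj := hp.parent _ hjr
    rw [hj1] at hpj
    rcases hf.old _ hu with h1 | ⟨h1, h2, h3, h4⟩
    · left
      apply hext
      · rw [hpj, hj1, h1, hg.parent c hcr]
      · rw [hj2, hq2 _ hjr, hj2]
        rw [hj1, h1, hf.κ_ι, hf.κ_ι]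
        exact parent_ne hu
    · right
      have h5 : q (D.parent (j c)) = c := by
        rw [hq1 _ hjr, hj2]
        rw [hj1, h2, hf.κ_ι]
      have h6 : D.parent (j c) ≠ D.root := fun h => hcr (by rw [← h5, h, hr2])
      have h7 : κ (B.parent (p (D.parent (j c)))) ≠ κ (p (D.parent (j c))) := by
        rw [hpj, h3, h2, hf.κ_ι]
        exact parent_ne hu
      refine ⟨by rw [hrange, hpj]; exact h1, h5, ?_, ?_⟩
      · apply hext
        · rw [hp.parent _ h6, hpj, h3, hj1, hg.parent c hcr]
        · rw [hq2 _ h6 h7, h5, hj2]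
      · by_cases h8 : f (p (D.parent (j c))) = κ (p (D.parent (j c)))
        · left; rw [hφ1 _ h8, h5]
        · right; rw [hφ2 _ h8, h5]
  · intro d hd
    rw [hrange] at hd
    have hdr : d ≠ D.root := by
      rintro rfl
      exact hd ⟨A.root, by rw [hr1, hf.ι_root]⟩
    rcases hf.new _ hd with ⟨h1, h2⟩ | ⟨h1, h2⟩
    · left
      have hcr := hqne d hdr h1
      have hjr : j (q d) ≠ D.root := fun h => hcr (by rw [← hj2 (q d), h, hr2])
      refine ⟨hcr, hext _ _ ?_ ?_⟩
      · rw [hp.parent _ hjr, hj1, ← hc, h2]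
      · rw [hq1 _ hjr, hj2]
        rw [hj1, ← hc, h2, hf.κ_ι]
    · right
      refine ⟨hext _ _ ?_ ?_, hφ1 _ h2⟩
      · rw [hp.parent _ hdr, hj1, h1, hc]
      · rw [hq1 _ hdr, hj2]
        rw [h1, hf.κ_ι]
  · funext d
    simp only [Function.comp_apply]
    by_cases h : f (p d) = κ (p d)
    · rw [hφ1 _ h, h, hc]
    · have hd : p d ∉ range ι := by
        rintro ⟨u, hu⟩
        rw [← hu, hf.f_ι, hf.κ_ι] at h
        exact h rfl
      have hdr : d ≠ D.root := by
        rintro rfl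
        exact hd ⟨A.root, by rw [hr1, hf.ι_root]⟩
      rcases hf.new _ hd with ⟨h1, h2⟩ | ⟨h1, h2⟩
      · rw [hφ2 _ h, hg.parent _ (hqne d hdr h1), ← hc]
        exact (hf.new_edge hd h1 h2).2.resolve_left h
      · exact absurd h2 h

/-- Amalgamation of two insertions. -/
theorem IsIns.amalgamate {f₁ : B.V → A.V} {ι₁ : A.V → B.V} {κ₁ : B.V → A.V}
    {f₂ : C.V → A.V} {ι₂ : A.V → C.V} {κ₂ : C.V → A.V}
    (h₁ : IsIns B A f₁ ι₁ κ₁) (h₂ : IsIns C A f₂ ι₂ κ₂) :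
    ∃ (D : FinRootedTree) (p : D.V → B.V) (q : D.V → C.V), (∃ ι κ, IsIns D B p ι κ) ∧
      (∃ ι κ, IsIns D C q ι κ) ∧ f₁ ∘ p = f₂ ∘ q := by
  classical
  -- `E₁ u` and `E₂ u` say that the edge below `u` is subdivided in `B` and in `C`. If both happen,
  -- the new vertex of `B` is placed in `D` on that side of the new vertex of `C` to which `f₁`
  -- retracts it; in `C` it can then be retracted to the old vertex on the same side.
  let E₁ : A.V → Prop := fun u => B.parent (ι₁ u) ∉ range ι₁
  let E₂ : A.V → Prop := fun u => C.parent (ι₂ u) ∉ range ι₂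
  have hE₁ : ∀ u, u ≠ A.root → E₁ u → κ₁ (B.parent (ι₁ u)) = u ∧
      B.parent (B.parent (ι₁ u)) = ι₁ (A.parent u) ∧
      (f₁ (B.parent (ι₁ u)) = u ∨ f₁ (B.parent (ι₁ u)) = A.parent u) := fun u hu h =>
    ((h₁.old u hu).resolve_left fun h' => h ⟨_, h'.symm⟩).2
  have hE₂ : ∀ u, u ≠ A.root → E₂ u → κ₂ (C.parent (ι₂ u)) = u ∧
      C.parent (C.parent (ι₂ u)) = ι₂ (A.parent u) ∧
      (f₂ (C.parent (ι₂ u)) = u ∨ f₂ (C.parent (ι₂ u)) = A.parent u) := fun u hu h =>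
    ((h₂.old u hu).resolve_left fun h' => h ⟨_, h'.symm⟩).2
  have hE₁' : ∀ u, u ≠ A.root → ¬ E₁ u → B.parent (ι₁ u) = ι₁ (A.parent u) := fun u hu h =>
    (h₁.old u hu).resolve_right fun h' => h h'.1
  have hE₂' : ∀ u, u ≠ A.root → ¬ E₂ u → C.parent (ι₂ u) = ι₂ (A.parent u) := fun u hu h =>
    (h₂.old u hu).resolve_right fun h' => h h'.1
  have hr₁ : E₁ A.root → False := fun h => h ⟨A.root, by rw [h₁.ι_root, parent_root]⟩
  have hr₂ : E₂ A.root → False := fun h => h ⟨A.root, by rw [h₂.ι_root, parent_root]⟩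
  have hιE : ∀ u v, B.parent (ι₁ u) = ι₁ v → ¬ E₁ u := fun u v h h' => h' ⟨v, h.symm⟩
  -- the vertex of `B` below which the second insertion takes place
  let t : A.V → B.V := fun u =>
    if E₁ u ∧ f₁ (B.parent (ι₁ u)) = u then B.parent (ι₁ u) else ι₁ u
  have ht1 : ∀ u, E₁ u → f₁ (B.parent (ι₁ u)) = u → t u = B.parent (ι₁ u) :=
    fun u h h' => if_pos ⟨h, h'⟩
  have ht2 : ∀ u, ¬ (E₁ u ∧ f₁ (B.parent (ι₁ u)) = u) → t u = ι₁ u := fun u h => if_neg h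
  have htκ : ∀ u, κ₁ (t u) = u := by
    intro u
    by_cases h : E₁ u ∧ f₁ (B.parent (ι₁ u)) = u
    · rw [ht1 u h.1 h.2, (hE₁ u (fun e => hr₁ (e ▸ h.1)) h.1).1]
    · rw [ht2 u h, h₁.κ_ι]
  have htr : ∀ u, u ≠ A.root → t u ≠ B.root := by
    intro u hu h
    exact hu (by rw [← htκ u, h, h₁.κ_isRT.1])
  let N := {x : C.V // x ∉ range ι₂}
  let e : N → Prop := fun x => κ₂ x.1 ≠ A.root ∧ C.parent (ι₂ (κ₂ x.1)) = x.1
  have heE : ∀ x : N, e x → E₂ (κ₂ x.1) := fun x hx h => x.2 (hx.2 ▸ h)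
  have hEe : ∀ u, u ≠ A.root → (hE : E₂ u) → e ⟨C.parent (ι₂ u), hE⟩ := by
    intro u hu hE
    simp only [e]
    rw [(hE₂ u hu hE).1]
    exact ⟨hu, rfl⟩
  have hne : ∀ x : N, ¬ e x → C.parent x.1 = ι₂ (κ₂ x.1) ∧ f₂ x.1 = κ₂ x.1 := fun x hx =>
    (h₂.new x.1 x.2).resolve_left hx
  obtain ⟨D, f, ι, κ, m, hD, hm, hrange, d1, d2, d3, d4, d5, d6⟩ := exists_insertion B N
    (fun x => if e x then t (κ₂ x.1) else ι₁ (κ₂ x.1)) e (fun x => f₂ x.1 = κ₂ x.1)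
    (fun x hx => by simp only [if_pos hx]; exact htr _ hx.1)
    (fun x y hx hy h => by
      simp only [if_pos hx, if_pos hy] at h
      have h' : κ₂ x.1 = κ₂ y.1 := by rw [← htκ (κ₂ x.1), h, htκ]
      exact Subtype.ext (by rw [← hx.2, ← hy.2, h']))
  have k1 : ∀ u, u ≠ A.root → (hE : E₂ u) → D.parent (ι (t u)) = m ⟨C.parent (ι₂ u), hE⟩ := by
    intro u hu hE
    have h := d1 _ (hEe u hu hE)
    simp only [if_pos (hEe u hu hE), (hE₂ u hu hE).1] at h
    exact h
  have k2 : ∀ b, b ≠ B.root → ¬ (κ₁ b ≠ A.root ∧ E₂ (κ₁ b) ∧ t (κ₁ b) = b) →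
      D.parent (ι b) = ι (B.parent b) := by
    intro b hb h
    refine d2 b hb fun x hx hxb => h ?_
    simp only [if_pos hx] at hxb
    have h' : κ₁ b = κ₂ x.1 := by rw [← hxb, htκ]
    rw [h']
    exact ⟨hx.1, heE x hx, hxb⟩
  have k3 : ∀ u, u ≠ A.root → (hE : E₂ u) →
      D.parent (m ⟨C.parent (ι₂ u), hE⟩) = ι (B.parent (t u)) := by
    intro u hu hE
    have h := d3 _ (hEe u hu hE)
    simp only [if_pos (hEe u hu hE), (hE₂ u hu hE).1] at h
    exact h
  have k4 : ∀ x : N, ¬ e x → D.parent (m x) = ι (ι₁ (κ₂ x.1)) := by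
    intro x hx
    have h := d4 x hx
    simpa only [if_neg hx] using h
  have k5 : ∀ u, u ≠ A.root → (hE : E₂ u) → f₂ (C.parent (ι₂ u)) ≠ u →
      f (m ⟨C.parent (ι₂ u), hE⟩) = B.parent (t u) := by
    intro u hu hE hf
    have h := d5 _ (hEe u hu hE) (by rwa [(hE₂ u hu hE).1])
    simp only [if_pos (hEe u hu hE), (hE₂ u hu hE).1] at h
    exact h
  have k6 : ∀ u, u ≠ A.root → (hE : E₂ u) → f₂ (C.parent (ι₂ u)) = u →
      f (m ⟨C.parent (ι₂ u), hE⟩) = t u := by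
    intro u hu hE hf
    have h := d6 _ (Or.inr (by rw [hf, (hE₂ u hu hE).1] : f₂ (⟨C.parent (ι₂ u), hE⟩ : N).1 = κ₂ _))
    simp only [if_pos (hEe u hu hE), (hE₂ u hu hE).1] at h
    exact h
  have k7 : ∀ x : N, ¬ e x → f (m x) = ι₁ (κ₂ x.1) := by
    intro x hx
    have h := d6 x (Or.inl hx)
    simpa only [if_neg hx] using h
  have hNe : ∀ x : N, e x → ∃ u, u ≠ A.root ∧ ∃ hE : E₂ u, x = ⟨C.parent (ι₂ u), hE⟩ :=
    fun x hx => ⟨_, hx.1, heE x hx, Subtype.ext hx.2.symm⟩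
  have hmι : ∀ x b, m x ≠ ι b := fun x b h => (hrange (m x)).1 ⟨x, rfl⟩ ⟨b, h.symm⟩
  have hcases : ∀ d, (∃ b, ι b = d) ∨ ∃ x, m x = d := fun d => by
    by_cases hd : d ∈ range ι
    · exact Or.inl hd
    · exact Or.inr ((hrange d).2 hd)
  let i : C.V → D.V := fun c => if h : c ∈ range ι₂ then ι (ι₁ (f₂ c)) else m ⟨c, h⟩
  have i1 : ∀ u, i (ι₂ u) = ι (ι₁ u) := fun u => by
    simp only [i, dif_pos (mem_range_self u), h₂.f_ι]
  have i2 : ∀ x : N, i x.1 = m x := fun x => dif_neg x.2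
  -- The doubly subdivided edges in which the new vertex `b` of `B` comes lowest: as seen from `C`,
  -- it is inserted below the new vertex of `C` and not below the old vertex.
  let P : B.V → Prop := fun b => κ₁ b ≠ A.root ∧ E₁ (κ₁ b) ∧ B.parent (ι₁ (κ₁ b)) = b ∧
    f₁ b ≠ κ₁ b ∧ E₂ (κ₁ b)
  have hφex : ∀ d, ∃ c, (∀ b, ι b = d → c = ι₂ (f₁ b)) ∧ ∀ x, m x = d → c = x.1 := by
    intro d
    rcases hcases d with ⟨b, rfl⟩ | ⟨x, rfl⟩
    · exact ⟨ι₂ (f₁ b), fun b' h => by rw [hD.injective h], fun x h => absurd h (hmι _ _)⟩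
    · exact ⟨x.1, fun b' h => absurd h.symm (hmι _ _), fun y h => by rw [hm h]⟩
  choose φ φ1' φ2' using hφex
  have φ1 : ∀ b, φ (ι b) = ι₂ (f₁ b) := fun b => φ1' _ b rfl
  have φ2 : ∀ x, φ (m x) = x.1 := fun x => φ2' _ x rfl
  have hκex : ∀ d, ∃ c, (∀ b, ι b = d → c = if P b then C.parent (ι₂ (κ₁ b)) else ι₂ (κ₁ b)) ∧
      ∀ x, m x = d → c = x.1 := by
    intro d
    rcases hcases d with ⟨b, rfl⟩ | ⟨x, rfl⟩
    · exact ⟨if P b then C.parent (ι₂ (κ₁ b)) else ι₂ (κ₁ b),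
        fun b' h => by rw [hD.injective h], fun x h => absurd h (hmι _ _)⟩
    · exact ⟨x.1, fun b' h => absurd h.symm (hmι _ _), fun y h => by rw [hm h]⟩
  choose k κ1' κ2' using hκex
  have κ1 : ∀ b, P b → k (ι b) = C.parent (ι₂ (κ₁ b)) := fun b h => by
    rw [κ1' _ b rfl, if_pos h]
  have κ2 : ∀ b, ¬ P b → k (ι b) = ι₂ (κ₁ b) := fun b h => by
    rw [κ1' _ b rfl, if_neg h]
  have κ3 : ∀ x, k (m x) = x.1 := fun x => κ2' _ x rfl
  have hPι : ∀ u, ¬ P (ι₁ u) := by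
    rintro u ⟨-, h, h', -⟩
    rw [h₁.κ_ι] at h h'
    exact h ⟨u, h'.symm⟩
  have hirange : ∀ b, b ∉ range ι₁ → ι b ∉ range i := by
    rintro b hb ⟨c, hc⟩
    by_cases hcr : c ∈ range ι₂
    · obtain ⟨u, rfl⟩ := hcr
      rw [i1] at hc
      exact hb ⟨u, hD.injective hc⟩
    · exact hmι _ _ ((i2 ⟨c, hcr⟩).symm.trans hc)
  have hBroot : ∀ b, b ∉ range ι₁ → b ≠ B.root := fun b hb => h₁.ne_root hb
  refine ⟨D, f, φ, ⟨ι, κ, hD⟩, ⟨i, k, ⟨?_, ?_, ?_, ?_, ?_⟩⟩, ?_⟩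
  · intro c
    by_cases hc : c ∈ range ι₂
    · obtain ⟨u, rfl⟩ := hc
      rw [i1, φ1, h₁.f_ι]
    · rw [i2 ⟨c, hc⟩, φ2]
  · intro c
    by_cases hc : c ∈ range ι₂
    · obtain ⟨u, rfl⟩ := hc
      rw [i1, κ2 _ (hPι u), h₁.κ_ι]
    · rw [i2 ⟨c, hc⟩, κ3]
  · rw [← h₂.ι_root, i1, h₁.ι_root, hD.ι_root]
  · intro c hc
    by_cases hcr : c ∈ range ι₂
    · obtain ⟨u, rfl⟩ := hcr
      have hu : u ≠ A.root := fun h => hc (by rw [h, h₂.ι_root])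
      have hBu : ι₁ u ≠ B.root := h₁.ι_ne_root hu
      rw [i1]
      by_cases hT : E₁ u ∧ f₁ (B.parent (ι₁ u)) = u
      · obtain ⟨a1, a2, a3⟩ := hE₁ u hu hT.1
        have ht := ht1 u hT.1 hT.2
        have b1 : D.parent (ι (ι₁ u)) = ι (B.parent (ι₁ u)) := k2 _ hBu (by
          rw [h₁.κ_ι, ht]
          rintro ⟨-, -, h⟩
          exact parent_ne hBu h)
        right
        rw [b1, κ2 _ (by rintro ⟨-, -, -, h, -⟩; exact h (by rw [hT.2, a1])), a1, φ1, hT.2]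
        refine ⟨hirange _ hT.1, rfl, ?_, Or.inl rfl⟩
        by_cases h2 : E₂ u
        · rw [i2 ⟨_, h2⟩, ← ht, k1 u hu h2]
        · rw [hE₂' u hu h2, i1, k2 _ (hBroot _ hT.1) (by rw [a1]; exact fun h => h2 h.2.1), a2]
      · have ht := ht2 u hT
        by_cases h2 : E₂ u
        · left
          rw [i2 ⟨_, h2⟩, ← k1 u hu h2, ht]
        · have b1 : D.parent (ι (ι₁ u)) = ι (B.parent (ι₁ u)) := k2 _ hBu (by
            rw [h₁.κ_ι]; exact fun h => h2 h.2.1)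
          by_cases h1 : E₁ u
          · obtain ⟨a1, a2, a3⟩ := hE₁ u hu h1
            have a4 := a3.resolve_left fun h => hT ⟨h1, h⟩
            right
            rw [b1, κ2 _ (by rintro ⟨-, -, -, -, h⟩; exact h2 (a1 ▸ h)), a1, φ1, a4,
              hE₂' u hu h2, i1, k2 _ (hBroot _ h1) (by rw [a1]; exact fun h => h2 h.2.1), a2]
            exact ⟨hirange _ h1, rfl, rfl, Or.inr rfl⟩
          · left
            rw [b1, hE₁' u hu h1, hE₂' u hu h2, i1]
    · by_cases he : e ⟨c, hcr⟩
      · obtain ⟨u, hu, h2, hcu⟩ := hNe _ he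
        rw [i2 ⟨c, hcr⟩, hcu]
        obtain rfl : c = C.parent (ι₂ u) := congrArg Subtype.val hcu
        rw [k3 u hu h2, (hE₂ u hu h2).2.1, i1]
        by_cases hT : E₁ u ∧ f₁ (B.parent (ι₁ u)) = u
        · left
          rw [ht1 u hT.1 hT.2, (hE₁ u hu hT.1).2.1]
        · rw [ht2 u hT]
          by_cases h1 : E₁ u
          · obtain ⟨a1, a2, a3⟩ := hE₁ u hu h1
            have a4 := a3.resolve_left fun h => hT ⟨h1, h⟩
            right
            rw [κ1 _ (by
              simp only [P]
              rw [a1, a4]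
              exact ⟨hu, h1, rfl, parent_ne hu, h2⟩), a1, φ1, a4]
            refine ⟨hirange _ h1, rfl, ?_, Or.inr rfl⟩
            rw [k2 _ (hBroot _ h1) (by
              rw [a1, ht2 u hT]
              rintro ⟨-, -, h⟩
              exact parent_ne (h₁.ι_ne_root hu) h.symm), a2]
          · left
            rw [hE₁' u hu h1]
      · left
        rw [i2 ⟨c, hcr⟩, k4 _ he, (hne _ he).1, i1]
  · intro d hd
    rcases hcases d with ⟨b, rfl⟩ | ⟨x, rfl⟩
    swap
    · exact absurd ⟨x.1, i2 x⟩ hd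
    have hb : b ∉ range ι₁ := by
      rintro ⟨u, rfl⟩
      exact hd ⟨ι₂ u, i1 u⟩
    rcases h₁.new b hb with ⟨h3, h4⟩ | ⟨h3, h4⟩
    · left
      obtain ⟨u, rfl⟩ : ∃ u, u = κ₁ b := ⟨_, rfl⟩
      have h1 : E₁ (κ₁ b) := fun h => hb (h4 ▸ h)
      obtain ⟨a1, a2, a3⟩ := hE₁ _ h3 h1
      by_cases hP : P b
      · have h2 := hP.2.2.2.2
        have hT : ¬ (E₁ (κ₁ b) ∧ f₁ (B.parent (ι₁ (κ₁ b))) = κ₁ b) := by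
          rw [h4]; exact fun h => hP.2.2.2.1 h.2
        rw [κ1 b hP, i2 ⟨_, h2⟩, k3 _ h3 h2, ht2 _ hT, h4]
        exact ⟨h₂.ne_root h2, rfl⟩
      · rw [κ2 b hP, i1]
        refine ⟨h₂.ι_ne_root h3, ?_⟩
        rw [k2 _ (h₁.ι_ne_root h3), h4]
        rw [h₁.κ_ι]
        rintro ⟨-, h2, ht⟩
        have hf : f₁ b = κ₁ b := by
          by_contra hf
          exact hP ⟨h3, h1, h4, hf, h2⟩
        rw [ht1 _ h1 (by rw [h4, hf])] at ht
        exact parent_ne (h₁.ι_ne_root h3) ht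
    · right
      have hP : ¬ P b := fun h => h.2.2.2.1 h4
      rw [κ2 b hP, i1, φ1, h4]
      refine ⟨?_, rfl⟩
      rw [k2 b (hBroot b hb), h3]
      rintro ⟨h5, h6, h7⟩
      by_cases hT : E₁ (κ₁ b) ∧ f₁ (B.parent (ι₁ (κ₁ b))) = κ₁ b
      · rw [ht1 _ hT.1 hT.2] at h7
        have h8 := (hE₁ _ h5 hT.1).2.1
        rw [h7, h3] at h8
        exact parent_ne h5 (h₁.injective h8).symm
      · rw [ht2 _ hT] at h7
        exact hb ⟨_, h7⟩
  · funext d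
    simp only [Function.comp_apply]
    rcases hcases d with ⟨b, rfl⟩ | ⟨x, rfl⟩
    · rw [hD.f_ι, φ1, h₂.f_ι]
    · rw [φ2]
      by_cases he : e x
      · obtain ⟨u, hu, h2, rfl⟩ := hNe _ he
        obtain ⟨a1, a2, a3⟩ := hE₂ u hu h2
        by_cases hf : f₂ (C.parent (ι₂ u)) = u
        · rw [k6 u hu h2 hf, hf]
          by_cases hT : E₁ u ∧ f₁ (B.parent (ι₁ u)) = u
          · rw [ht1 u hT.1 hT.2, hT.2]
          · rw [ht2 u hT, h₁.f_ι]
        · rw [k5 u hu h2 hf, a3.resolve_left hf]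
          by_cases hT : E₁ u ∧ f₁ (B.parent (ι₁ u)) = u
          · rw [ht1 u hT.1 hT.2, (hE₁ u hu hT.1).2.1, h₁.f_ι]
          · rw [ht2 u hT]
            by_cases h1 : E₁ u
            · exact (hE₁ u hu h1).2.2.resolve_left fun h => hT ⟨h1, h⟩
            · rw [hE₁' u hu h1, h₁.f_ι]
      · rw [k7 x he, h₁.f_ι, (hne x he).2]

/-! ### Amalgamation of simple*-confluent maps -/

/-- In the elementary squares opposite sides are of the same kind. So a single insertion or light
confluent map can be carried along a whole composition by a row of squares (`grid`), and stacking
rows treats two compositions. -/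
theorem SimpleStarConfluent.amalgamate {f : B.V → A.V} {g : C.V → A.V}
    (hf : SimpleStarConfluent B A f) (hg : SimpleStarConfluent C A g) :
    ∃ (D : FinRootedTree) (p : D.V → B.V) (q : D.V → C.V), SimpleStarConfluent D B p ∧
      SimpleStarConfluent D C q ∧ f ∘ p = g ∘ q := by
  -- amalgamation with a class of maps which amalgamates with both kinds of generators
  have grid : ∀ Q : ∀ S T : FinRootedTree, (S.V → T.V) → Prop,
      (∀ {B A C : FinRootedTree} {f : B.V → A.V} {g : C.V → A.V},
        ((∃ ι κ, IsIns B A f ι κ) ∨ IsLC B A f) → Q C A g →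
        ∃ (D : FinRootedTree) (p : D.V → B.V) (q : D.V → C.V), Q D B p ∧
          SimpleStarConfluent D C q ∧ f ∘ p = g ∘ q) →
      ∀ {B A : FinRootedTree} {f : B.V → A.V}, SimpleStarConfluent B A f →
      ∀ (C : FinRootedTree) (g : C.V → A.V), Q C A g →
        ∃ (D : FinRootedTree) (p : D.V → B.V) (q : D.V → C.V), Q D B p ∧
          SimpleStarConfluent D C q ∧ f ∘ p = g ∘ q := by
    intro Q hQ B A f hf
    refine SimpleStarConfluent.induction_isIns (P := fun B A f => ∀ (C : FinRootedTree)
      (g : C.V → A.V), Q C A g → ∃ (D : FinRootedTree) (p : D.V → B.V) (q : D.V → C.V),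
        Q D B p ∧ SimpleStarConfluent D C q ∧ f ∘ p = g ∘ q) ?_ ?_ ?_ hf
    · exact fun h C g hg => hQ (Or.inl ⟨_, _, h⟩) hg
    · exact fun h C g hg => hQ (Or.inr h) hg
    · intro R S T f g h1 h2 C k hk
      obtain ⟨D, p, q, hp, hq, h3⟩ := h2 C k hk
      obtain ⟨D', p', q', hp', hq', h4⟩ := h1 D p hp
      refine ⟨D', p', q ∘ q', hp', hq'.comp hq, ?_⟩
      rw [Function.comp_assoc, h4, ← Function.comp_assoc, h3, Function.comp_assoc]
  have hlc := @grid IsLC (by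
    rintro B A C f g (⟨ι, κ, h⟩ | h) hg
    · obtain ⟨D, p, q, hp, ⟨ι', κ', hq⟩, h3⟩ := h.amalgamate_isLC hg
      exact ⟨D, p, q, hp, hq.simpleStarConfluent, h3⟩
    · obtain ⟨D, p, q, hp, hq, h3⟩ := h.amalgamate hg
      exact ⟨D, p, q, hp, hq.simpleStarConfluent, h3⟩)
  have hins := @grid (fun S T f => ∃ ι κ, IsIns S T f ι κ) (by
    rintro B A C f g (⟨ι, κ, h⟩ | h) ⟨ι', κ', hg⟩
    · obtain ⟨D, p, q, hp, ⟨ι', κ', hq⟩, h3⟩ := h.amalgamate hg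
      exact ⟨D, p, q, hp, hq.simpleStarConfluent, h3⟩
    · obtain ⟨D, p, q, hp, hq, h3⟩ := hg.amalgamate_isLC h
      exact ⟨D, q, p, hq, hp.simpleStarConfluent, h3.symm⟩)
  refine SimpleStarConfluent.induction_isIns (P := fun C A g => ∀ (B : FinRootedTree)
    (f : B.V → A.V), SimpleStarConfluent B A f → ∃ (D : FinRootedTree) (p : D.V → B.V)
      (q : D.V → C.V), SimpleStarConfluent D B p ∧ SimpleStarConfluent D C q ∧ f ∘ p = g ∘ q)
    ?_ ?_ ?_ hg B f hf
  · intro C A g ι κ h B f hf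
    obtain ⟨D, p, q, ⟨ι, κ, hp⟩, hq, h3⟩ := hins hf _ _ ⟨_, _, h⟩
    exact ⟨D, p, q, hp.simpleStarConfluent, hq, h3⟩
  · intro C A g h B f hf
    obtain ⟨D, p, q, hp, hq, h3⟩ := hlc hf _ _ h
    exact ⟨D, p, q, hp.simpleStarConfluent, hq, h3⟩
  · intro R S T g k h1 h2 B f hf
    obtain ⟨D, p, q, hp, hq, h3⟩ := h2 B f hf
    obtain ⟨D', p', q', hp', hq', h4⟩ := h1 D q hq
    refine ⟨D', p ∘ p', q', hp'.comp hp, hq', ?_⟩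
    rw [← Function.comp_assoc, h3, Function.comp_assoc, h4, ← Function.comp_assoc]

end FinRootedTree

/-! ### Compactness and projections of inverse limits. -/

theorem nonempty_iInter_of_antitone {Z : Type*} [TopologicalSpace Z] [CompactSpace Z]
    (K : ℕ → Set Z) (hK : ∀ n, IsClosed (K n)) (hne : ∀ n, (K n).Nonempty)
    (hanti : ∀ n, K (n + 1) ⊆ K n) : (⋂ n, K n).Nonempty :=
  IsCompact.nonempty_iInter_of_sequence_nonempty_isCompact_isClosed K hanti hne
    (hK 0).isCompact hK

namespace TreeSequence

open FinRootedTree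

variable {s : TreeSequence SimpleStarConfluent}

theorem isClosed_limit (s : TreeSequence SimpleStarConfluent) :
    IsClosed {x : ∀ n, (s.F n).V | ∀ n, s.bond n (x (n + 1)) = x n} := by
  have : {x : ∀ n, (s.F n).V | ∀ n, s.bond n (x (n + 1)) = x n} =
      ⋂ n, {x | s.bond n (x (n + 1)) = x n} := by
    ext x; simp
  rw [this]
  refine isClosed_iInter fun n => isClosed_eq ?_ (continuous_apply n)
  exact (continuous_of_discreteTopology (f := s.bond n)).comp (continuous_apply (n + 1))

instance : CompactSpace s.Limit := isCompact_iff_compactSpace.1 (isClosed_limit s).isCompact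

theorem continuous_proj (n : ℕ) : Continuous (s.proj n) :=
  (continuous_apply n).comp continuous_subtype_val

theorem isClosed_proj (n : ℕ) (K : Set (s.F n).V) : IsClosed {x : s.Limit | s.proj n x ∈ K} :=
  (isClosed_discrete K).preimage (continuous_proj n)

theorem isOpen_proj (n : ℕ) (K : Set (s.F n).V) : IsOpen {x : s.Limit | s.proj n x ∈ K} :=
  (isOpen_discrete K).preimage (continuous_proj n)

theorem ext_proj {x y : s.Limit} (h : ∀ n, s.proj n x = s.proj n y) : x = y :=
  Subtype.ext (funext h)

theorem bond_proj (n : ℕ) (x : s.Limit) : s.bond n (s.proj (n + 1) x) = s.proj n x := x.2 n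

theorem proj_eq_of_le {m n : ℕ} (h : m ≤ n) {x y : s.Limit} (hxy : s.proj n x = s.proj n y) :
    s.proj m x = s.proj m y := by
  induction n, h using Nat.le_induction with
  | base => exact hxy
  | succ n _ ih => exact ih (by rw [← bond_proj, hxy, bond_proj])

theorem bond_surjective (n : ℕ) : Function.Surjective (s.bond n) := (s.bond_mem n).isEpi.surj

/-- In the full product, the sequences through `v` that obey the bonding relations below level `n +
d` form a decreasing family of nonempty closed sets. -/
theorem proj_surjective (n : ℕ) : Function.Surjective (s.proj n) := by
  intro v
  -- Coordinates below `m` are forced by the bonding maps; those above are arbitrary, and roots are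
  -- used as fillers.
  have h1 : ∀ m (w : (s.F m).V), ∃ x : ∀ n, (s.F n).V, x m = w ∧
      ∀ i < m, s.bond i (x (i + 1)) = x i := by
    intro m
    induction m with
    | zero =>
      intro w
      exact ⟨Function.update (fun n => (s.F n).root) 0 w, by simp, fun i hi => by omega⟩
    | succ m ih =>
      intro w
      obtain ⟨x, hx, hx'⟩ := ih (s.bond m w)
      refine ⟨Function.update x (m + 1) w, by simp, fun i hi => ?_⟩
      rw [Function.update_of_ne (show i ≠ m + 1 by omega)]
      rcases Nat.lt_succ_iff_lt_or_eq.1 hi with hi | rfl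
      · rw [Function.update_of_ne (by omega)]
        exact hx' i hi
      · rw [Function.update_self, hx]
  have h2 : ∀ d, ∃ x : ∀ n, (s.F n).V, x n = v ∧ ∀ i < n + d, s.bond i (x (i + 1)) = x i := by
    intro d
    induction d with
    | zero => exact h1 n v
    | succ d ih =>
      obtain ⟨x, hx, hx'⟩ := ih
      obtain ⟨w, hw⟩ := bond_surjective (n + d) (x (n + d))
      refine ⟨Function.update x (n + d + 1) w, by
        rw [Function.update_of_ne (by omega), hx], fun i hi => ?_⟩
      rw [Function.update_of_ne (show i ≠ n + d + 1 by omega)]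
      rcases Nat.lt_or_eq_of_le (show i ≤ n + d by omega) with hi | rfl
      · rw [Function.update_of_ne (by omega)]
        exact hx' i hi
      · rw [Function.update_self, hw]
  obtain ⟨x, hx⟩ := nonempty_iInter_of_antitone
    (fun d => {x : ∀ n, (s.F n).V | x n = v ∧ ∀ i < n + d, s.bond i (x (i + 1)) = x i})
    (fun d => by
      have : {x : ∀ n, (s.F n).V | x n = v ∧ ∀ i < n + d, s.bond i (x (i + 1)) = x i} =
          {x | x n = v} ∩ ⋂ i, ⋂ (_ : i < n + d), {x | s.bond i (x (i + 1)) = x i} := by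
        ext x; simp
      rw [this]
      refine (isClosed_eq (continuous_apply n) continuous_const).inter
        (isClosed_iInter fun i => isClosed_iInter fun _ => isClosed_eq ?_ (continuous_apply i))
      exact (continuous_of_discreteTopology (f := s.bond i)).comp (continuous_apply (i + 1)))
    h2 (fun d x hx => ⟨hx.1, fun i hi => hx.2 i (by omega)⟩)
  rw [mem_iInter] at hx
  exact ⟨⟨x, fun i => (hx (i + 1)).2 i (by omega)⟩, (hx 0).1⟩

/-- A neighbourhood of the diagonal contains all pairs with equal `n`-th coordinate for some `n`. -/
theorem exists_proj_subset {U : Set (s.Limit × s.Limit)} (hU : IsOpen U) (hd : ∀ x, (x, x) ∈ U) :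
    ∃ n, ∀ x y, s.proj n x = s.proj n y → (x, y) ∈ U := by
  by_contra! h
  obtain ⟨⟨x, y⟩, hxy⟩ := nonempty_iInter_of_antitone
    (fun n => {q : s.Limit × s.Limit | s.proj n q.1 = s.proj n q.2} ∩ Uᶜ)
    (fun n => (isClosed_eq ((continuous_proj n).comp continuous_fst)
      ((continuous_proj n).comp continuous_snd)).inter hU.isClosed_compl)
    (fun n => by
      obtain ⟨x, y, h1, h2⟩ := h n
      exact ⟨(x, y), h1, h2⟩)
    (fun n q hq => ⟨proj_eq_of_le (Nat.le_succ n) hq.1, hq.2⟩)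
  rw [mem_iInter] at hxy
  have : x = y := ext_proj fun n => (hxy n).1
  subst this
  exact (hxy 0).2 (hd x)

/-- The extension property of an inverse sequence. -/
def HasExtension (s : TreeSequence SimpleStarConfluent) : Prop :=
  ∀ (j : ℕ) (B : FinRootedTree) (g : B.V → (s.F j).V), SimpleStarConfluent B (s.F j) g →
    ∃ (k : ℕ) (h : (s.F k).V → B.V), SimpleStarConfluent (s.F k) B h ∧
      ∀ x : s.Limit, g (h (s.proj k x)) = s.proj j x

end TreeSequence

namespace FinRootedTree

/-! ### Coinitial trees and enumerations -/

/-- The tree with one edge. -/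
def edgeTree : FinRootedTree :=
  ofParent (V := Bool) false (fun _ => false) (fun b => if b then 1 else 0) (by decide)

/-- A vertex of maximal depth is a leaf, and removing it is inverse to adding an edge; this can go
on until one vertex besides the root is left. Together with amalgamation it shows that any two trees
have a common cover. -/
theorem exists_simpleStarConfluent_edgeTree (A : FinRootedTree) :
    ∃ f, SimpleStarConfluent A edgeTree f := by
  classical
  induction hn : Nat.card A.V using Nat.strong_induction_on generalizing A with
  | _ n ih =>
    by_cases h : ∀ x y : A.V, x ≠ A.root → y ≠ A.root → x = y
    · have hpar : ∀ a, a ≠ A.root → A.parent a = A.root := fun a ha => by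
        by_contra h'
        exact parent_ne ha (h _ _ h' ha)
      have he : edgeTree.parent true = false := ofParent_parent _ _ _ _ true (by decide)
      let f : A.V → edgeTree.V := fun v => (if v = A.root then false else true : Bool)
      have f1 : f A.root = false := if_pos rfl
      have f2 : ∀ a, a ≠ A.root → f a = true := fun a ha => if_neg ha
      refine ⟨f, IsLC.simpleStarConfluent ⟨f1, ?_, ?_, ?_⟩⟩
      · intro a ha h'
        rw [f2 a ha] at h'
        exact Bool.noConfusion h'
      · intro a ha
        rw [hpar a ha, f1, f2 a ha, he]
      · intro a v hv hva
        have hv' : v = true := by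
          have : ∀ b : Bool, b ≠ false → b = true := by decide
          exact this v hv
        subst hv'
        rw [he] at hva
        have ha : a = A.root := by
          by_contra ha
          rw [f2 a ha] at hva
          exact Bool.noConfusion hva
        obtain ⟨b, hb⟩ := exists_ne A.root
        exact ⟨b, hb, by rw [hpar b hb, ha], f2 b hb⟩
    · push Not at h
      obtain ⟨a, b, ha, hb, hab⟩ := h
      obtain ⟨x, hx⟩ := Finite.exists_max A.depth
      have hxr : x ≠ A.root := by
        rintro rfl
        have h1 := hx a
        rw [depth_root, Nat.le_zero, depth_eq_zero] at h1
        exact ha h1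
      obtain ⟨A', j, hj, hrange, hjr, hA'⟩ := exists_delete_vertex hxr (by
        by_cases hax : a = x
        · exact ⟨A.root, b, hb.symm, hxr.symm, fun h => hab (hax.trans h.symm)⟩
        · exact ⟨A.root, a, ha.symm, hxr.symm, hax⟩)
      have hlift : ∀ s, s ≠ x → ∃ t, j t = s := fun s hs => by
        have : s ∈ range j := by rw [hrange]; exact hs
        exact this
      have hjx : ∀ t, j t ≠ x := fun t => by
        have : j t ∈ ({x}ᶜ : Set A.V) := hrange ▸ mem_range_self t
        exact this
      have hgex : ∀ v, ∃ t, j t = if v = x then A.parent x else v := by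
        intro v
        apply hlift
        split_ifs with hv
        exacts [parent_ne hxr, hv]
      choose g hg using hgex
      have hgj : ∀ t, g (j t) = t := fun t => hj (by rw [hg, if_neg (hjx t)])
      have hleaf : ∀ v, v ≠ A.root → A.parent v ≠ x := by
        rintro v hv rfl
        have h1 := depth_parent_lt hv
        have h2 := hx v
        omega
      have hins : IsIns A A' g j g := by
        refine ⟨hgj, hgj, hjr, fun u hu => Or.inl ?_, fun y hy => Or.inr ⟨?_, rfl⟩⟩
        · exact ((hA' u hu).2 (hleaf _ fun h => hu (hj (h.trans hjr.symm)))).symm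
        · have : y = x := by
            by_contra hne
            exact hy (hlift y hne)
          rw [hg, if_pos this, this]
      have hlt : Nat.card A'.V < n := by
        rw [← hn]
        refine (Nat.card_le_card_of_injective j hj).lt_of_ne fun hc => ?_
        obtain ⟨t, ht⟩ := (Function.Injective.bijective_of_nat_card_le hj hc.ge).2 x
        exact hjx t ht
      obtain ⟨f, hf⟩ := ih _ hlt A' rfl
      exact ⟨_, (hins.simpleStarConfluent_of_single hrange).comp hf⟩

theorem isLC_of_graphIso {S T : FinRootedTree} (φ : S.graph ≃g T.graph)
    (hr : φ S.root = T.root) : IsLC S T φ := by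
  have hne : ∀ v, v ≠ S.root → φ v ≠ T.root := fun v hv h =>
    hv (φ.injective (h.trans hr.symm))
  have hp := parent_eq_of_rank (T := S) (fun v => φ.symm (T.parent (φ v)))
    (fun v => T.depth (φ v))
    (fun v hv => by
      rw [← φ.map_adj_iff]
      simpa using adj_parent (hne v hv))
    (fun v hv => by simpa using depth_parent_lt (hne v hv))
  exact isLC_of_equiv φ.toEquiv hr fun a ha => by
    rw [hp a ha]
    simp

/-- Up to isomorphism there are only countably many simple*-confluent maps onto a tree. -/
theorem exists_enumeration (A : FinRootedTree) :
    ∃ (B : ℕ → FinRootedTree) (g : ∀ i, (B i).V → A.V), (∀ i, SimpleStarConfluent (B i) A (g i)) ∧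
      ∀ (C : FinRootedTree) (f : C.V → A.V), SimpleStarConfluent C A f →
        ∃ (i : ℕ) (e : (B i).V → C.V), SimpleStarConfluent (B i) C e ∧ g i = f ∘ e := by
  -- Trees on some `Fin n` with a map to the finite set `A.V`: a countable type of codes.
  let Γ := {c : Σ n : ℕ, SimpleGraph (Fin n) × Fin n × (Fin n → A.V) //
    ∃ (hN : Nontrivial (Fin c.1)) (hT : c.2.1.IsTree),
      SimpleStarConfluent ⟨Fin c.1, inferInstance, hN, c.2.1, hT, c.2.2.1⟩ A c.2.2.2}
  have hcode : ∀ (C : FinRootedTree) (f : C.V → A.V), SimpleStarConfluent C A f →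
      ∃ (c : Γ) (e : Fin c.1.1 → C.V),
        SimpleStarConfluent ⟨Fin c.1.1, inferInstance, c.2.choose, c.1.2.1,
          c.2.choose_spec.choose, c.1.2.2.1⟩ C e ∧ c.1.2.2.2 = f ∘ e := by
    intro C f hf
    let φ : C.V ≃ Fin (Nat.card C.V) := Finite.equivFin C.V
    have hN : Nontrivial (Fin (Nat.card C.V)) := φ.injective.nontrivial
    let iso := SimpleGraph.Iso.map φ C.graph
    have hT : (C.graph.map φ.toEmbedding).IsTree := iso.isTree_iff.1 C.isTree
    have hlc := (isLC_of_graphIso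
      (S := ⟨Fin (Nat.card C.V), inferInstance, hN, C.graph.map φ.toEmbedding, hT, φ C.root⟩)
      (T := C) iso.symm (φ.symm_apply_apply C.root)).simpleStarConfluent
    exact ⟨⟨⟨Nat.card C.V, C.graph.map φ.toEmbedding, φ C.root, f ∘ φ.symm⟩, hN, hT,
      hlc.comp hf⟩, φ.symm, hlc, rfl⟩
  have hne : Nonempty Γ := by
    obtain ⟨c, -⟩ := hcode A id (SimpleStarConfluent.id A)
    exact ⟨c⟩
  obtain ⟨enum, henum⟩ := exists_surjective_nat Γ
  refine ⟨fun i => ⟨Fin (enum i).1.1, inferInstance, (enum i).2.choose, (enum i).1.2.1,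
    (enum i).2.choose_spec.choose, (enum i).1.2.2.1⟩, fun i => (enum i).1.2.2.2,
    fun i => (enum i).2.choose_spec.choose_spec, ?_⟩
  intro C f hf
  obtain ⟨c, e, he, h⟩ := hcode C f hf
  obtain ⟨i, rfl⟩ := henum c
  exact ⟨i, e, he, h⟩

/-- A simple*-confluent map onto `A`. -/
structure Over (A : FinRootedTree) where
  tree : FinRootedTree
  map : tree.V → A.V
  mem : SimpleStarConfluent tree A map

/-- The `i`-th simple*-confluent map onto `A`. -/
noncomputable def enumOver (A : FinRootedTree) (i : ℕ) : Over A :=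
  ⟨(exists_enumeration A).choose i, _, (exists_enumeration A).choose_spec.choose_spec.1 i⟩

theorem exists_enumOver {A C : FinRootedTree} {f : C.V → A.V} (hf : SimpleStarConfluent C A f) :
    ∃ (i : ℕ) (e : (enumOver A i).tree.V → C.V), SimpleStarConfluent (enumOver A i).tree C e ∧
      (enumOver A i).map = f ∘ e :=
  (exists_enumeration A).choose_spec.choose_spec.2 C f hf

/-- Amalgamation, seen as pulling back a map onto `A` along another one. -/
noncomputable def Over.pullback {A : FinRootedTree} (a b : Over A) : Over b.tree :=
  ⟨_, _, (a.mem.amalgamate b.mem).choose_spec.choose_spec.choose_spec.2.1⟩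

theorem Over.exists_pullback_map {A : FinRootedTree} (a b : Over A) :
    ∃ q : (a.pullback b).tree.V → a.tree.V, SimpleStarConfluent _ _ q ∧
      a.map ∘ q = b.map ∘ (a.pullback b).map :=
  ⟨_, (a.mem.amalgamate b.mem).choose_spec.choose_spec.choose_spec.1,
    (a.mem.amalgamate b.mem).choose_spec.choose_spec.choose_spec.2.2⟩

/-! ### Construction of a generic sequence. -/

/-- A tree with an infinite matrix of maps onto it, which are waiting to be realized. -/
structure Stage where
  tree : FinRootedTree
  task : ℕ → ℕ → Over tree

/-- The stages of the construction of a generic sequence. -/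
noncomputable def stage : ℕ → Stage
  | 0 => ⟨edgeTree, fun _ i => enumOver _ i⟩
  -- The task coded by `n` becomes the bonding map; rows up to `n` are pulled back along it, and row
  -- `n + 1` starts with all maps onto the new tree. Later rows hold placeholders that are replaced
  -- when their stage is reached.
  | n + 1 => ⟨((stage n).task n.unpair.1 n.unpair.2).tree, fun j i =>
      if j ≤ n then ((stage n).task j i).pullback ((stage n).task n.unpair.1 n.unpair.2)
      else enumOver _ i⟩

/-- A generic sequence of trees. -/
noncomputable def genericSequence : TreeSequence SimpleStarConfluent where
  F n := (stage n).tree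
  bond n := ((stage n).task n.unpair.1 n.unpair.2).map
  bond_mem n := ((stage n).task n.unpair.1 n.unpair.2).mem

theorem stage_task_fresh (j i : ℕ) : (stage j).task j i = enumOver _ i := by
  cases j with
  | zero => rfl
  | succ n => exact if_neg (by omega)

theorem stage_task_old {j n : ℕ} (h : j ≤ n) (i : ℕ) : (stage (n + 1)).task j i =
    ((stage n).task j i).pullback ((stage n).task n.unpair.1 n.unpair.2) := if_pos h

/-- Up to a cover of its domain, `g` is entry `i` of row `j`. Its pullbacks are followed up to stage
`Nat.pair j i`, where the pullback itself is the next bonding map. As `j ≤ Nat.pair j i`, the row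
has been started by then. -/
theorem genericSequence_hasExtension : genericSequence.HasExtension := by
  intro j B g hg
  obtain ⟨i, e, he, hie⟩ := exists_enumOver hg
  have key : ∀ n, j ≤ n → ∃ (u : ((stage n).task j i).tree.V → (enumOver (stage j).tree i).tree.V)
      (α : (stage n).tree.V → (stage j).tree.V), SimpleStarConfluent _ _ u ∧
      (∀ x : genericSequence.Limit, α (genericSequence.proj n x) = genericSequence.proj j x) ∧
      (enumOver (stage j).tree i).map ∘ u = α ∘ ((stage n).task j i).map := by
    intro n hn
    induction n, hn using Nat.le_induction with
    | base =>
      rw [stage_task_fresh]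
      exact ⟨_root_.id, _root_.id, .id _, fun _ => rfl, rfl⟩
    | succ n hn ih =>
      obtain ⟨u, α, hu, hα, h⟩ := ih
      rw [stage_task_old hn]
      obtain ⟨q, hq, hq'⟩ := ((stage n).task j i).exists_pullback_map
        ((stage n).task n.unpair.1 n.unpair.2)
      refine ⟨u ∘ q, α ∘ ((stage n).task n.unpair.1 n.unpair.2).map, hq.comp hu, fun x => ?_, ?_⟩
      · rw [← hα x]
        exact congrArg α (TreeSequence.bond_proj n x)
      · rw [← Function.comp_assoc, h, Function.comp_assoc, hq']
        rfl
  have key' := key (Nat.pair j i) (Nat.left_le_pair j i)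
  have ht : ((stage (Nat.pair j i)).task (Nat.pair j i).unpair.1 (Nat.pair j i).unpair.2) =
      (stage (Nat.pair j i)).task j i := by rw [Nat.unpair_pair]
  rw [← ht] at key'
  obtain ⟨u, α, hu, hα, h⟩ := key'
  refine ⟨Nat.pair j i + 1, e ∘ u, hu.comp he, fun x => ?_⟩
  have h1 : g (e (u (genericSequence.proj (Nat.pair j i + 1) x))) =
      α (genericSequence.bond _ (genericSequence.proj (Nat.pair j i + 1) x)) := by
    have h2 := congrFun h (genericSequence.proj (Nat.pair j i + 1) x)
    exact (congrFun hie (u (genericSequence.proj (Nat.pair j i + 1) x))).symm.trans h2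
  rw [TreeSequence.bond_proj, hα] at h1
  exact h1

end FinRootedTree

namespace TreeSequence

open FinRootedTree

/-! ### The extension property characterizes projective Fraïssé limits. -/

variable {s : TreeSequence SimpleStarConfluent}

/-- An arbitrary tree is joined to the first stage by amalgamating over `edgeTree`; lifting along a
map onto an arbitrary `A` becomes, after amalgamation, lifting along a map onto a stage. -/
theorem HasExtension.isProjectiveFraisseLimit (hs : s.HasExtension) :
    s.IsProjectiveFraisseLimit where
  projects A := by
    obtain ⟨f, hf⟩ := exists_simpleStarConfluent_edgeTree A
    obtain ⟨g, hg⟩ := exists_simpleStarConfluent_edgeTree (s.F 0)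
    obtain ⟨D, p, q, hp, hq, -⟩ := hf.amalgamate hg
    obtain ⟨k, h, hh, -⟩ := hs 0 D q hq
    exact ⟨_, k, p ∘ h, hh.comp hp, rfl⟩
  extends_epi A B f g hf hg := by
    obtain ⟨m, f', hf', rfl⟩ := hf
    obtain ⟨D, p, q, hp, hq, hpq⟩ := hf'.amalgamate hg
    obtain ⟨k, h, hh, hx⟩ := hs m D p hp
    refine ⟨_, ⟨k, q ∘ h, hh.comp hq, rfl⟩, funext fun x => ?_⟩
    have := congrFun hpq (h (s.proj k x))
    simp only [Function.comp_apply] at this ⊢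
    rw [← this, hx]
  small_fibres U hU hd := by
    obtain ⟨n, hn⟩ := exists_proj_subset hU hd
    exact ⟨s.F n, s.proj n, ⟨n, _root_.id, .id _, rfl⟩, hn⟩

theorem IsProjectiveFraisseLimit.hasExtension (hs : s.IsProjectiveFraisseLimit) :
    s.HasExtension := by
  intro j B g hg
  obtain ⟨h, ⟨k, h', hh', rfl⟩, hx⟩ := hs.extends_epi (s.F j) B (s.proj j) g
    ⟨j, _root_.id, .id _, rfl⟩ hg
  exact ⟨k, h', hh', fun x => (congrFun hx x).symm⟩

end TreeSequence

namespace FinRootedTree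

/-! ### Splitting one edge and adding one leaf -/

theorem exists_split {T : FinRootedTree} {v c : T.V} (hv : v ≠ T.root)
    (hc : c = v ∨ c = T.parent v) :
    ∃ (B : FinRootedTree) (g : B.V → T.V) (ι : T.V → B.V) (m : B.V),
      SimpleStarConfluent B T g ∧ (∀ u, g (ι u) = u) ∧ g m = c ∧ (∀ d, d = m ∨ d ∈ range ι) ∧
      ¬ B.Edge (ι (T.parent v)) (ι v) ∧ (∀ u, B.Edge (ι u) m → u = v ∨ u = T.parent v) ∧
      (∀ u, B.le m (ι u) → T.le v u) := by
  obtain ⟨B, g, ι, κ, m', hins, -, hrange, h1, h2, h3, -, h5, h6⟩ :=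
    exists_insertion T Unit (fun _ => v) (fun _ => True) (fun _ => c = v) (fun _ _ => hv)
      (fun _ _ _ _ _ => rfl)
  obtain ⟨m, hm⟩ : ∃ m, m = m' () := ⟨_, rfl⟩
  have hmr : m ∉ range ι := (hrange m).1 ⟨(), hm.symm⟩
  have hpv : B.parent (ι v) = m := hm ▸ h1 () trivial
  have hpm : B.parent m = ι (T.parent v) := hm ▸ h3 () trivial
  have hpb : ∀ b, b ≠ T.root → b ≠ v → B.parent (ι b) = ι (T.parent b) := fun b hb hbv =>
    h2 b hb fun _ _ h => hbv h.symm
  have hκ : κ m = v := by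
    rcases hins.old v hv with h | ⟨-, h, -⟩
    · exact absurd ⟨_, h.symm.trans hpv⟩ hmr
    · rw [← hpv, h]
  refine ⟨B, g, ι, m, hins.simpleStarConfluent, hins.f_ι, ?_, ?_, ?_, ?_, ?_⟩
  · by_cases h : c = v
    · rw [hm, h6 () (Or.inr h), h]
    · rw [hm, h5 () trivial h, hc.resolve_left h]
  · intro d
    by_cases hd : d ∈ range ι
    · exact Or.inr hd
    · obtain ⟨_, hd⟩ := (hrange d).2 hd
      exact Or.inl (hd.symm.trans hm.symm)
  · intro h
    rcases edge_cases h with h | ⟨h, h'⟩ | ⟨h, h'⟩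
    · exact parent_ne hv (hins.injective h)
    · have hr : T.parent v ≠ T.root := fun e => h (by rw [e, hins.ι_root])
      rw [hpb _ hr (parent_ne hv)] at h'
      have h4 := depth_parent_lt hv
      have h7 := depth_parent_lt hr
      rw [hins.injective h'] at h7
      omega
    · rw [hpv] at h'
      exact hmr ⟨_, h'.symm⟩
  · intro u h
    rcases edge_cases h with h | ⟨h, h'⟩ | ⟨h, h'⟩
    · exact absurd ⟨_, h⟩ hmr
    · by_contra! hu
      rw [hpb u (fun e => h (by rw [e, hins.ι_root])) hu.1] at h'
      exact hmr ⟨_, h'⟩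
    · exact Or.inr (hins.injective (h'.symm.trans hpm))
  · intro u h
    have := hins.κ_isRT.le h
    rwa [hκ, hins.κ_ι] at this

theorem exists_leaf (T : FinRootedTree) (u : T.V) :
    ∃ (B : FinRootedTree) (g : B.V → T.V) (y : B.V),
      SimpleStarConfluent B T g ∧ g y = u ∧ ∀ d, B.le y d → d = y := by
  obtain ⟨B, g, ι, κ, m', hins, -, hrange, -, h2, -, h4, -, h6⟩ :=
    exists_insertion T Unit (fun _ => u) (fun _ => False) (fun _ => False) (fun _ h => h.elim)
      (fun _ _ _ _ _ => rfl)
  refine ⟨B, g, m' (), hins.simpleStarConfluent, h6 () (Or.inl not_false), fun d hd => ?_⟩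
  by_contra hne
  have hr : m' () ∉ range ι := (hrange _).1 ⟨(), rfl⟩
  obtain ⟨x, hx, hxp, -⟩ := exists_child_le hd (Ne.symm hne)
  by_cases hxr : x ∈ range ι
  · obtain ⟨b, rfl⟩ := hxr
    rw [h2 b (fun e => hx (by rw [e, hins.ι_root])) (fun _ h => h.elim)] at hxp
    exact hr ⟨_, hxp⟩
  · obtain ⟨_, rfl⟩ := (hrange x).2 hxr
    exact parent_ne hx hxp

end FinRootedTree

namespace TreeSequence

open FinRootedTree

variable {s : TreeSequence SimpleStarConfluent}

/-! ### Edges and order in the limit -/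

/-- The order of the limit. -/
def Le (s : TreeSequence SimpleStarConfluent) (x y : s.Limit) : Prop :=
  ∀ n, (s.F n).le (s.proj n x) (s.proj n y)

/-- Composition of bonding maps. -/
def bondTo (s : TreeSequence SimpleStarConfluent) (k : ℕ) : ∀ d, (s.F (k + d)).V → (s.F k).V
  | 0 => id
  | d + 1 => bondTo s k d ∘ s.bond (k + d)

theorem bondTo_mem (k d : ℕ) : SimpleStarConfluent (s.F (k + d)) (s.F k) (s.bondTo k d) := by
  induction d with
  | zero => exact .id _
  | succ d ih => exact (s.bond_mem (k + d)).comp ih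

theorem bondTo_proj (k d : ℕ) (x : s.Limit) : s.bondTo k d (s.proj (k + d) x) = s.proj k x := by
  induction d with
  | zero => rfl
  | succ d ih =>
    rw [← ih, ← bond_proj (k + d)]
    rfl

theorem le_proj_of_le {m n : ℕ} (h : m ≤ n) {x y : s.Limit}
    (hxy : (s.F n).le (s.proj n x) (s.proj n y)) : (s.F m).le (s.proj m x) (s.proj m y) := by
  obtain ⟨d, rfl⟩ := Nat.exists_eq_add_of_le h
  rw [← bondTo_proj m d x, ← bondTo_proj m d y]
  exact (bondTo_mem m d).isEpi.map_le _ _ hxy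

theorem edge_proj_of_le {m n : ℕ} (h : m ≤ n) {x y : s.Limit}
    (hxy : (s.F n).Edge (s.proj n x) (s.proj n y)) : (s.F m).Edge (s.proj m x) (s.proj m y) := by
  obtain ⟨d, rfl⟩ := Nat.exists_eq_add_of_le h
  rw [← bondTo_proj m d x, ← bondTo_proj m d y]
  exact (bondTo_mem m d).isEpi.map_edge _ _ hxy

theorem Le.refl (x : s.Limit) : s.Le x x := fun _ => le_refl _

theorem Le.trans {x y z : s.Limit} (h : s.Le x y) (h' : s.Le y z) : s.Le x z := fun n =>
  le_trans (h n) (h' n)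

theorem Le.antisymm {x y : s.Limit} (h : s.Le x y) (h' : s.Le y x) : x = y :=
  ext_proj fun n => le_antisymm (h n) (h' n)

/-- Comparability passes down to lower levels, so once one direction fails at some level, the other
holds at all levels beyond it. -/
theorem le_total_of_forall {x y : s.Limit}
    (h : ∀ n, (s.F n).le (s.proj n x) (s.proj n y) ∨ (s.F n).le (s.proj n y) (s.proj n x)) :
    s.Le x y ∨ s.Le y x := by
  by_cases hxy : s.Le x y
  · exact Or.inl hxy
  · obtain ⟨n, hn⟩ := not_forall.1 hxy
    refine Or.inr fun m => ?_
    rcases h (max m n) with h1 | h1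
    · exact absurd (le_proj_of_le (le_max_right m n) h1) hn
    · exact le_proj_of_le (le_max_left m n) h1

theorem Le.total_of_le {x y z : s.Limit} (hx : s.Le x z) (hy : s.Le y z) : s.Le x y ∨ s.Le y x :=
  le_total_of_forall fun n => FinRootedTree.le_total_of_le (hx n) (hy n)

theorem Edge.proj {x y : s.Limit} (h : s.Edge x y) (n : ℕ) :
    (s.F n).Edge (s.proj n x) (s.proj n y) := h n

theorem Edge.symm {x y : s.Limit} (h : s.Edge x y) : s.Edge y x := fun n =>
  FinRootedTree.Edge.symm (h n)

theorem Edge.le_total {x y : s.Limit} (h : s.Edge x y) : s.Le x y ∨ s.Le y x :=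
  le_total_of_forall fun n => edge_le_total (h n)

theorem exists_proj_ne {x y : s.Limit} (h : x ≠ y) : ∃ n, ∀ m, n ≤ m → s.proj m x ≠ s.proj m y := by
  by_contra! h'
  refine h (ext_proj fun n => ?_)
  obtain ⟨m, hm, h1⟩ := h' n
  exact proj_eq_of_le hm h1

theorem exists_not_edge_proj {x y : s.Limit} (h : ¬ s.Edge x y) :
    ∃ n, ∀ m, n ≤ m → ¬ (s.F m).Edge (s.proj m x) (s.proj m y) := by
  by_contra! h'
  refine h fun n => ?_
  obtain ⟨m, hm, h1⟩ := h' n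
  exact edge_proj_of_le hm h1

theorem exists_not_le_proj {x y : s.Limit} (h : ¬ s.Le x y) :
    ∃ n, ∀ m, n ≤ m → ¬ (s.F m).le (s.proj m x) (s.proj m y) := by
  by_contra! h'
  refine h fun n => ?_
  obtain ⟨m, hm, h1⟩ := h' n
  exact le_proj_of_le hm h1

theorem Edge.map {A : FinRootedTree} {k : ℕ} {h : (s.F k).V → A.V}
    (hh : SimpleStarConfluent (s.F k) A h) {x y : s.Limit} (hxy : s.Edge x y) :
    A.Edge (h (s.proj k x)) (h (s.proj k y)) := hh.isEpi.map_edge _ _ (hxy k)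

theorem Le.map {A : FinRootedTree} {k : ℕ} {h : (s.F k).V → A.V}
    (hh : SimpleStarConfluent (s.F k) A h) {x y : s.Limit} (hxy : s.Le x y) :
    A.le (h (s.proj k x)) (h (s.proj k y)) := hh.isEpi.map_le _ _ (hxy k)

/-- Two distinct adjacent points of the limit can be separated by a vertex inserted into the edge
between their projections. -/
theorem HasExtension.split (hs : s.HasExtension) {x y : s.Limit} (hxy : s.Edge x y) {n : ℕ}
    (hn : s.proj n x ≠ s.proj n y) :
    ∃ (k : ℕ) (B : FinRootedTree) (h : (s.F k).V → B.V) (ι : (s.F n).V → B.V) (m : B.V),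
      SimpleStarConfluent (s.F k) B h ∧ h (s.proj k y) = m ∧
      (∀ z, s.proj n z ≠ s.proj n y → h (s.proj k z) = ι (s.proj n z)) ∧
      (∀ u, B.Edge (ι u) m → u = s.proj n x ∨ u = s.proj n y) ∧
      (∀ u, s.proj n y = (s.F n).parent (s.proj n x) → B.le m (ι u) →
        (s.F n).le (s.proj n x) u) := by
  obtain ⟨v, hv, hvxy⟩ : ∃ v, v ≠ (s.F n).root ∧
      ((v = s.proj n x ∧ (s.F n).parent v = s.proj n y) ∨
      (v = s.proj n y ∧ (s.F n).parent v = s.proj n x)) := by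
    rcases edge_cases (hxy.proj n) with h | ⟨h, h'⟩ | ⟨h, h'⟩
    · exact absurd h hn
    · exact ⟨_, h, Or.inl ⟨rfl, h'⟩⟩
    · exact ⟨_, h, Or.inr ⟨rfl, h'⟩⟩
  -- The new vertex is retracted to the projection of `y`, so only points with that projection can
  -- be sent to it.
  obtain ⟨B, g, ι, m, hg, hι, hm, hd, he1, he2, hle⟩ := exists_split (c := s.proj n y) hv
    (by rcases hvxy with ⟨-, h⟩ | ⟨h, -⟩ <;> simp [h])
  obtain ⟨k, h, hh, hgh⟩ := hs n B g hg
  have hne : ∀ z, s.proj n z ≠ s.proj n y → h (s.proj k z) = ι (s.proj n z) := by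
    intro z hz
    have h1 := hgh z
    rcases hd (h (s.proj k z)) with h2 | ⟨u, h2⟩
    · rw [h2, hm] at h1
      exact absurd h1.symm hz
    · rw [← h2, hι] at h1
      rw [← h2, h1]
  refine ⟨k, B, h, ι, m, hh, ?_, hne, ?_, ?_⟩
  · have h1 := hgh y
    rcases hd (h (s.proj k y)) with h2 | ⟨u, h2⟩
    · exact h2
    -- Otherwise `x` and `y` would be sent to the two ends of the split edge, which are no longer
    -- adjacent.
    · exfalso
      rw [← h2, hι] at h1
      have h3 := Edge.map hh hxy
      rw [← h2, h1, hne x hn] at h3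
      rcases hvxy with ⟨h4, h5⟩ | ⟨h4, h5⟩ <;> rw [h5, h4] at he1
      · exact he1 (FinRootedTree.Edge.symm h3)
      · exact he1 h3
  · intro u hu
    rcases he2 u hu with h | h <;> rcases hvxy with ⟨h4, h5⟩ | ⟨h4, h5⟩ <;> simp_all
  · intro u hp hu
    rcases hvxy with ⟨h4, h5⟩ | ⟨h4, h5⟩
    · exact h4 ▸ hle u hu
    · exfalso
      have h6 := depth_parent_lt hv
      rw [h5, h4] at h6
      have h7 : s.proj n x ≠ (s.F n).root := by
        intro e
        rw [e, parent_root] at hp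
        exact hn (e.trans hp.symm)
      have h8 := depth_parent_lt h7
      rw [← hp] at h8
      omega

/-- With three distinct points, split the edge between the projections of `x` and `y` so that `y`
goes to the new vertex. The neighbours of that vertex are the two old ends, and `z` goes to neither.
-/
theorem HasExtension.edge_eq_or_eq (hs : s.HasExtension) {x y z : s.Limit} (hxy : s.Edge x y)
    (hyz : s.Edge y z) : x = y ∨ y = z ∨ x = z := by
  by_contra! hne
  obtain ⟨n1, h1⟩ := exists_proj_ne hne.1
  obtain ⟨n2, h2⟩ := exists_proj_ne hne.2.1
  obtain ⟨n3, h3⟩ := exists_proj_ne hne.2.2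
  obtain ⟨n, hn1, hn2, hn3⟩ : ∃ n, n1 ≤ n ∧ n2 ≤ n ∧ n3 ≤ n :=
    ⟨n1 + n2 + n3, by omega, by omega, by omega⟩
  obtain ⟨k, B, h, ι, m, hh, hy, hz, he, -⟩ := hs.split hxy (h1 n hn1)
  have h4 := Edge.map hh hyz.symm
  rw [hy, hz z (h2 n hn2).symm] at h4
  rcases he _ h4 with h5 | h5
  · exact h3 n hn3 h5.symm
  · exact h2 n hn2 h5.symm

theorem HasExtension.edge_trans (hs : s.HasExtension) (x y z : s.Limit) (hxy : s.Edge x y)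
    (hyz : s.Edge y z) : s.Edge x z := by
  rcases hs.edge_eq_or_eq hxy hyz with rfl | rfl | rfl
  · exact hyz
  · exact hxy
  · exact fun _ => Or.inl rfl

/-- Only the case that `x` lies just above `x'` is in doubt. Splitting moves `x'` into the interior
of the edge below `x`, and old vertices above the new vertex are above the upper end of that edge:
nothing branches off between two adjacent points. -/
theorem HasExtension.le_of_edge_of_le (hs : s.HasExtension) {x x' w : s.Limit} (he : s.Edge x x')
    (hle : s.Le x' w) (hne : ¬ s.Edge x' w) : s.Le x w := by
  by_contra hxw
  have hxx : x ≠ x' := by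
    rintro rfl
    exact hxw hle
  obtain ⟨n1, h1⟩ := exists_proj_ne hxx
  obtain ⟨n2, h2⟩ := exists_not_edge_proj hne
  obtain ⟨n3, h3⟩ := exists_not_le_proj hxw
  obtain ⟨n, hn1, hn2, hn3⟩ : ∃ n, n1 ≤ n ∧ n2 ≤ n ∧ n3 ≤ n :=
    ⟨n1 + n2 + n3, by omega, by omega, by omega⟩
  obtain ⟨k, B, h, ι, m, hh, hy, hz, -, hle'⟩ := hs.split he (h1 n hn1)
  have hp : s.proj n x' = (s.F n).parent (s.proj n x) := by
    rcases edge_cases (he.proj n) with h | ⟨-, h⟩ | ⟨-, h⟩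
    · exact absurd h (h1 n hn1)
    · exact h.symm
    · exact absurd (FinRootedTree.le_trans (h ▸ parent_le _) (hle n)) (h3 n hn3)
  refine h3 n hn3 (hle' _ hp ?_)
  have h4 := Le.map hh hle
  rwa [hy, hz w fun e => h2 n hn2 (Or.inl e.symm)] at h4

theorem le_of_le_of_edge {x x' w : s.Limit} (he : s.Edge x x')
    (hle : s.Le w x') (hne : ¬ s.Edge w x') : s.Le w x := by
  obtain ⟨n, hn⟩ := exists_not_edge_proj hne
  have key : ∀ m, n ≤ m → (s.F m).le (s.proj m w) (s.proj m x) := by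
    intro m hm
    have h1 : s.proj m w ≠ s.proj m x' := fun e => hn m hm (Or.inl e)
    rcases edge_cases (he.proj m) with h | ⟨-, h⟩ | ⟨-, h⟩
    · rw [h]; exact hle m
    · exact FinRootedTree.le_trans (hle m) (h ▸ parent_le _)
    · rw [← h]; exact le_parent_of_le_of_ne (hle m) h1
  exact fun m => le_proj_of_le (le_max_left m n) (key _ (le_max_right m n))

/-! ### Lifting -/

/-- Vertices below the image of `w` lift to points below `w`. -/
theorem exists_le_lift {A : FinRootedTree} {k : ℕ} {h : (s.F k).V → A.V}
    (hh : SimpleStarConfluent (s.F k) A h) {w : s.Limit} {a : A.V}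
    (ha : A.le a (h (s.proj k w))) : ∃ z, s.Le z w ∧ h (s.proj k z) = a := by
  obtain ⟨z, hz⟩ := nonempty_iInter_of_antitone
    (fun d => {z : s.Limit | s.proj (k + d) z ∈ {v | (s.F (k + d)).le v (s.proj (k + d) w)}} ∩
      {z : s.Limit | s.proj k z ∈ {v | h v = a}})
    (fun d => (isClosed_proj _ _).inter (isClosed_proj _ _))
    (fun d => by
      rw [← bondTo_proj k d] at ha
      obtain ⟨c, hc, hc', -⟩ := ((bondTo_mem k d).comp hh).isEpi.isRT.exists_le ha
      obtain ⟨z, rfl⟩ := proj_surjective (k + d) c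
      refine ⟨z, hc, ?_⟩
      simpa [bondTo_proj] using hc')
    (fun d z hz => ⟨le_proj_of_le (Nat.le_succ (k + d)) hz.1, hz.2⟩)
  rw [mem_iInter] at hz
  exact ⟨z, fun n => le_proj_of_le (Nat.le_add_left n k) (hz n).1, (hz 0).2⟩

/-- The lowest lift of a vertex `c` along the chain below `w`; all vertices above `c` lift to points
above it. -/
theorem exists_lowest_lift {A : FinRootedTree} {k : ℕ} {h : (s.F k).V → A.V}
    (hh : SimpleStarConfluent (s.F k) A h) {w : s.Limit} {c : A.V}
    (hc : A.le c (h (s.proj k w))) : ∃ c' : s.Limit, s.Le c' w ∧ h (s.proj k c') = c ∧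
      ∀ z, A.le c z → ∃ z' : s.Limit, s.Le c' z' ∧ h (s.proj k z') = z := by
  have hf : ∀ d, SimpleStarConfluent (s.F (k + d)) A (h ∘ s.bondTo k d) := fun d =>
    (bondTo_mem k d).comp hh
  have hex : ∀ d, ∃ u, (s.F (k + d)).le u (s.proj (k + d) w) ∧ (h ∘ s.bondTo k d) u = c ∧
      (u = (s.F (k + d)).root ∨ ¬ A.le c ((h ∘ s.bondTo k d) ((s.F (k + d)).parent u))) :=
    fun d => (hf d).isEpi.isRT.exists_le (by simpa [bondTo_proj] using hc)
  choose u hu1 hu2 hu3 using hex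
  -- So `u d` is the smallest vertex on the chain below `w` whose image is above `c`.
  have hmin : ∀ d v, (s.F (k + d)).le v (s.proj (k + d) w) → A.le c ((h ∘ s.bondTo k d) v) →
      (s.F (k + d)).le (u d) v := by
    intro d v hv hcv
    by_contra hlt
    have h1 := (le_total_of_le hv (hu1 d)).resolve_right hlt
    have hne : v ≠ u d := by
      rintro rfl
      exact hlt (le_refl _)
    rcases hu3 d with h2 | h2
    · exact hlt (h2 ▸ root_le v)
    · exact h2 (le_trans hcv ((hf d).isEpi.map_le _ _ (le_parent_of_le_of_ne h1 hne)))
  -- Minimality makes the vertices `u d` compatible, so that they define a point.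
  have hbond : ∀ d, s.bond (k + d) (u (d + 1)) = u d := by
    intro d
    have hle : (s.F (k + d)).le (s.bond (k + d) (u (d + 1))) (s.proj (k + d) w) := by
      rw [← bond_proj]
      exact (s.bond_mem (k + d)).isEpi.map_le _ _ (hu1 (d + 1))
    refine le_antisymm ?_ (hmin d _ hle ?_)
    · have h1 := hu1 d
      rw [← bond_proj] at h1
      obtain ⟨v, hv, hv', -⟩ := (s.bond_mem (k + d)).isEpi.isRT.exists_le h1
      rw [← hv']
      refine (s.bond_mem (k + d)).isEpi.map_le _ _ (hmin (d + 1) v hv ?_)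
      have : (h ∘ s.bondTo k (d + 1)) v = (h ∘ s.bondTo k d) (u d) := by rw [← hv']; rfl
      rw [this, hu2]
      exact le_refl _
    · have : (h ∘ s.bondTo k d) (s.bond (k + d) (u (d + 1))) = (h ∘ s.bondTo k (d + 1)) (u (d + 1)) :=
        rfl
      rw [this, hu2]
      exact le_refl _
  obtain ⟨c', hc'⟩ := nonempty_iInter_of_antitone
    (fun d => {z : s.Limit | s.proj (k + d) z ∈ ({u d} : Set _)})
    (fun d => isClosed_proj _ _)
    (fun d => (proj_surjective (k + d) (u d)).imp fun _ h => h)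
    (fun d z (hz : _ = _) => by
      change _ = _
      rw [← hbond, ← hz]
      exact (bond_proj (k + d) z).symm)
  rw [mem_iInter] at hc'
  have hc'' : ∀ d, s.proj (k + d) c' = u d := hc'
  refine ⟨c', fun n => le_proj_of_le (Nat.le_add_left n k) (by rw [hc'']; exact hu1 n), ?_, ?_⟩
  · rw [← hu2 0, ← hc'']
    rfl
  intro z hz
  obtain ⟨z', hz'⟩ := nonempty_iInter_of_antitone
    (fun d => {z' : s.Limit | s.proj (k + d) z' ∈ {v | (s.F (k + d)).le (s.proj (k + d) c') v}} ∩
      {z' : s.Limit | s.proj k z' ∈ {v | h v = z}})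
    (fun d => (isClosed_proj _ _).inter (isClosed_proj _ _))
    (fun d => by
      -- Confluence over the interval from `c` to `z`. The set `C` contains `u d` but not its
      -- parent, whose image is not above `c`; hence all of `C` lies above `u d`.
      obtain ⟨C, hC, huC, hCQ⟩ := (hf d).isConfluent.exists_pc (pc_Icc c z) (a := u d)
        (by rw [hu2]; exact ⟨le_refl _, hz⟩)
      have : z ∈ (h ∘ s.bondTo k d) '' C := by rw [hCQ]; exact ⟨hz, le_refl _⟩
      obtain ⟨v, hv, hvz⟩ := this
      obtain ⟨z', rfl⟩ := proj_surjective (k + d) v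
      refine ⟨z', ?_, by simpa [bondTo_proj] using hvz⟩
      refine hC.le_of_parent_not_mem ((hc'' d).symm ▸ huC) ?_ hv
      rw [hc'']
      refine (hu3 d).imp_right fun h1 h2 => h1 ?_
      have : (h ∘ s.bondTo k d) ((s.F (k + d)).parent (u d)) ∈ {q | A.le c q ∧ A.le q z} :=
        hCQ ▸ mem_image_of_mem _ h2
      exact this.1)
    (fun d z hz => ⟨le_proj_of_le (Nat.le_succ (k + d)) hz.1, hz.2⟩)
  rw [mem_iInter] at hz'
  exact ⟨z', fun n => le_proj_of_le (Nat.le_add_left n k) (hz' n).1, (hz' 0).2⟩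

end TreeSequence

/-! ## Ordered continua -/

section

attribute [local instance] TopologicalSpace.vietoris

theorem tendsto_nonemptyCompacts {Y ι : Type*} [TopologicalSpace Y] {l : Filter ι}
    {Ks : ι → NonemptyCompacts Y} {K : NonemptyCompacts Y}
    (h1 : ∀ U : Set Y, IsOpen U → (K : Set Y) ⊆ U → ∀ᶠ i in l, (Ks i : Set Y) ⊆ U)
    (h2 : ∀ U : Set Y, IsOpen U → ((K : Set Y) ∩ U).Nonempty →
      ∀ᶠ i in l, ((Ks i : Set Y) ∩ U).Nonempty) :
    Tendsto Ks l (𝓝 K) := by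
  rw [NonemptyCompacts.isEmbedding_coe.isInducing.tendsto_nhds_iff]
  refine TopologicalSpace.tendsto_nhds_generateFrom_iff.2 ?_
  rintro V (⟨U, hU, rfl⟩ | ⟨U, hU, rfl⟩) hK
  · exact h1 U hU hK
  · exact h2 U hU hK

end

variable {Y : Type*} [TopologicalSpace Y]

/-- A compact set with an injective continuous function to the reals has a continuous
parametrization. -/
theorem exists_continuousOn_inverse [T2Space Y] [Nonempty Y] {S : Set Y} (hS : IsCompact S) {ψ : Y → ℝ}
    (hψ : ContinuousOn ψ S) (hinj : InjOn ψ S) :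
    ∃ g : ℝ → Y, ContinuousOn g (ψ '' S) ∧ ∀ x ∈ S, g (ψ x) = x := by
  have hg : ∀ x ∈ S, Function.invFunOn ψ S (ψ x) = x := fun x hx =>
    hinj.leftInvOn_invFunOn hx
  refine ⟨Function.invFunOn ψ S, ?_, hg⟩
  rw [continuousOn_iff_isClosed]
  intro C hC
  refine ⟨ψ '' (S ∩ C), ((hS.inter_right hC).image_of_continuousOn
    (hψ.mono inter_subset_left)).isClosed, ?_⟩
  ext r
  constructor
  · rintro ⟨hr, x, hx, rfl⟩
    exact ⟨⟨x, ⟨hx, by simpa [hg x hx] using hr⟩, rfl⟩, x, hx, rfl⟩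
  · rintro ⟨⟨x, ⟨hx, hxC⟩, rfl⟩, -⟩
    exact ⟨by simpa [hg x hx] using hxC, x, hx, rfl⟩

/-- A continuum with an injective continuous function to the reals is an arc. -/
theorem isArc_of_injOn [T2Space Y] {S : Set Y} (hS : IsCompact S) (hc : IsPreconnected S)
    {ψ : Y → ℝ} (hψ : ContinuousOn ψ S) (hinj : InjOn ψ S) {a b : Y} (ha : a ∈ S) (hb : b ∈ S)
    (hab : a ≠ b) (hmin : ∀ x ∈ S, ψ a ≤ ψ x) (hmax : ∀ x ∈ S, ψ x ≤ ψ b) : IsArc S a b := by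
  have : Nonempty Y := ⟨a⟩
  obtain ⟨g, hg, hgψ⟩ := exists_continuousOn_inverse hS hψ hinj
  have himage : ψ '' S = Icc (ψ a) (ψ b) := by
    refine Subset.antisymm (image_subset_iff.2 fun x hx => ⟨hmin x hx, hmax x hx⟩) ?_
    exact (hc.image ψ hψ).ordConnected.out (mem_image_of_mem ψ ha) (mem_image_of_mem ψ hb)
  have hlt : ψ a < ψ b := (hmin b hb).lt_of_ne fun h => hab (hinj ha hb h)
  let r : unitInterval → ℝ := fun t => ψ a + t * (ψ b - ψ a)
  have hr : ∀ t, r t ∈ Icc (ψ a) (ψ b) := fun t => by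
    have h1 := t.2.1
    have h2 := t.2.2
    constructor <;> simp only [r] <;> nlinarith
  have hrange : ∀ x ∈ S, ∃ t, r t = ψ x := fun x hx => by
    have h1 := hmin x hx
    have h2 := hmax x hx
    refine ⟨⟨(ψ x - ψ a) / (ψ b - ψ a), div_nonneg (by linarith) (by linarith),
      div_le_one_of_le₀ (by linarith) (by linarith)⟩, ?_⟩
    have : ψ b - ψ a ≠ 0 := by linarith
    simp only [r]
    field_simp
    ring
  have hmem : ∀ t, ∃ x ∈ S, ψ x = r t := fun t => by
    have := hr t
    rwa [← himage] at this
  refine ⟨g ∘ r, ?_, ?_, ?_, ?_, ?_⟩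
  · have hrc : Continuous r := by fun_prop
    exact hg.comp_continuous hrc fun t => himage ▸ hr t
  · intro t t' h
    obtain ⟨x, hx, hxt⟩ := hmem t
    obtain ⟨x', hx', hxt'⟩ := hmem t'
    simp only [Function.comp_apply, ← hxt, ← hxt', hgψ x hx, hgψ x' hx'] at h
    rw [h, hxt'] at hxt
    have h3 : ψ b - ψ a ≠ 0 := by linarith
    have h4 : (t' : ℝ) * (ψ b - ψ a) = t * (ψ b - ψ a) := by simpa [r] using hxt
    exact Subtype.ext (mul_right_cancel₀ h3 h4).symm
  · simp [r, hgψ a ha]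
  · simp [r, hgψ b hb]
  · ext y
    constructor
    · rintro ⟨t, rfl⟩
      obtain ⟨x, hx, hxt⟩ := hmem t
      simpa [← hxt, hgψ x hx] using hx
    · intro hy
      obtain ⟨t, ht⟩ := hrange y hy
      exact ⟨t, by simp [ht, hgψ y hy]⟩

namespace IsArc

variable {A : Set Y} {a b : Y}

theorem left_mem (h : IsArc A a b) : a ∈ A := by
  obtain ⟨f, -, -, rfl, -, rfl⟩ := h
  exact mem_range_self _

theorem right_mem (h : IsArc A a b) : b ∈ A := by
  obtain ⟨f, -, -, -, rfl, rfl⟩ := h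
  exact mem_range_self _

theorem ne (h : IsArc A a b) : a ≠ b := by
  obtain ⟨f, -, hf, rfl, rfl, -⟩ := h
  exact fun e => zero_ne_one (hf e)

theorem isConnected (h : IsArc A a b) : IsConnected A := by
  obtain ⟨f, hf, -, -, -, rfl⟩ := h
  exact isConnected_range hf

theorem isClosed [T2Space Y] (h : IsArc A a b) : IsClosed A := by
  obtain ⟨f, hf, -, -, -, rfl⟩ := h
  exact (isCompact_range hf).isClosed

/-- An arc is irreducible between its endpoints. -/
theorem eq_of_isPreconnected [T2Space Y] (h : IsArc A a b) {C : Set Y} (hC : IsPreconnected C)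
    (hCA : C ⊆ A) (ha : a ∈ C) (hb : b ∈ C) : C = A := by
  obtain ⟨f, hf, hinj, rfl, rfl, rfl⟩ := h
  refine Subset.antisymm hCA ?_
  have h1 : IsPreconnected (f ⁻¹' C) := by
    rw [← (hf.isClosedEmbedding hinj).isInducing.isPreconnected_image, image_preimage_eq_of_subset hCA]
    exact hC
  rintro _ ⟨t, rfl⟩
  exact h1.ordConnected.out (x := 0) (y := 1) ha hb ⟨t.2.1, t.2.2⟩

/-- The intersection of `A` and `C` is connected and contains both ends of the arc, which is
irreducible between them. -/
theorem subset_of_unicoherent [T2Space Y] (hY : IsHereditarilyUnicoherent Y) (h : IsArc A a b)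
    {C : Set Y} (hC : IsConnected C) (hC' : IsClosed C) (ha : a ∈ C) (hb : b ∈ C) : A ⊆ C :=
  inter_eq_left.1 (h.eq_of_isPreconnected (hY A C h.isClosed h.isConnected hC' hC)
    inter_subset_left ⟨h.left_mem, ha⟩ ⟨h.right_mem, hb⟩)

theorem unique [T2Space Y] (hY : IsHereditarilyUnicoherent Y) (h : IsArc A a b)
    {C : Set Y} (hC : IsArc C a b) : A = C :=
  (h.subset_of_unicoherent hY hC.isConnected hC.isClosed hC.left_mem hC.right_mem).antisymm
    (hC.subset_of_unicoherent hY h.isConnected h.isClosed h.left_mem h.right_mem)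

end IsArc

/-! ### Dendroids from a closed order. -/

/-- A closed partial order with least element `o` on a hereditarily unicoherent space whose lower
sets `Iic p` are connected chains that depend continuously on `p`. -/
structure IsOrderedDendroid (Y : Type*) [TopologicalSpace Y] [PartialOrder Y] (o : Y) : Prop where
  least : ∀ p : Y, o ≤ p
  closed : IsClosed {q : Y × Y | q.1 ≤ q.2}
  chain : ∀ p q r : Y, p ≤ r → q ≤ r → p ≤ q ∨ q ≤ p
  preconnected : ∀ p : Y, IsPreconnected (Iic p)
  lower : ∀ U : Set Y, IsOpen U → IsOpen {p | (Iic p ∩ U).Nonempty}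
  unicoherent : IsHereditarilyUnicoherent Y

namespace IsOrderedDendroid

variable [PartialOrder Y] {o : Y}

theorem isClosed_Iic (h : IsOrderedDendroid Y o) (p : Y) : IsClosed (Iic p) :=
  h.closed.preimage (f := fun x => (x, p)) (by fun_prop)

theorem isClosed_Ici (h : IsOrderedDendroid Y o) (p : Y) : IsClosed (Ici p) :=
  h.closed.preimage (f := fun x => (p, x)) (by fun_prop)

/-- Projection along a compact factor is closed. This is the upper semicontinuity of `Iic`,
complementing the field `lower`. -/
theorem isClosed_upper [CompactSpace Y] (h : IsOrderedDendroid Y o) {C : Set Y} (hC : IsClosed C) :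
    IsClosed {p | (Iic p ∩ C).Nonempty} := by
  have : {p | (Iic p ∩ C).Nonempty} = Prod.snd '' ({q : Y × Y | q.1 ≤ q.2} ∩ Prod.fst ⁻¹' C) := by
    ext p
    constructor
    · rintro ⟨z, hz, hzC⟩
      exact ⟨(z, p), ⟨hz, hzC⟩, rfl⟩
    · rintro ⟨⟨z, p⟩, ⟨hz, hzC⟩, rfl⟩
      exact ⟨z, hz, hzC⟩
  rw [this]
  exact isClosedMap_snd_of_compactSpace _ (h.closed.inter (hC.preimage continuous_fst))

theorem injOn_Iic (h : IsOrderedDendroid Y o) {φ : Y → ℝ} (hφ : StrictMono φ) (b : Y) :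
    InjOn φ (Iic b) := by
  intro x hx y hy hxy
  by_contra hne
  rcases h.chain x y b hx hy with h1 | h1
  · exact (hφ (h1.lt_of_ne hne)).ne hxy
  · exact (hφ (h1.lt_of_ne (Ne.symm hne))).ne hxy.symm

variable [CompactSpace Y] [T2Space Y] [SecondCountableTopology Y]

/-- The distance from a fixed point `y` to `Iic p` is continuous in `p` by the two semicontinuities,
and it decreases when `p` grows. Minus a weighted sum of these distances over a dense sequence is
strictly monotone: for `p < q`, a dense point near `q` is nearer to `Iic q` than to `Iic p`. The
function parametrizes all chains at once. -/
theorem exists_strictMono (h : IsOrderedDendroid Y o) : ∃ φ : Y → ℝ, Continuous φ ∧ StrictMono φ := by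
  let _ := metrizableSpaceMetric Y
  have : Nonempty Y := ⟨o⟩
  let d := denseSeq Y
  have hne : ∀ p : Y, (Iic p).Nonempty := fun p => nonempty_Iic (a := p)
  have hcont : ∀ y : Y, Continuous fun p : Y => Metric.infDist y (Iic p) := by
    intro y
    rw [continuous_iff_lower_upperSemicontinuous, lowerSemicontinuous_iff_isClosed_preimage,
      upperSemicontinuous_iff_isOpen_preimage]
    constructor
    · intro r
      convert h.isClosed_upper (Metric.isClosed_closedBall (x := y) (ε := r)) using 1
      ext p
      constructor
      · intro hp
        obtain ⟨z, hz, hzd⟩ := (h.isClosed_Iic p).isCompact.exists_infDist_eq_dist (hne p) y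
        exact ⟨z, hz, by rw [Metric.mem_closedBall, dist_comm, ← hzd]; exact hp⟩
      · rintro ⟨z, hz, hzd⟩
        refine (Metric.infDist_le_dist_of_mem hz).trans ?_
        rwa [Metric.mem_closedBall, dist_comm] at hzd
    · intro r
      convert h.lower (Metric.ball y r) Metric.isOpen_ball using 1
      ext p
      constructor
      · intro hp
        obtain ⟨z, hz, hzd⟩ := (Metric.infDist_lt_iff (hne p)).1 hp
        exact ⟨z, hz, by rwa [Metric.mem_ball, dist_comm]⟩
      · rintro ⟨z, hz, hzd⟩
        exact (Metric.infDist_lt_iff (hne p)).2 ⟨z, hz, by rwa [Metric.mem_ball, dist_comm] at hzd⟩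
  have hanti : ∀ y p q : Y, p ≤ q → Metric.infDist y (Iic q) ≤ Metric.infDist y (Iic p) :=
    fun y p q hpq => Metric.infDist_le_infDist_of_subset (Iic_subset_Iic.2 hpq) (hne p)
  have hbound : ∀ (n : ℕ) (p : Y), ‖(1 / 2 : ℝ) ^ n * Metric.infDist (d n) (Iic p)‖ ≤
      (1 / 2) ^ n * Metric.diam (univ : Set Y) := by
    intro n p
    rw [Real.norm_of_nonneg (mul_nonneg (by positivity) Metric.infDist_nonneg)]
    refine mul_le_mul_of_nonneg_left ?_ (by positivity)
    exact (Metric.infDist_le_dist_of_mem (mem_Iic.2 le_rfl)).trans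
      (Metric.dist_le_diam_of_mem isCompact_univ.isBounded (mem_univ _) (mem_univ _))
  have hsum : Summable fun n : ℕ => (1 / 2 : ℝ) ^ n * Metric.diam (univ : Set Y) :=
    (summable_geometric_of_lt_one (by norm_num) (by norm_num)).mul_right _
  refine ⟨fun p => -∑' n, (1 / 2 : ℝ) ^ n * Metric.infDist (d n) (Iic p),
    (continuous_tsum (fun n => continuous_const.mul (hcont _)) hsum hbound).neg, ?_⟩
  intro p q hpq
  have hq : q ∉ Iic p := fun hq => hpq.not_ge hq
  have hpos := ((h.isClosed_Iic p).notMem_iff_infDist_pos (hne p)).1 hq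
  -- With half the distance, `d n` is still more than that half away from `Iic p`.
  obtain ⟨n, hn⟩ : ∃ n, dist q (d n) < Metric.infDist q (Iic p) / 2 := by
    obtain ⟨_, hn, n, rfl⟩ := Metric.dense_iff.1 (denseRange_denseSeq Y) q _ (half_pos hpos)
    exact ⟨n, by simpa [dist_comm] using hn⟩
  refine neg_lt_neg (Summable.tsum_lt_tsum (i := n) (fun m => ?_) ?_
    (Summable.of_norm_bounded hsum fun n => hbound n q)
    (Summable.of_norm_bounded hsum fun n => hbound n p))
  · exact mul_le_mul_of_nonneg_left (hanti _ _ _ hpq.le) (by positivity)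
  · refine mul_lt_mul_of_pos_left ?_ (by positivity)
    have h1 : Metric.infDist (d n) (Iic q) ≤ dist (d n) q := Metric.infDist_le_dist_of_mem le_rfl
    have h2 := Metric.infDist_le_infDist_add_dist (s := Iic p) (x := q) (y := d n)
    rw [dist_comm] at h1
    linarith

/-- On the compact chain `Iic b` the function `φ` has a continuous inverse, defined on an order
connected set of reals, and `Icc a b` is the image of a real interval under it. -/
theorem isPreconnected_Icc (h : IsOrderedDendroid Y o) (a b : Y) : IsPreconnected (Icc a b) := by
  by_cases hab : a ≤ b
  swap
  · rw [Icc_eq_empty hab]; exact isPreconnected_empty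
  obtain ⟨φ, hφc, hφ⟩ := h.exists_strictMono
  have : Nonempty Y := ⟨o⟩
  have hinj := h.injOn_Iic hφ b
  obtain ⟨g, hg, hgφ⟩ := exists_continuousOn_inverse (h.isClosed_Iic b).isCompact
    hφc.continuousOn hinj
  have hsub : Icc (φ a) (φ b) ⊆ φ '' Iic b :=
    ((h.preconnected b).image φ hφc.continuousOn).ordConnected.out (mem_image_of_mem φ hab)
      (mem_image_of_mem φ (mem_Iic.2 le_rfl))
  have himage : Icc a b = g '' Icc (φ a) (φ b) := by
    ext x
    constructor
    · intro hx
      exact ⟨φ x, ⟨hφ.monotone hx.1, hφ.monotone hx.2⟩, hgφ x hx.2⟩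
    · rintro ⟨r, hr, rfl⟩
      obtain ⟨x, hx, rfl⟩ := hsub hr
      rw [hgφ x hx]
      refine ⟨?_, hx⟩
      rcases h.chain a x b hab hx with h1 | h1
      · exact h1
      · exact (hinj hx hab (le_antisymm (hφ.monotone h1) hr.1)).ge
  rw [himage]
  exact _root_.isPreconnected_Icc.image g (hg.mono hsub)

/-- Any two points have a meet, and the union of the intervals above the meet is an arc. -/
theorem exists_isArc (h : IsOrderedDendroid Y o) {a b : Y} (hab : a ≠ b) :
    ∃ m, m ≤ a ∧ m ≤ b ∧ (∀ z, z ≤ a → z ≤ b → z ≤ m) ∧ IsArc (Icc m a ∪ Icc m b) a b := by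
  classical
  obtain ⟨φ, hφc, hφ⟩ := h.exists_strictMono
  -- The meet is the common lower bound where `φ` is largest; it is the greatest one because lower
  -- sets are chains.
  obtain ⟨m, ⟨hma, hmb⟩, hm⟩ := ((h.isClosed_Iic a).inter (h.isClosed_Iic b)).isCompact.exists_isMaxOn
    ⟨o, h.least a, h.least b⟩ hφc.continuousOn
  have hm' : ∀ z, z ≤ a → z ≤ b → z ≤ m := by
    intro z hza hzb
    rcases h.chain z m a hza hma with h1 | h1
    · exact h1
    · have h2 : φ z ≤ φ m := hm ⟨hza, hzb⟩
      by_contra hne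
      exact absurd (hφ (lt_of_le_not_ge h1 hne)) h2.not_gt
  refine ⟨m, hma, hmb, hm', ?_⟩
  -- Signed height over the meet: nonpositive on the branch to `a`, nonnegative on the branch to
  -- `b`, zero at `m`.
  let ψ : Y → ℝ := fun z => if z ≤ b then φ z - φ m else φ m - φ z
  have hψb : ∀ z ∈ Icc m b, ψ z = φ z - φ m := fun z hz => if_pos hz.2
  have hψa : ∀ z ∈ Icc m a, ψ z = φ m - φ z := fun z hz => by
    by_cases hzb : z ≤ b
    · have : z = m := le_antisymm (hm' z hz.2 hzb) hz.1
      simp [ψ, this]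
    · exact if_neg hzb
  have hca : IsClosed (Icc m a) := (h.isClosed_Ici m).inter (h.isClosed_Iic a)
  have hcb : IsClosed (Icc m b) := (h.isClosed_Ici m).inter (h.isClosed_Iic b)
  have hmono : ∀ z, m ≤ z → 0 ≤ φ z - φ m := fun z hz => sub_nonneg.2 (hφ.monotone hz)
  have hzero : ∀ z, m ≤ z → φ z = φ m → z = m := fun z hz he => by
    by_contra hne
    exact (hφ (hz.lt_of_ne (Ne.symm hne))).ne' he
  have hinj : ∀ c, ∀ x ∈ Icc m c, ∀ y ∈ Icc m c, φ x = φ y → x = y := fun c x hx y hy he =>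
    h.injOn_Iic hφ c hx.2 hy.2 he
  refine isArc_of_injOn (ψ := ψ) (hca.union hcb).isCompact
    (IsPreconnected.union m ⟨le_rfl, hma⟩ ⟨le_rfl, hmb⟩ (h.isPreconnected_Icc m a)
      (h.isPreconnected_Icc m b)) ?_ ?_ (Or.inl ⟨hma, le_rfl⟩) (Or.inr ⟨hmb, le_rfl⟩) hab ?_ ?_
  · refine ContinuousOn.union_of_isClosed ?_ ?_ hca hcb
    · exact (Continuous.continuousOn (by fun_prop)).congr hψa
    · exact (Continuous.continuousOn (by fun_prop)).congr hψb
  · have hmix : ∀ x ∈ Icc m a, ∀ y ∈ Icc m b, ψ x = ψ y → x = y := by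
      intro x hx y hy hxy
      rw [hψa x hx, hψb y hy] at hxy
      have h1 := hmono x hx.1
      have h2 := hmono y hy.1
      rw [hzero x hx.1 (by linarith), hzero y hy.1 (by linarith)]
    rintro x (hx | hx) y (hy | hy) hxy
    · rw [hψa x hx, hψa y hy] at hxy
      exact hinj a x hx y hy (by linarith)
    · exact hmix x hx y hy hxy
    · exact (hmix y hy x hx hxy.symm).symm
    · rw [hψb x hx, hψb y hy] at hxy
      exact hinj b x hx y hy (by linarith)
  · have ha := hψa a ⟨hma, le_rfl⟩
    rintro x (hx | hx)
    · have := hφ.monotone hx.2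
      rw [ha, hψa x hx]
      linarith
    · have := hmono x hx.1
      have := hmono a hma
      rw [ha, hψb x hx]
      linarith
  · have hb := hψb b ⟨hmb, le_rfl⟩
    rintro x (hx | hx)
    · have := hmono x hx.1
      have := hmono b hmb
      rw [hb, hψa x hx]
      linarith
    · have := hφ.monotone hx.2
      rw [hb, hψb x hx]
      linarith

/-- Unicoherence makes arcs unique, and the meet of `o` with `p` is `o`. -/
theorem eq_of_isArcOrPoint (h : IsOrderedDendroid Y o) {A : Set Y} {p : Y}
    (hA : IsArcOrPoint A o p) : A = Iic p := by
  rcases hA with hA | ⟨rfl, rfl⟩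
  · obtain ⟨m, hm, -, -, harc⟩ := h.exists_isArc hA.ne
    have hmo : m = o := le_antisymm hm (h.least m)
    subst hmo
    rw [hA.unique h.unicoherent harc, Icc_self]
    ext x
    simp [h.least]
  · ext x
    exact ⟨fun hx => hx.le, fun hx => le_antisymm hx (h.least x)⟩

theorem isContinuum (h : IsOrderedDendroid Y o) : IsContinuum Y where
  compact := inferInstance
  connected := by
    have : IsPreconnected (univ : Set Y) := by
      have h1 : (univ : Set Y) = ⋃₀ range Iic := by
        ext x
        simp only [mem_univ, true_iff]
        exact ⟨_, ⟨x, rfl⟩, mem_Iic.2 le_rfl⟩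
      rw [h1]
      refine isPreconnected_sUnion o _ ?_ ?_
      · rintro _ ⟨x, rfl⟩
        exact h.least x
      · rintro _ ⟨x, rfl⟩
        exact h.preconnected x
    exact connectedSpace_iff_univ.2 ⟨⟨o, mem_univ o⟩, this⟩
  metrizable := inferInstance

theorem isDendroid (h : IsOrderedDendroid Y o) : IsDendroid Y where
  continuum := h.isContinuum
  unicoherent := h.unicoherent
  arcwise _ _ hab := by
    obtain ⟨m, -, -, -, hm⟩ := h.exists_isArc hab
    exact ⟨_, hm⟩

/-- Arcs from `o` are the sets `Iic p`, so Vietoris convergence amounts to the two semicontinuities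
of `Iic`. -/
theorem isSmoothDendroid (h : IsOrderedDendroid Y o) : IsSmoothDendroid Y := by
  refine ⟨h.isDendroid, o, fun x xs hx A As hA hAs => ?_⟩
  have hA' := h.eq_of_isArcOrPoint hA
  have hAs' := fun n => h.eq_of_isArcOrPoint (hAs n)
  refine tendsto_nonemptyCompacts (fun U hU hAU => ?_) fun U hU hAU => ?_
  · have h1 : {p | (Iic p ∩ Uᶜ).Nonempty}ᶜ ∈ 𝓝 x := by
      refine (h.isClosed_upper hU.isClosed_compl).isOpen_compl.mem_nhds ?_
      rintro ⟨z, hz, hzU⟩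
      exact hzU (hAU (hA' ▸ hz))
    filter_upwards [hx h1] with n hn
    intro z hz
    by_contra hzU
    exact hn ⟨z, hAs' n ▸ hz, hzU⟩
  · have h1 : {p | (Iic p ∩ U).Nonempty} ∈ 𝓝 x := by
      refine (h.lower U hU).mem_nhds ?_
      rwa [hA'] at hAU
    filter_upwards [hx h1] with n hn
    rwa [hAs' n]

/-- Every arc has the form `Icc m a ∪ Icc m b`, where only `a` and `b` can be maximal. -/
theorem isEndpoint_of_isMax (h : IsOrderedDendroid Y o) {p : Y} (hp : ∀ q, p ≤ q → q = p) :
    IsEndpoint p := by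
  intro A a b hA hpA
  obtain ⟨m, -, -, -, hm⟩ := h.exists_isArc hA.ne
  rw [hA.unique h.unicoherent hm] at hpA
  rcases hpA with h1 | h1
  · exact Or.inl (hp _ h1.2).symm
  · exact Or.inr (hp _ h1.2).symm

theorem exists_isMax_ge (h : IsOrderedDendroid Y o) (p : Y) :
    ∃ q, p ≤ q ∧ ∀ r, q ≤ r → r = q := by
  obtain ⟨φ, hφc, hφ⟩ := h.exists_strictMono
  obtain ⟨q, hq, hmax⟩ := (h.isClosed_Ici p).isCompact.exists_isMaxOn ⟨p, le_rfl⟩ hφc.continuousOn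
  refine ⟨q, hq, fun r hr => ?_⟩
  by_contra hne
  have h1 : φ r ≤ φ q := hmax (le_trans hq hr)
  exact absurd (hφ (hr.lt_of_ne (Ne.symm hne))) h1.not_gt

theorem isArc_Icc (h : IsOrderedDendroid Y o) {a b : Y} (hab : a < b) : IsArc (Icc a b) a b := by
  obtain ⟨m, hma, -, hm, harc⟩ := h.exists_isArc hab.ne
  have hmo : m = a := le_antisymm hma (hm a le_rfl hab.le)
  subst hmo
  rwa [Icc_self, union_eq_right.2 (singleton_subset_iff.2 (left_mem_Icc.2 hab.le))] at harc

theorem isRamificationPoint (h : IsOrderedDendroid Y o) {p : Y} (z : Fin 3 → Y)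
    (hz : ∀ i, p < z i) (hmeet : ∀ i j, i ≠ j → ∀ q, q ≤ z i → q ≤ z j → q ≤ p) :
    IsRamificationPoint p := by
  have key : ∀ i j, i ≠ j → Icc p (z i) ∩ Icc p (z j) = {p} := by
    intro i j hij
    ext q
    refine ⟨fun hq => le_antisymm (hmeet i j hij q hq.1.2 hq.2.2) hq.1.1, ?_⟩
    rintro rfl
    exact ⟨⟨le_rfl, (hz i).le⟩, le_rfl, (hz j).le⟩
  exact ⟨_, _, _, ⟨_, _, h.isArc_Icc (hz 0)⟩, ⟨_, _, h.isArc_Icc (hz 1)⟩,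
    ⟨_, _, h.isArc_Icc (hz 2)⟩, key 0 1 (by decide), key 0 2 (by decide), key 1 2 (by decide)⟩

end IsOrderedDendroid

namespace TreeSequence

open FinRootedTree

variable {s : TreeSequence SimpleStarConfluent}

/-! ## The topological realization -/

theorem mem_of_forall_proj_mem {C : Set s.Limit} (hC : IsClosed C) {x : s.Limit}
    (h : ∀ n, s.proj n x ∈ s.proj n '' C) : x ∈ C := by
  obtain ⟨c, hc⟩ := nonempty_iInter_of_antitone
    (fun n => C ∩ {c : s.Limit | s.proj n c ∈ ({s.proj n x} : Set _)})
    (fun n => hC.inter (isClosed_proj _ _))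
    (fun n => by
      obtain ⟨c, hc, hcx⟩ := h n
      exact ⟨c, hc, hcx⟩)
    (fun n c hc => ⟨hc.1, proj_eq_of_le (Nat.le_succ n) hc.2⟩)
  rw [mem_iInter] at hc
  rw [← ext_proj fun n => (hc n).2]
  exact (hc 0).1

theorem exists_tube {C U : Set s.Limit} (hC : IsClosed C) (hU : IsOpen U) (hCU : C ⊆ U) :
    ∃ n, ∀ m, n ≤ m → ∀ x, s.proj m x ∈ s.proj m '' C → x ∈ U := by
  have hmono : ∀ {n m : ℕ}, n ≤ m → ∀ x, s.proj m x ∈ s.proj m '' C →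
      s.proj n x ∈ s.proj n '' C := by
    rintro n m hnm x ⟨c, hc, hcx⟩
    exact ⟨c, hc, proj_eq_of_le hnm hcx⟩
  suffices ∃ n, ∀ x, s.proj n x ∈ s.proj n '' C → x ∈ U by
    obtain ⟨n, hn⟩ := this
    exact ⟨n, fun m hm x hx => hn x (hmono hm x hx)⟩
  by_contra! h
  obtain ⟨x, hx⟩ := nonempty_iInter_of_antitone
    (fun n => {x : s.Limit | s.proj n x ∈ s.proj n '' C} ∩ Uᶜ)
    (fun n => (isClosed_proj _ _).inter hU.isClosed_compl) h
    (fun n x hx => ⟨hmono (Nat.le_succ n) x hx.1, hx.2⟩)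
  rw [mem_iInter] at hx
  exact (hx 0).2 (hCU (mem_of_forall_proj_mem hC fun n => (hx n).1))

theorem exists_cylinder {x : s.Limit} {U : Set s.Limit} (hU : IsOpen U) (hx : x ∈ U) :
    ∃ n, ∀ m, n ≤ m → ∀ y, s.proj m y = s.proj m x → y ∈ U := by
  obtain ⟨n, hn⟩ := exists_tube (isClosed_singleton (x := x)) hU (singleton_subset_iff.2 hx)
  exact ⟨n, fun m hm y hy => hn m hm y ⟨x, rfl, hy.symm⟩⟩

theorem isClosed_edge : IsClosed {q : s.Limit × s.Limit | s.Edge q.1 q.2} := by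
  have : {q : s.Limit × s.Limit | s.Edge q.1 q.2} =
      ⋂ n, (fun q : s.Limit × s.Limit => (s.proj n q.1, s.proj n q.2)) ⁻¹'
        {v | (s.F n).Edge v.1 v.2} := by
    ext q
    rw [mem_iInter]
    rfl
  rw [this]
  exact isClosed_iInter fun n => (isClosed_discrete _).preimage
    (((continuous_proj n).comp continuous_fst).prodMk ((continuous_proj n).comp continuous_snd))

theorem isClosed_le : IsClosed {q : s.Limit × s.Limit | s.Le q.1 q.2} := by
  have : {q : s.Limit × s.Limit | s.Le q.1 q.2} =
      ⋂ n, (fun q : s.Limit × s.Limit => (s.proj n q.1, s.proj n q.2)) ⁻¹'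
        {v | (s.F n).le v.1 v.2} := by
    ext q
    rw [mem_iInter]
    rfl
  rw [this]
  exact isClosed_iInter fun n => (isClosed_discrete _).preimage
    (((continuous_proj n).comp continuous_fst).prodMk ((continuous_proj n).comp continuous_snd))

/-- The point of the limit given by the roots. -/
def rootPoint (s : TreeSequence SimpleStarConfluent) : s.Limit :=
  ⟨fun n => (s.F n).root, fun n => (s.bond_mem n).isEpi.map_root⟩

namespace HasExtension

/-- The realization of a sequence with the extension property. -/
def Space (hs : s.HasExtension) : Type := s.Realization hs.edge_trans

variable (hs : s.HasExtension)

instance : TopologicalSpace hs.Space := inferInstanceAs (TopologicalSpace (Quotient _))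

/-- The quotient map onto the realization. -/
def mk (x : s.Limit) : hs.Space := Quotient.mk (s.edgeSetoid hs.edge_trans) x

theorem isQuotientMap_mk : IsQuotientMap hs.mk := isQuotientMap_quotient_mk'

theorem mk_surjective : Function.Surjective hs.mk := hs.isQuotientMap_mk.surjective

theorem continuous_mk : Continuous hs.mk := hs.isQuotientMap_mk.continuous

instance : CompactSpace hs.Space := hs.mk_surjective.compactSpace hs.continuous_mk

theorem mk_eq_iff {x y : s.Limit} : hs.mk x = hs.mk y ↔ s.Edge x y :=
  Quotient.eq (r := s.edgeSetoid hs.edge_trans)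

/-- The edge relation is closed and the limit compact, so the quotient map is closed. -/
theorem isClosed_saturation {C : Set s.Limit} (hC : IsClosed C) :
    IsClosed (hs.mk '' C) := by
  rw [← hs.isQuotientMap_mk.isClosed_preimage]
  have : hs.mk ⁻¹' (hs.mk '' C) =
      Prod.snd '' ({q : s.Limit × s.Limit | s.Edge q.1 q.2} ∩ Prod.fst ⁻¹' C) := by
    ext x
    constructor
    · rintro ⟨y, hy, hyx⟩
      exact ⟨(y, x), ⟨hs.mk_eq_iff.1 hyx, hy⟩, rfl⟩
    · rintro ⟨⟨y, x⟩, ⟨hyx, hy⟩, rfl⟩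
      exact ⟨y, hy, hs.mk_eq_iff.2 hyx⟩
  rw [this]
  exact isClosedMap_snd_of_compactSpace _ (isClosed_edge.inter (hC.preimage continuous_fst))

theorem isClosed_fibre (q : hs.Space) : IsClosed (hs.mk ⁻¹' {q}) := by
  obtain ⟨x, rfl⟩ := hs.mk_surjective q
  rw [← image_singleton]
  exact (hs.isClosed_saturation isClosed_singleton).preimage hs.continuous_mk

/-- Requiring the condition of all representatives saturates the cylinder; these sets form a
countable basis of the realization. -/
theorem isOpen_basic (n : ℕ) (K : Set (s.F n).V) :
    IsOpen {q : hs.Space | ∀ x, hs.mk x = q → s.proj n x ∈ K} := by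
  rw [← isClosed_compl_iff]
  convert hs.isClosed_saturation (isClosed_proj n Kᶜ) using 1
  ext q
  simp only [mem_compl_iff, mem_ofPred_eq, mem_image, not_forall]
  exact ⟨fun ⟨x, h, h'⟩ => ⟨x, h', h⟩, fun ⟨x, h', h⟩ => ⟨x, h, h'⟩⟩

theorem exists_basic {q : hs.Space} {U : Set hs.Space} (hU : IsOpen U) (hq : q ∈ U) :
    ∃ n, ∀ m, n ≤ m → ∀ x, s.proj m x ∈ s.proj m '' (hs.mk ⁻¹' {q}) → hs.mk x ∈ U :=
  exists_tube (hs.isClosed_fibre q) (hU.preimage hs.continuous_mk) (by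
    rintro x rfl
    exact hq)

instance : T2Space hs.Space := by
  refine ⟨fun q r hqr => ?_⟩
  obtain ⟨n, hn⟩ := exists_tube (hs.isClosed_fibre q) (hs.isClosed_fibre r).isOpen_compl (by
    rintro x rfl
    exact hqr)
  refine ⟨_, _, hs.isOpen_basic n (s.proj n '' (hs.mk ⁻¹' {q})),
    hs.isOpen_basic n (s.proj n '' (hs.mk ⁻¹' {q}))ᶜ, fun x hx => mem_image_of_mem _ hx,
    fun x hx hx' => hn n le_rfl x hx' hx, ?_⟩
  rw [disjoint_left]
  intro p h1 h2
  obtain ⟨x, rfl⟩ := hs.mk_surjective p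
  exact h2 x rfl (h1 x rfl)

instance : SecondCountableTopology hs.Space := by
  have : IsTopologicalBasis (range fun i : Σ n, Set (s.F n).V =>
      {q : hs.Space | ∀ x, hs.mk x = q → s.proj i.1 x ∈ i.2}) := by
    refine isTopologicalBasis_of_isOpen_of_nhds ?_ fun q U hq hU => ?_
    · rintro _ ⟨i, rfl⟩
      exact hs.isOpen_basic _ _
    · obtain ⟨n, hn⟩ := hs.exists_basic hU hq
      refine ⟨_, ⟨⟨n, s.proj n '' (hs.mk ⁻¹' {q})⟩, rfl⟩, fun x hx => mem_image_of_mem _ hx, ?_⟩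
      intro p hp
      obtain ⟨x, rfl⟩ := hs.mk_surjective p
      exact hn n le_rfl x (hp x rfl)
  exact this.secondCountableTopology (countable_range _)

/-- A change of representatives can destroy `Le` only by producing an edge, so this disjunction is
what descends to the quotient. -/
theorem edge_or_le_congr (hs : s.HasExtension) {x x' y y' : s.Limit} (hx : s.Edge x x') (hy : s.Edge y y')
    (h : s.Le x' y') : s.Edge x y ∨ s.Le x y := by
  by_cases h1 : s.Edge x' y'
  · exact Or.inl (hs.edge_trans _ _ _ hx (hs.edge_trans _ _ _ h1 hy.symm))
  · have h2 := hs.le_of_edge_of_le hx h h1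
    by_cases h3 : s.Edge x y'
    · exact Or.inl (hs.edge_trans _ _ _ h3 hy.symm)
    · exact Or.inr (le_of_le_of_edge hy h2 h3)

theorem edge_or_le_trans (hs : s.HasExtension) {x y z : s.Limit} (h : s.Edge x y ∨ s.Le x y) (h' : s.Edge y z ∨ s.Le y z) :
    s.Edge x z ∨ s.Le x z := by
  rcases h with h | h <;> rcases h' with h' | h'
  · exact Or.inl (hs.edge_trans _ _ _ h h')
  · exact hs.edge_or_le_congr h (fun _ => Or.inl rfl) h'
  · exact hs.edge_or_le_congr (fun _ => Or.inl rfl) h'.symm h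
  · exact Or.inr (h.trans h')

instance : LE hs.Space := ⟨fun q r => ∃ x y, hs.mk x = q ∧ hs.mk y = r ∧ s.Le x y⟩

theorem mk_le_mk {x y : s.Limit} : hs.mk x ≤ hs.mk y ↔ s.Edge x y ∨ s.Le x y := by
  constructor
  · rintro ⟨x', y', hx, hy, h⟩
    exact hs.edge_or_le_congr (hs.mk_eq_iff.1 hx).symm (hs.mk_eq_iff.1 hy).symm h
  · rintro (h | h)
    · exact ⟨x, x, rfl, hs.mk_eq_iff.2 h, Le.refl x⟩
    · exact ⟨x, y, rfl, rfl, h⟩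

instance : PartialOrder hs.Space where
  le_refl q := by
    obtain ⟨x, rfl⟩ := hs.mk_surjective q
    exact hs.mk_le_mk.2 (Or.inr (Le.refl x))
  le_trans p q r hpq hqr := by
    obtain ⟨x, rfl⟩ := hs.mk_surjective p
    obtain ⟨y, rfl⟩ := hs.mk_surjective q
    obtain ⟨z, rfl⟩ := hs.mk_surjective r
    rw [hs.mk_le_mk] at *
    exact hs.edge_or_le_trans hpq hqr
  le_antisymm p q hpq hqp := by
    obtain ⟨x, rfl⟩ := hs.mk_surjective p
    obtain ⟨y, rfl⟩ := hs.mk_surjective q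
    rw [hs.mk_le_mk] at *
    rw [hs.mk_eq_iff]
    rcases hpq with h | h
    · exact h
    · rcases hqp with h' | h'
      · exact h'.symm
      · rw [h.antisymm h']
        exact fun _ => Or.inl rfl

/-! ### Connectedness -/

/-- Threads of connected sets have connected image in the realization. -/
theorem isPreconnected_image_threads {K : ∀ n, Set (s.F n).V} (hK : ∀ n, (s.F n).PC (K n))
    (hb : ∀ n, ∀ v ∈ K (n + 1), s.bond n v ∈ K n) :
    IsPreconnected (hs.mk '' {x | ∀ n, s.proj n x ∈ K n}) := by
  set Z : Set s.Limit := {x | ∀ n, s.proj n x ∈ K n} with hZ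
  have hZ' : Z = ⋂ n, {x | s.proj n x ∈ K n} := by ext x; rw [mem_iInter]; rfl
  have hdown : ∀ {m n : ℕ}, m ≤ n → ∀ x : s.Limit, s.proj n x ∈ K n → s.proj m x ∈ K m := by
    intro m n hmn x hx
    induction n, hmn using Nat.le_induction with
    | base => exact hx
    | succ n _ ih => exact ih (by rw [← bond_proj]; exact hb n _ hx)
  have hZc : IsClosed Z := by
    rw [hZ']
    exact isClosed_iInter fun n => isClosed_proj _ _
  rw [isPreconnected_closed_iff]
  rintro t t' ht ht' hsub ⟨_, ⟨a0, ha0, rfl⟩, ha0t⟩ ⟨_, ⟨b0, hb0, rfl⟩, hb0t⟩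
  set A := Z ∩ hs.mk ⁻¹' t with hA
  set B := Z ∩ hs.mk ⁻¹' t' with hB
  have hAc : IsClosed A := hZc.inter (ht.preimage hs.continuous_mk)
  have hBc : IsClosed B := hZc.inter (ht'.preimage hs.continuous_mk)
  -- By compactness, some level `n ≥ m` has all points over `K n` projecting at level `m` into the
  -- traces of `A` and `B`; an edge of `K n` leading out of the part over the trace of `A` then
  -- joins the two traces.
  have key : ∀ m, ∃ a ∈ A, ∃ b ∈ B, (s.F m).Edge (s.proj m a) (s.proj m b) := by
    intro m
    by_contra! hno
    obtain ⟨n, hmn, hn⟩ : ∃ n, m ≤ n ∧ ∀ x : s.Limit, s.proj n x ∈ K n →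
        s.proj m x ∈ s.proj m '' A ∪ s.proj m '' B := by
      by_contra! h
      obtain ⟨x, hx⟩ := nonempty_iInter_of_antitone
        (fun n => {x : s.Limit | s.proj n x ∈ K n} ∩
          {x | s.proj m x ∈ (s.proj m '' A ∪ s.proj m '' B)ᶜ})
        (fun n => (isClosed_proj _ _).inter (isClosed_proj _ _))
        (fun n => by
          obtain ⟨x, hx, hx'⟩ := h (max m n) (le_max_left _ _)
          exact ⟨x, hdown (le_max_right _ _) x hx, hx'⟩)
        (fun n x hx => ⟨hdown (Nat.le_succ n) x hx.1, hx.2⟩)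
      rw [mem_iInter] at hx
      have hxZ : x ∈ Z := fun n => (hx n).1
      refine (hx 0).2 ?_
      rcases hsub (mem_image_of_mem _ hxZ) with h1 | h1
      · exact Or.inl ⟨x, ⟨hxZ, h1⟩, rfl⟩
      · exact Or.inr ⟨x, ⟨hxZ, h1⟩, rfl⟩
    obtain ⟨u, ⟨huK, x, rfl, hxA⟩, v, ⟨hvK, hv⟩, huv⟩ :=
      hK n {v | ∃ x, s.proj n x = v ∧ s.proj m x ∈ s.proj m '' A}
        ⟨s.proj n a0, ha0 n, a0, rfl, a0, ⟨ha0, ha0t⟩, rfl⟩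
        ⟨s.proj n b0, hb0 n, by
          rintro ⟨x, hx, a, ha, hax⟩
          refine hno a ha b0 ⟨hb0, hb0t⟩ (Or.inl ?_)
          rw [hax, proj_eq_of_le hmn hx]⟩
    obtain ⟨y, rfl⟩ := proj_surjective n v
    have hyA : s.proj m y ∉ s.proj m '' A := fun h => hv ⟨y, rfl, h⟩
    obtain ⟨a, ha, hax⟩ := hxA
    obtain ⟨b, hb, hby⟩ := (hn y hvK).resolve_left hyA
    refine hno a ha b hb ?_
    rw [hax, hby]
    exact edge_proj_of_le hmn (Or.inr huv)
  -- The edges found at all levels accumulate at an edge of the limit, whose ends are one point of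
  -- the realization, common to both closed sets.
  obtain ⟨⟨a, b⟩, hab⟩ := nonempty_iInter_of_antitone
    (fun m => (A ×ˢ B) ∩ {q : s.Limit × s.Limit | (s.F m).Edge (s.proj m q.1) (s.proj m q.2)})
    (fun m => (hAc.prod hBc).inter ((isClosed_discrete
      {v : (s.F m).V × (s.F m).V | (s.F m).Edge v.1 v.2}).preimage
      (((continuous_proj m).comp continuous_fst).prodMk ((continuous_proj m).comp continuous_snd))))
    (fun m => by
      obtain ⟨a, ha, b, hb, h⟩ := key m
      exact ⟨(a, b), ⟨ha, hb⟩, h⟩)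
    (fun m q hq => ⟨hq.1, edge_proj_of_le (Nat.le_succ m) hq.2⟩)
  rw [mem_iInter] at hab
  have he : hs.mk a = hs.mk b := hs.mk_eq_iff.2 fun n => (hab n).2
  exact ⟨hs.mk a, mem_image_of_mem _ (hab 0).1.1.1, (hab 0).1.1.2, he ▸ (hab 0).1.2.2⟩

/-- A partition of the vertices gives two closed sets covering the connected `P`. They share a point
of `P`, and two representatives of it on different sides project to an edge. -/
theorem pc_proj_preimage {P : Set hs.Space} (hP : IsPreconnected P) (n : ℕ) :
    (s.F n).PC (s.proj n '' (hs.mk ⁻¹' P)) := by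
  rintro U ⟨_, ⟨a, ha, rfl⟩, haU⟩ ⟨_, ⟨b, hb, rfl⟩, hbU⟩
  obtain ⟨q, hqP, ⟨x, hx, hxq⟩, y, hy, hyq⟩ := isPreconnected_closed_iff.1 hP
    (hs.mk '' {x | s.proj n x ∈ U}) (hs.mk '' {x | s.proj n x ∈ Uᶜ})
    (hs.isClosed_saturation (isClosed_proj _ _)) (hs.isClosed_saturation (isClosed_proj _ _))
    (fun q _ => by
      obtain ⟨x, rfl⟩ := hs.mk_surjective q
      by_cases hx : s.proj n x ∈ U
      · exact Or.inl ⟨x, hx, rfl⟩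
      · exact Or.inr ⟨x, hx, rfl⟩)
    ⟨_, ha, a, haU, rfl⟩ ⟨_, hb, b, hbU, rfl⟩
  have he : s.Edge x y := hs.mk_eq_iff.1 (hxq.trans hyq.symm)
  have hxP : x ∈ hs.mk ⁻¹' P := by rw [mem_preimage, hxq]; exact hqP
  have hyP : y ∈ hs.mk ⁻¹' P := by rw [mem_preimage, hyq]; exact hqP
  refine ⟨s.proj n x, ⟨⟨x, hxP, rfl⟩, hx⟩, s.proj n y, ⟨⟨y, hyP, rfl⟩, hy⟩, ?_⟩
  rcases he.proj n with h | h
  · exact absurd (h ▸ hx) hy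
  · exact h

theorem isPreconnected_image_Icc (x w : s.Limit) :
    IsPreconnected (hs.mk '' {z | s.Le x z ∧ s.Le z w}) := by
  have := hs.isPreconnected_image_threads (K := fun n => {v | (s.F n).le (s.proj n x) v ∧
    (s.F n).le v (s.proj n w)}) (fun n => pc_Icc _ _) (fun n v hv => by
      rw [← bond_proj n x, ← bond_proj n w]
      exact ⟨(s.bond_mem n).isEpi.map_le _ _ hv.1, (s.bond_mem n).isEpi.map_le _ _ hv.2⟩)
  convert this using 2
  ext z
  exact ⟨fun h n => ⟨h.1 n, h.2 n⟩, fun h => ⟨fun n => (h n).1, fun n => (h n).2⟩⟩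

theorem rootPoint_le (x : s.Limit) : s.Le s.rootPoint x := fun _ => root_le _

theorem Iic_mk (x : s.Limit) : Iic (hs.mk x) = hs.mk '' {z | s.Le s.rootPoint z ∧ s.Le z x} := by
  ext q
  obtain ⟨z, rfl⟩ := hs.mk_surjective q
  rw [mem_Iic, hs.mk_le_mk]
  constructor
  · rintro (h | h)
    · exact ⟨x, ⟨rootPoint_le x, Le.refl x⟩, hs.mk_eq_iff.2 h.symm⟩
    · exact ⟨z, ⟨rootPoint_le z, h⟩, rfl⟩
  · rintro ⟨z', ⟨-, h⟩, hz⟩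
    exact hs.edge_or_le_congr (hs.mk_eq_iff.1 hz).symm (fun _ => Or.inl rfl) h

theorem isOrderedDendroid : IsOrderedDendroid hs.Space (hs.mk s.rootPoint) where
  least p := by
    obtain ⟨x, rfl⟩ := hs.mk_surjective p
    exact hs.mk_le_mk.2 (Or.inr (rootPoint_le x))
  closed := by
    have : {q : hs.Space × hs.Space | q.1 ≤ q.2} =
        Prod.map hs.mk hs.mk '' {q : s.Limit × s.Limit | s.Le q.1 q.2} := by
      ext ⟨p, q⟩
      constructor
      · rintro ⟨x, y, hx, hy, h⟩
        exact ⟨(x, y), h, Prod.ext hx hy⟩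
      · rintro ⟨⟨x, y⟩, h, hxy⟩
        exact ⟨x, y, congrArg Prod.fst hxy, congrArg Prod.snd hxy, h⟩
    rw [this]
    exact (isClosed_le.isCompact.image (hs.continuous_mk.prodMap hs.continuous_mk)).isClosed
  chain p q r hp hq := by
    obtain ⟨z, rfl⟩ := hs.mk_surjective r
    rw [← mem_Iic, hs.Iic_mk] at hp hq
    obtain ⟨x, ⟨-, hx⟩, rfl⟩ := hp
    obtain ⟨y, ⟨-, hy⟩, rfl⟩ := hq
    exact (hx.total_of_le hy).imp (fun h => hs.mk_le_mk.2 (Or.inr h))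
      (fun h => hs.mk_le_mk.2 (Or.inr h))
  preconnected p := by
    obtain ⟨x, rfl⟩ := hs.mk_surjective p
    rw [hs.Iic_mk]
    exact hs.isPreconnected_image_Icc _ _
  lower U hU := by
    rw [← hs.isQuotientMap_mk.isOpen_preimage, isOpen_iff_forall_mem_open]
    rintro x ⟨q, hq, hqU⟩
    rw [hs.Iic_mk] at hq
    obtain ⟨z, ⟨-, hz⟩, rfl⟩ := hq
    obtain ⟨n, hn⟩ := exists_cylinder (hU.preimage hs.continuous_mk) hqU
    refine ⟨{x' | s.proj n x' ∈ ({s.proj n x} : Set _)}, fun x' hx' => ?_, isOpen_proj _ _, rfl⟩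
    -- Points with the same `n`-th coordinate as `x` have below them lifts of the `n`-th coordinate
    -- of `z`, which is all that membership in `U` needs.
    have hle : (s.F n).le (s.proj n z) (id (s.proj n x')) := by
      rw [id, show s.proj n x' = s.proj n x from hx']
      exact hz n
    obtain ⟨z', hz', hz''⟩ := exists_le_lift (.id (s.F n)) hle
    exact ⟨hs.mk z', hs.mk_le_mk.2 (Or.inr hz'), hn n le_rfl z' hz''⟩
  unicoherent P Q hP hP' hQ hQ' := by
    -- At each level the traces of `P` and `Q` are connected, hence so is their intersection;
    -- closedness identifies the threads through these intersections with the points of `P ∩ Q`.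
    have h1 := hs.isPreconnected_image_threads
      (K := fun n => s.proj n '' (hs.mk ⁻¹' P) ∩ s.proj n '' (hs.mk ⁻¹' Q))
      (fun n => (hs.pc_proj_preimage hP'.isPreconnected n).inter
        (hs.pc_proj_preimage hQ'.isPreconnected n))
      (by
        rintro n v ⟨⟨x, hx, rfl⟩, y, hy, hxy⟩
        refine ⟨⟨x, hx, (bond_proj n x).symm⟩, y, hy, ?_⟩
        rw [← hxy, bond_proj])
    convert h1 using 1
    ext q
    obtain ⟨x, rfl⟩ := hs.mk_surjective q
    constructor
    · intro hx
      exact ⟨x, fun n => ⟨⟨x, hx.1, rfl⟩, x, hx.2, rfl⟩, rfl⟩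
    · rintro ⟨y, hy, hyx⟩
      rw [← hyx]
      exact ⟨mem_of_forall_proj_mem (hP.preimage hs.continuous_mk) fun n => (hy n).1,
        mem_of_forall_proj_mem (hQ.preimage hs.continuous_mk) fun n => (hy n).2⟩

end HasExtension

end TreeSequence

namespace FinRootedTree

/-! ### Images and unions of connected vertex sets. -/

variable {S T : FinRootedTree}

theorem pc_singleton (a : T.V) : T.PC {a} := by
  rintro U ⟨_, rfl, h1⟩ ⟨_, rfl, h2⟩
  exact absurd h1 h2

theorem PC.image {K : Set S.V} (hK : S.PC K) {f : S.V → T.V} (hf : IsEpi S T f) :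
    T.PC (f '' K) := by
  rintro U ⟨_, ⟨a, ha, rfl⟩, haU⟩ ⟨_, ⟨b, hb, rfl⟩, hbU⟩
  obtain ⟨u, ⟨huK, hu⟩, v, ⟨hvK, hv⟩, huv⟩ := hK (f ⁻¹' U) ⟨a, ha, haU⟩ ⟨b, hb, hbU⟩
  refine ⟨f u, ⟨mem_image_of_mem f huK, hu⟩, f v, ⟨mem_image_of_mem f hvK, hv⟩, ?_⟩
  rcases hf.map_edge u v (Or.inr huv) with h | h
  · exact absurd (mem_preimage.1 hu) (h ▸ hv)
  · exact h

theorem pc_of_forall_exists {K : Set T.V} {a : T.V}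
    (h : ∀ v ∈ K, ∃ C ⊆ K, T.PC C ∧ a ∈ C ∧ v ∈ C) : T.PC K := by
  have key : ∀ U : Set T.V, a ∈ U → (K \ U).Nonempty → ∃ u ∈ K ∩ U, ∃ v ∈ K \ U,
      T.graph.Adj u v := by
    rintro U haU ⟨v, hvK, hvU⟩
    obtain ⟨C, hCK, hC, haC, hvC⟩ := h v hvK
    obtain ⟨u, hu, w, hw, huw⟩ := hC U ⟨a, haC, haU⟩ ⟨v, hvC, hvU⟩
    exact ⟨u, ⟨hCK hu.1, hu.2⟩, w, ⟨hCK hw.1, hw.2⟩, huw⟩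
  intro U h1 h2
  by_cases ha : a ∈ U
  · exact key U ha h2
  · obtain ⟨u, ⟨hu, huU⟩, v, ⟨hv, hvU⟩, huv⟩ := key Uᶜ ha (by simpa [Set.sdiff_compl] using h1)
    exact ⟨v, ⟨hv, by simpa using hvU⟩, u, ⟨hu, huU⟩, huv.symm⟩

end FinRootedTree

namespace TreeSequence

open FinRootedTree

variable {s : TreeSequence SimpleStarConfluent}

namespace HasExtension

/-! ### The Kelley property -/

/-- Confluence: a connected set of vertices lifts to a continuum through any given point. -/
theorem exists_continuum_over (hs : s.HasExtension) {n : ℕ} {Q : Set (s.F n).V} (hQ : (s.F n).PC Q)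
    {y : s.Limit} (hy : s.proj n y ∈ Q) :
    ∃ Z : Set s.Limit, IsClosed Z ∧ IsPreconnected (hs.mk '' Z) ∧ y ∈ Z ∧ s.proj n '' Z = Q := by
  -- From level `n` on, the component of the projection of `y` in the preimage of `Q`; below level
  -- `n` no condition is imposed.
  let K : ∀ m, Set (s.F m).V := fun m => {v | n ≤ m → ∃ C, (s.F m).PC C ∧ s.proj m y ∈ C ∧ v ∈ C ∧
    ∀ ζ : s.Limit, s.proj m ζ ∈ C → s.proj n ζ ∈ Q}
  have hyK : ∀ m, s.proj m y ∈ K m := fun m hm => ⟨{s.proj m y}, pc_singleton _, rfl, rfl,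
    fun ζ hζ => by rw [proj_eq_of_le hm hζ]; exact hy⟩
  have hK : ∀ m, (s.F m).PC (K m) := by
    intro m
    by_cases hm : n ≤ m
    · refine pc_of_forall_exists (a := s.proj m y) fun v hv => ?_
      obtain ⟨C, hC, hyC, hvC, hCQ⟩ := hv hm
      exact ⟨C, fun u hu _ => ⟨C, hC, hyC, hu, hCQ⟩, hC, hyC, hvC⟩
    · rw [show K m = univ from eq_univ_of_forall fun v h => absurd h hm]
      exact pc_univ
  have hb : ∀ m, ∀ v ∈ K (m + 1), s.bond m v ∈ K m := by
    intro m v hv hm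
    obtain ⟨C, hC, hyC, hvC, hCQ⟩ := hv (by omega)
    refine ⟨s.bond m '' C, hC.image (s.bond_mem m).isEpi, ⟨_, hyC, bond_proj m y⟩,
      mem_image_of_mem _ hvC, ?_⟩
    rintro ζ ⟨c, hc, hcζ⟩
    obtain ⟨x, rfl⟩ := proj_surjective (m + 1) c
    rw [bond_proj] at hcζ
    rw [← proj_eq_of_le hm hcζ]
    exact hCQ x hc
  have hdown : ∀ {m m' : ℕ}, m ≤ m' → ∀ x : s.Limit, s.proj m' x ∈ K m' → s.proj m x ∈ K m := by
    intro m m' hmm x hx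
    induction m', hmm using Nat.le_induction with
    | base => exact hx
    | succ i _ ih => exact ih (by rw [← bond_proj]; exact hb i _ hx)
  refine ⟨{x | ∀ m, s.proj m x ∈ K m}, ?_, hs.isPreconnected_image_threads hK hb, hyK, ?_⟩
  · have : {x : s.Limit | ∀ m, s.proj m x ∈ K m} = ⋂ m, {x | s.proj m x ∈ K m} := by
      ext x; rw [mem_iInter]; rfl
    rw [this]
    exact isClosed_iInter fun m => isClosed_proj _ _
  · refine Subset.antisymm ?_ fun q hq => ?_
    · rintro _ ⟨x, hx, rfl⟩
      obtain ⟨C, -, -, hxC, hCQ⟩ := hx n le_rfl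
      exact hCQ x hxC
    -- Confluence of the bonding maps puts a vertex over `q` into the component at every level;
    -- compactness turns these into one point.
    · obtain ⟨x, hx⟩ := nonempty_iInter_of_antitone
        (fun d => {x : s.Limit | s.proj (n + d) x ∈ K (n + d)} ∩
          {x : s.Limit | s.proj n x ∈ ({q} : Set _)})
        (fun d => (isClosed_proj _ _).inter (isClosed_proj _ _))
        (fun d => by
          obtain ⟨C, hC, hyC, hCQ⟩ := (bondTo_mem n d).isConfluent.exists_pc hQ
            (a := s.proj (n + d) y) (by rw [bondTo_proj]; exact hy)
          obtain ⟨v, hv, hvq⟩ : q ∈ s.bondTo n d '' C := hCQ ▸ hq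
          obtain ⟨x, rfl⟩ := proj_surjective (n + d) v
          refine ⟨x, fun _ => ⟨C, hC, hyC, hv, fun ζ hζ => ?_⟩, ?_⟩
          · rw [← bondTo_proj n d, ← hCQ]
            exact mem_image_of_mem _ hζ
          · rw [bondTo_proj] at hvq
            exact hvq)
        (fun d x hx => ⟨hdown (Nat.le_succ (n + d)) x hx.1, hx.2⟩)
      rw [mem_iInter] at hx
      exact ⟨x, fun m => hdown (Nat.le_add_left m n) x (hx m).1, (hx 0).2⟩

/-- When `ps j` is close to `p`, a representative has its `n`-th coordinate in the trace of `K`, and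
confluence gives a continuum through `ps j` with the same `n`-th trace as `K`. The level `n` is then
allowed to grow with `j`. -/
theorem isKelleyContinuum (hs : s.HasExtension) : IsKelleyContinuum hs.Space := by
  classical
  refine ⟨hs.isOrderedDendroid.isContinuum, fun K hK p hp ps hps => ?_⟩
  let A := hs.mk ⁻¹' (K : Set hs.Space)
  have hA : IsClosed A := K.isCompact.isClosed.preimage hs.continuous_mk
  let Q : ∀ n, Set (s.F n).V := fun n => s.proj n '' A
  have hQ : ∀ n, (s.F n).PC (Q n) := fun n => hs.pc_proj_preimage hK.isPreconnected n
  choose y hy using fun j => hs.mk_surjective (ps j)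
  have hev : ∀ n, ∀ᶠ j in atTop, s.proj n (y j) ∈ Q n := by
    intro n
    filter_upwards [hps ((hs.isOpen_basic n (Q n)).mem_nhds (show p ∈ _ from fun x hx =>
      mem_image_of_mem _ (show hs.mk x ∈ (K : Set hs.Space) from hx ▸ hp)))] with j hj
    exact hj (y j) (hy j)
  have hex : ∀ n j, ∃ L : NonemptyCompacts hs.Space, IsConnected (L : Set hs.Space) ∧ ps j ∈ L ∧
      (s.proj n (y j) ∈ Q n → ∃ Z : Set s.Limit, (L : Set hs.Space) = hs.mk '' Z ∧
        s.proj n '' Z = Q n) := by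
    intro n j
    by_cases hj : s.proj n (y j) ∈ Q n
    · obtain ⟨Z, hZ, hZc, hyZ, hZQ⟩ := hs.exists_continuum_over (hQ n) hj
      have hmem : ps j ∈ hs.mk '' Z := ⟨y j, hyZ, hy j⟩
      exact ⟨⟨⟨hs.mk '' Z, (hs.isClosed_saturation hZ).isCompact⟩, ⟨_, hmem⟩⟩, ⟨⟨_, hmem⟩, hZc⟩, hmem,
        fun _ => ⟨Z, rfl, hZQ⟩⟩
    · exact ⟨⟨⟨{ps j}, isCompact_singleton⟩, singleton_nonempty _⟩, isConnected_singleton, rfl,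
        fun h => absurd h hj⟩
  choose L hL1 hL2 hL3 using hex
  -- The finest level up to `j` that can be used. If there is none the value is `0`, which is
  -- harmless because `L 0 j` is then the singleton of `ps j`.
  let N : ℕ → ℕ := fun j => Nat.findGreatest (fun n => s.proj n (y j) ∈ Q n) j
  have hN : ∀ n, ∀ᶠ j in atTop, n ≤ N j ∧ s.proj (N j) (y j) ∈ Q (N j) := by
    intro n
    filter_upwards [hev n, eventually_ge_atTop n] with j h1 h2
    exact ⟨Nat.le_findGreatest h2 h1, Nat.findGreatest_spec (P := fun n => s.proj n (y j) ∈ Q n) h2 h1⟩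
  refine ⟨fun j => L (N j) j, fun j => ⟨hL1 _ _, hL2 _ _⟩, tendsto_nonemptyCompacts ?_ ?_⟩
  · intro U hU hKU
    obtain ⟨n, hn⟩ := exists_tube hA (hU.preimage hs.continuous_mk) (preimage_mono hKU)
    filter_upwards [hN n] with j hj
    obtain ⟨Z, hLZ, hZQ⟩ := hL3 _ _ hj.2
    rw [hLZ]
    rintro _ ⟨x, hx, rfl⟩
    refine hn _ hj.1 x ?_
    change s.proj (N j) x ∈ Q (N j)
    rw [← hZQ]
    exact mem_image_of_mem _ hx
  · rintro U hU ⟨q, hqK, hqU⟩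
    obtain ⟨x, rfl⟩ := hs.mk_surjective q
    obtain ⟨n, hn⟩ := exists_cylinder (hU.preimage hs.continuous_mk) hqU
    filter_upwards [hN n] with j hj
    obtain ⟨Z, hLZ, hZQ⟩ := hL3 _ _ hj.2
    obtain ⟨z, hz, hzx⟩ : s.proj (N j) x ∈ s.proj (N j) '' Z := by
      rw [hZQ]
      exact mem_image_of_mem _ hqK
    rw [hLZ]
    exact ⟨hs.mk z, mem_image_of_mem _ hz, hn _ hj.1 z hzx⟩

/-! ### Endpoints -/

/-- Attach a leaf to a projection of `x`. A maximal point above a lift of the leaf still lies over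
the leaf, or is the class of that lift, and in both cases it is close to `x`. -/
theorem dense_endpoints (hs : s.HasExtension) : Dense {p : hs.Space | IsEndpoint p} := by
  rw [dense_iff_inter_open]
  rintro U hU ⟨q, hq⟩
  obtain ⟨x, rfl⟩ := hs.mk_surjective q
  obtain ⟨n, hn⟩ := exists_cylinder (hU.preimage hs.continuous_mk) hq
  obtain ⟨B, g, y, hg, hgy, hleaf⟩ := exists_leaf (s.F n) (s.proj n x)
  obtain ⟨k, h, hh, hgh⟩ := hs n B g hg
  obtain ⟨v, hv⟩ := hh.isEpi.surj y
  obtain ⟨z, rfl⟩ := proj_surjective k v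
  obtain ⟨q, hzq, hq⟩ := hs.isOrderedDendroid.exists_isMax_ge (hs.mk z)
  refine ⟨q, ?_, hs.isOrderedDendroid.isEndpoint_of_isMax hq⟩
  obtain ⟨w, rfl⟩ := hs.mk_surjective q
  rcases hs.mk_le_mk.1 hzq with h1 | h1
  · rw [← hs.mk_eq_iff.2 h1]
    refine hn n le_rfl z ?_
    rw [← hgh, hv, hgy]
  · refine hn n le_rfl w ?_
    have h2 := h1.map hh
    rw [hv] at h2
    rw [← hgh, hleaf _ h2, hgy]

end HasExtension

end TreeSequence

namespace FinRootedTree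

/-! ### Tripling -/

theorem exists_tree_of_parent {V : Type} [Finite V] [Nontrivial V] (root : V) (p : V → V)
    (rank : V → ℕ) (h : ∀ v, v ≠ root → rank (p v) < rank v) (hr : p root = root) :
    ∃ (B : FinRootedTree) (e : V ≃ B.V), e root = B.root ∧ ∀ v, B.parent (e v) = e (p v) := by
  refine ⟨ofParent root p rank h, Equiv.refl V, rfl, fun v => ?_⟩
  by_cases hv : v = root
  · subst hv
    exact (parent_root (T := ofParent v p rank h)).trans hr.symm
  · exact ofParent_parent root p rank h v hv

/-- Every tree `T` has a light confluent preimage in which three pairwise disjoint copies of the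
part of `T` above any vertex can be found. -/
theorem exists_tripling (T : FinRootedTree) :
    ∃ (B : FinRootedTree) (g : B.V → T.V), SimpleStarConfluent B T g ∧ ∀ t : B.V,
      ∃ R : Fin 3 → B.V → Prop,
        (∀ i z, T.le (g t) z → ∃ b, R i b ∧ g b = z ∧ B.le t b) ∧
        (∀ i j, i ≠ j → ∀ b b', R i b → R j b' → ∀ v, B.le v b → B.le v b' →
          T.le (g v) (g t)) := by
  -- A vertex of the cover is a vertex of `T` with a colouring of its root path by three colours;
  -- the head of the list is the topmost colour.
  let W := {q : T.V × List (Fin 3) // q.2.length = T.depth q.1}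
  have hfin : Finite W := by
    obtain ⟨v, hv⟩ := Finite.exists_max T.depth
    have : ({q : T.V × List (Fin 3) | q.2.length = T.depth q.1}).Finite :=
      (finite_univ.prod (List.finite_length_le (Fin 3) (T.depth v))).subset
        fun q hq => ⟨mem_univ _, (show q.2.length = T.depth q.1 from hq).le.trans (hv q.1)⟩
    exact this
  have hlift : ∀ a, ∃ w : W, w.1.1 = a := fun a =>
    ⟨⟨(a, List.replicate (T.depth a) 0), by simp⟩, rfl⟩
  have hnt : Nontrivial W := by
    obtain ⟨a, b, hab⟩ := exists_pair_ne T.V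
    obtain ⟨w, rfl⟩ := hlift a
    obtain ⟨w', rfl⟩ := hlift b
    exact ⟨w, w', fun h => hab (by rw [h])⟩
  let r : W := ⟨(T.root, []), by simp⟩
  let p : W → W := fun w => ⟨(T.parent w.1.1, w.1.2.tail), by
    rw [List.length_tail, w.2]
    by_cases h : w.1.1 = T.root
    · rw [h, parent_root, depth_root]
    · have := depth_parent_add_one h
      change _ = T.depth (T.parent w.1.1)
      omega⟩
  have hne : ∀ w : W, w ≠ r → w.1.1 ≠ T.root := by
    rintro ⟨⟨a, l⟩, hl⟩ hw rfl
    have : l = [] := List.eq_nil_of_length_eq_zero (hl.trans depth_root)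
    subst this
    exact hw rfl
  obtain ⟨B, e, her, hep⟩ := exists_tree_of_parent r p (fun w => T.depth w.1.1)
    (fun w hw => depth_parent_lt (hne w hw)) (Subtype.ext (Prod.ext parent_root rfl))
  have hner : ∀ w, e w ≠ B.root → w ≠ r := by
    rintro w hw rfl
    exact hw her
  have hp1 : ∀ w, (p w).1.1 = T.parent w.1.1 := fun _ => rfl
  have hp2 : ∀ w, (p w).1.2 = w.1.2.tail := fun _ => rfl
  have hg : IsLC B T (fun b => (e.symm b).1.1) := by
    refine ⟨by rw [← her, e.symm_apply_apply], fun b hb => ?_, fun b hb => ?_, fun b v hv hvb => ?_⟩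
    all_goals obtain ⟨w, rfl⟩ := e.surjective b
    · simpa using hne w (hner w hb)
    · simp [hep, hp1]
    · simp only [Equiv.symm_apply_apply] at hvb
      refine ⟨e ⟨(v, 0 :: w.1.2), ?_⟩, fun h => ?_, ?_, by simp⟩
      · have := depth_parent_add_one hv
        rw [hvb] at this
        simp [w.2, this]
      · rw [← her] at h
        exact hv (congrArg (fun w : W => w.1.1) (e.injective h))
      · rw [hep]
        exact congrArg e (Subtype.ext (Prod.ext hvb rfl))
  have hiter : ∀ n b, (e.symm (B.parent^[n] b)).1.2 = (e.symm b).1.2.drop n := by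
    intro n
    induction n with
    | zero => simp
    | succ n ih =>
      intro b
      obtain ⟨w, rfl⟩ := e.surjective b
      rw [Function.iterate_succ_apply, ih, hep]
      simp [hp2]
  -- The `i`-th copy consists of the vertices whose colouring extends that of `t` by the colour `i`
  -- alone.
  refine ⟨B, _, hg.simpleStarConfluent, fun t => ⟨fun i b => ∃ k, (e.symm b).1.2 =
    List.replicate k i ++ (e.symm t).1.2 ∧ T.le (e.symm t).1.1 (e.symm b).1.1, ?_, ?_⟩⟩
  · intro i z hz
    obtain ⟨τ, rfl⟩ := e.surjective t
    simp only [Equiv.symm_apply_apply] at hz ⊢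
    have hd := depth_le_of_le hz
    let b : W := ⟨(z, List.replicate (T.depth z - T.depth τ.1.1) i ++ τ.1.2), by
      simp only [List.length_append, List.length_replicate, τ.2]
      omega⟩
    refine ⟨e b, ⟨_, by rw [e.symm_apply_apply], by rw [e.symm_apply_apply]; exact hz⟩,
      by rw [e.symm_apply_apply], ?_⟩
    rw [le_iff_iterate]
    refine ⟨T.depth z - T.depth τ.1.1, e.symm.injective ?_⟩
    have h1 := hiter (T.depth z - T.depth τ.1.1) (e b)
    have h2 : T.le (e.symm (B.parent^[T.depth z - T.depth τ.1.1] (e b))).1.1 (e.symm (e b)).1.1 :=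
      hg.isRT.le (le_iff_iterate.2 ⟨_, rfl⟩)
    have h3 := (e.symm (B.parent^[T.depth z - T.depth τ.1.1] (e b))).2
    rw [e.symm_apply_apply] at h1 h2 ⊢
    rw [List.drop_left' (by simp)] at h1
    rw [h1, τ.2] at h3
    refine Subtype.ext (Prod.ext ?_ h1)
    rcases le_total_of_le h2 hz with h | h
    · exact eq_of_le_of_depth_le h h3.le
    · exact (eq_of_le_of_depth_le h h3.ge).symm
  · rintro i j hij b b' ⟨k, hb, hle⟩ ⟨k', hb', -⟩ v hv hv'
    have h1 : T.le (e.symm v).1.1 (e.symm b).1.1 := hg.isRT.le hv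
    obtain ⟨n, hn⟩ := le_iff_iterate.1 hv
    obtain ⟨n', hn'⟩ := le_iff_iterate.1 hv'
    have h2 := hiter n b
    have h3 := hiter n' b'
    rw [hn, hb] at h2
    rw [hn', hb'] at h3
    -- A common lower bound deeper than `t` would have both `i` and `j` as its topmost colour.
    have hdep : T.depth (e.symm v).1.1 ≤ T.depth (e.symm t).1.1 := by
      rw [← (e.symm v).2, ← (e.symm t).2]
      by_contra! hlt
      have hk : n < k := by
        rw [h2] at hlt
        simp only [List.length_drop, List.length_append, List.length_replicate] at hlt
        omega
      have hk' : n' < k' := by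
        rw [h3] at hlt
        simp only [List.length_drop, List.length_append, List.length_replicate] at hlt
        omega
      rw [List.drop_append_of_le_length (by simp; omega), List.drop_replicate] at h2 h3
      have h4 := List.append_cancel_right (h2.symm.trans h3)
      rw [show k - n = (k - n - 1) + 1 by omega, show k' - n' = (k' - n' - 1) + 1 by omega,
        List.replicate_succ, List.replicate_succ] at h4
      exact hij (List.cons.inj h4).1
    rcases le_total_of_le h1 hle with h | h
    · exact h
    · rw [eq_of_le_of_depth_le h hdep]
      exact le_refl _

end FinRootedTree

namespace TreeSequence

open FinRootedTree

variable {s : TreeSequence SimpleStarConfluent}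

namespace HasExtension

/-! ### Ramification points -/

/-- Points `z i` above the vertex `c`, which lies above `x` on the chain below `w` at level `k`. -/
def IsFan (x w : s.Limit) (k : ℕ) (z : Fin 3 → s.Limit) : Prop :=
  ∃ c, (s.F k).le (s.proj k x) c ∧ s.proj k x ≠ c ∧ (s.F k).le c (s.proj k w) ∧
    ∀ i, (s.F k).le c (s.proj k (z i))

/-- Otherwise the class of `x` would be separated from the rest of the connected image of the
interval from `x` to `w`: by `htop` that class contains no larger point. -/
theorem exists_between (hs : s.HasExtension) {x w : s.Limit} (hxw : s.Le x w)
    (htop : ∀ y, s.Le x y → s.Edge x y → y = x) {k : ℕ} (hk : s.proj k x ≠ s.proj k w) :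
    ∃ t, s.Le x t ∧ s.Le t w ∧ t ≠ x ∧ s.proj k t = s.proj k x := by
  by_contra! hno
  have hpre := isPreconnected_closed_iff.1 (hs.isPreconnected_image_Icc x w)
    {hs.mk x} (hs.mk '' ({z | s.Le x z} ∩ {z | s.Le z w} ∩ {z | s.proj k z ∈ ({s.proj k x}ᶜ : Set _)}))
    isClosed_singleton (hs.isClosed_saturation (by
      refine IsClosed.inter (IsClosed.inter ?_ ?_) (isClosed_proj _ _)
      · exact isClosed_le.preimage (f := fun z => (x, z)) (by fun_prop)
      · exact isClosed_le.preimage (f := fun z => (z, w)) (by fun_prop)))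
    (by
      rintro _ ⟨z, hz, rfl⟩
      by_cases h : s.proj k z = s.proj k x
      · left
        by_cases hzx : z = x
        · rw [hzx]; rfl
        · exact absurd h (hno z hz.1 hz.2 hzx)
      · exact Or.inr ⟨z, ⟨hz, h⟩, rfl⟩)
    ⟨hs.mk x, ⟨x, ⟨Le.refl x, hxw⟩, rfl⟩, rfl⟩
    ⟨hs.mk w, ⟨w, ⟨hxw, Le.refl w⟩, rfl⟩, w, ⟨⟨hxw, Le.refl w⟩, fun h => hk h.symm⟩, rfl⟩
  obtain ⟨_, -, rfl, z, hz, hzx⟩ := hpre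
  have := htop z hz.1.1 (hs.mk_eq_iff.1 hzx.symm)
  exact hz.2 (by rw [this]; rfl)

/-- Take `t` strictly above `x` with the same coordinate at level `k`, and triple the tree at a
level `n` where `t` and `x` are separated. Points over the three copies of what lies above `t` meet
only up to `t`, hence at level `k` only up to `x`. The lowest lift `t'` of the image of `t` below
`w` starts the next fan. -/
theorem IsFan.exists_next (hs : s.HasExtension) {x w : s.Limit} (hxw : s.Le x w)
    (htop : ∀ y, s.Le x y → s.Edge x y → y = x) {k : ℕ} {z : Fin 3 → s.Limit}
    (hz : IsFan x w k z) : ∃ (k' : ℕ) (z' : Fin 3 → s.Limit), IsFan x w k' z' ∧ k < k' ∧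
      (∀ i, s.proj k (z' i) = s.proj k (z i)) ∧ ∀ i j, i ≠ j → ∀ v : s.Limit,
        (s.F k').le (s.proj k' v) (s.proj k' (z' i)) →
        (s.F k').le (s.proj k' v) (s.proj k' (z' j)) → (s.F k).le (s.proj k v) (s.proj k x) := by
  obtain ⟨c, hxc, hne, hcw, hcz⟩ := hz
  have hkw : s.proj k x ≠ s.proj k w := fun h =>
    hne (FinRootedTree.le_antisymm hxc (h ▸ hcw))
  obtain ⟨t, hxt, htw, htx, htk⟩ := hs.exists_between hxw htop hkw
  obtain ⟨c', hc'w, hc', hlift⟩ := exists_lowest_lift (.id (s.F k)) (w := w) (c := c) hcw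
  simp only [id] at hc' hlift
  choose y hy hyk using fun i => hlift _ (hcz i)
  have htc : s.Le t c' := by
    refine (htw.total_of_le hc'w).resolve_right fun h => hne ?_
    have := h k
    rw [hc', htk] at this
    exact FinRootedTree.le_antisymm hxc this
  obtain ⟨k1, hk1⟩ := exists_not_le_proj fun h : s.Le t x => htx (h.antisymm hxt)
  obtain ⟨n, hn, hn'⟩ : ∃ n, k1 ≤ n ∧ k ≤ n := ⟨k1 + k, by omega, by omega⟩
  obtain ⟨B, g, hg, hB⟩ := exists_tripling (s.F n)
  obtain ⟨m, h, hh, hgh⟩ := hs n B g hg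
  obtain ⟨R, hR1, hR2⟩ := hB (h (s.proj m t))
  obtain ⟨t', ht'w, ht', hlift'⟩ := exists_lowest_lift hh (htw.map hh)
  have hex : ∀ i, ∃ z' : s.Limit, s.Le t' z' ∧ R i (h (s.proj m z')) ∧
      s.proj n z' = s.proj n (y i) := by
    intro i
    obtain ⟨b, hb1, hb2, hb3⟩ := hR1 i (s.proj n (y i)) (by rw [hgh]; exact (htc.trans (hy i)) n)
    obtain ⟨z', hz', hz''⟩ := hlift' b hb3
    exact ⟨z', hz', hz''.symm ▸ hb1, by rw [← hgh, hz'', hb2]⟩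
  choose z' hz'1 hz'2 hz'3 using hex
  have htn : s.proj n t' = s.proj n t := by rw [← hgh, ht', hgh]
  have hxt' : s.Le x t' := by
    refine (hxw.total_of_le ht'w).resolve_right fun h1 => hk1 n hn ?_
    rw [← htn]
    exact h1 n
  -- A level above `m` and `n` and strictly above `k`.
  refine ⟨m + n + k + 1, z', ⟨s.proj _ t', hxt' _, fun h1 => hk1 n hn ?_, ht'w _,
    fun i => hz'1 i _⟩, by omega, fun i => ?_, ?_⟩
  · rw [← htn, proj_eq_of_le (show n ≤ m + n + k + 1 by omega) h1]
    exact FinRootedTree.le_refl _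
  · rw [proj_eq_of_le hn' (hz'3 i), hyk]
  · intro i j hij v hvi hvj
    have hm : m ≤ m + n + k + 1 := by omega
    have h1 := hR2 i j hij _ _ (hz'2 i) (hz'2 j) (h (s.proj m v))
      (hh.isEpi.map_le _ _ (le_proj_of_le hm hvi)) (hh.isEpi.map_le _ _ (le_proj_of_le hm hvj))
    rw [hgh, hgh] at h1
    rw [← htk]
    exact le_proj_of_le hn' h1

/-- Iterated refinement keeps the coordinates already reached, so the fans converge. The limit
points stay away from `x` because of the first fan, and each refinement bounds their common lower
bounds by `x` at one more level. -/
theorem exists_three_above (hs : s.HasExtension) {x w : s.Limit} (hxw : s.Le x w) (hne : x ≠ w)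
    (htop : ∀ y, s.Le x y → s.Edge x y → y = x) :
    ∃ z : Fin 3 → s.Limit, (∀ i, s.Le x (z i) ∧ z i ≠ x) ∧
      ∀ i j, i ≠ j → ∀ v, s.Le v (z i) → s.Le v (z j) → s.Le v x := by
  let Fan := {q : ℕ × (Fin 3 → s.Limit) // IsFan x w q.1 q.2}
  have hstep : ∀ σ : Fan, ∃ σ' : Fan, σ.1.1 < σ'.1.1 ∧
      (∀ i, s.proj σ.1.1 (σ'.1.2 i) = s.proj σ.1.1 (σ.1.2 i)) ∧ ∀ i j, i ≠ j → ∀ v : s.Limit,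
        (s.F σ'.1.1).le (s.proj σ'.1.1 v) (s.proj σ'.1.1 (σ'.1.2 i)) →
        (s.F σ'.1.1).le (s.proj σ'.1.1 v) (s.proj σ'.1.1 (σ'.1.2 j)) →
        (s.F σ.1.1).le (s.proj σ.1.1 v) (s.proj σ.1.1 x) := by
    rintro ⟨⟨k, z⟩, hz⟩
    obtain ⟨k', z', hz', h⟩ := IsFan.exists_next hs hxw htop hz
    exact ⟨⟨(k', z'), hz'⟩, h⟩
  choose f hf1 hf2 hf3 using hstep
  obtain ⟨k0, hk0⟩ := exists_proj_ne hne
  -- Initially all three points are `w`; the separation is done by the refinements.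
  let σ0 : Fan := ⟨(k0, fun _ => w), s.proj k0 w, hxw k0, hk0 k0 le_rfl, FinRootedTree.le_refl _,
    fun _ => FinRootedTree.le_refl _⟩
  let σ : ℕ → Fan := fun n => f^[n] σ0
  have hσ : ∀ n, σ (n + 1) = f (σ n) := fun n => Function.iterate_succ_apply' f n σ0
  have hk : ∀ n, n ≤ (σ n).1.1 := by
    intro n
    induction n with
    | zero => exact Nat.zero_le _
    | succ n ih =>
      have := hf1 (σ n)
      rw [← hσ] at this
      omega
  have hz : ∀ i, ∃ z : s.Limit, ∀ n, s.proj (σ n).1.1 z = s.proj (σ n).1.1 ((σ n).1.2 i) := by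
    intro i
    obtain ⟨z, hz⟩ := nonempty_iInter_of_antitone
      (fun n => {z : s.Limit | s.proj (σ n).1.1 z ∈ ({s.proj (σ n).1.1 ((σ n).1.2 i)} : Set _)})
      (fun n => isClosed_proj _ _) (fun n => ⟨_, rfl⟩)
      (fun n z (hz : _ = _) => by
        have h1 := hf1 (σ n)
        have h2 := hf2 (σ n) i
        rw [← hσ] at h1 h2
        exact (proj_eq_of_le h1.le hz).trans h2)
    rw [mem_iInter] at hz
    exact ⟨z, hz⟩
  choose z hz using hz
  refine ⟨z, fun i => ⟨fun n => le_proj_of_le (hk n) ?_, ?_⟩, fun i j hij v hvi hvj n =>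
    le_proj_of_le (hk n) ?_⟩
  · obtain ⟨c, h1, -, -, h2⟩ := (σ n).2
    rw [hz]
    exact FinRootedTree.le_trans h1 (h2 i)
  · rintro h
    obtain ⟨c, h1, h3, -, h2⟩ := (σ 0).2
    have h4 := h2 i
    rw [← hz, h] at h4
    exact h3 (FinRootedTree.le_antisymm h1 h4)
  · have h3 := hf3 (σ n) i j hij v
    rw [← hσ, ← hz, ← hz] at h3
    exact h3 (hvi _) (hvj _)

/-- An edge class has at most two points, and they are comparable. -/
theorem exists_top (hs : s.HasExtension) (p : hs.Space) :
    ∃ x, hs.mk x = p ∧ ∀ y, s.Le x y → s.Edge x y → y = x := by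
  obtain ⟨x, rfl⟩ := hs.mk_surjective p
  by_cases h : ∀ y, s.Le x y → s.Edge x y → y = x
  · exact ⟨x, rfl, h⟩
  · push Not at h
    obtain ⟨y, hxy, he, hne⟩ := h
    refine ⟨y, (hs.mk_eq_iff.2 he).symm, fun z hyz he' => ?_⟩
    rcases hs.edge_eq_or_eq he he' with h | h | h
    · exact absurd h.symm hne
    · exact h.symm
    · subst h
      exact hxy.antisymm hyz

/-- A maximal point is an endpoint. Otherwise the top representative `x` has three points above it
whose pairwise common lower bounds are below `x`. They are pairwise incomparable and nonadjacent, so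
passing to classes creates no further common lower bounds. -/
theorem isEndpoint_or_isRamificationPoint (hs : s.HasExtension) (p : hs.Space) :
    IsEndpoint p ∨ IsRamificationPoint p := by
  have hO := hs.isOrderedDendroid
  by_cases hmax : ∀ q, p ≤ q → q = p
  · exact Or.inl (hO.isEndpoint_of_isMax hmax)
  right
  push Not at hmax
  obtain ⟨q, hpq, hne⟩ := hmax
  obtain ⟨x, rfl, htop⟩ := hs.exists_top p
  obtain ⟨w, rfl⟩ := hs.mk_surjective q
  have hxw : s.Le x w := (hs.mk_le_mk.1 hpq).resolve_left fun h => hne (hs.mk_eq_iff.2 h.symm)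
  obtain ⟨z, hz, hmeet⟩ := hs.exists_three_above hxw (fun h => hne (by rw [h])) htop
  have hne' : ∀ i j, i ≠ j → ¬ s.Le (z i) (z j) := fun i j hij h =>
    (hz i).2 ((hmeet i j hij _ (Le.refl _) h).antisymm (hz i).1)
  have hne'' : ∀ i j, i ≠ j → ¬ s.Edge (z i) (z j) := fun i j hij h =>
    h.le_total.elim (hne' i j hij) (hne' j i hij.symm)
  refine hO.isRamificationPoint (fun i => hs.mk (z i)) (fun i => ?_) ?_
  · refine lt_of_le_of_ne (hs.mk_le_mk.2 (Or.inr (hz i).1)) fun h => (hz i).2 ?_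
    exact htop _ (hz i).1 (hs.mk_eq_iff.1 h)
  · intro i j hij q hqi hqj
    obtain ⟨v, rfl⟩ := hs.mk_surjective q
    have key : ∀ i j, i ≠ j → s.Edge v (z i) → ¬ hs.mk v ≤ hs.mk (z j) := by
      intro i j hij he hle
      rw [hs.mk_eq_iff.2 he, hs.mk_le_mk] at hle
      exact hle.elim (hne'' i j hij) (hne' i j hij)
    rcases hs.mk_le_mk.1 hqi with h1 | h1
    · exact absurd hqj (key i j hij h1)
    · rcases hs.mk_le_mk.1 hqj with h2 | h2
      · exact absurd hqi (key j i hij.symm h2)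
      · exact hs.mk_le_mk.2 (Or.inr (hmeet i j hij v h1 h2))

end HasExtension

end TreeSequence

/-! ### The main theorem. -/

theorem theorem8p30 :
    (∃ s : TreeSequence FinRootedTree.SimpleStarConfluent, s.IsProjectiveFraisseLimit) ∧
    ∀ s : TreeSequence FinRootedTree.SimpleStarConfluent, s.IsProjectiveFraisseLimit →
      ∃ h : ∀ x y z, s.Edge x y → s.Edge y z → s.Edge x z,
        IsKelleyContinuum (s.Realization h) ∧
        IsDendroid (s.Realization h) ∧
        IsSmoothDendroid (s.Realization h) ∧
        Dense {p : s.Realization h | IsEndpoint p} ∧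
        ∀ p : s.Realization h, IsEndpoint p ∨ IsRamificationPoint p := by
  refine ⟨⟨_, FinRootedTree.genericSequence_hasExtension.isProjectiveFraisseLimit⟩, fun s h => ?_⟩
  have hs := h.hasExtension
  exact ⟨hs.edge_trans, hs.isKelleyContinuum, hs.isOrderedDendroid.isDendroid,
    hs.isOrderedDendroid.isSmoothDendroid, hs.dense_endpoints,
    hs.isEndpoint_or_isRamificationPoint⟩
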